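/- **Parameters.** Let $N,N_1,N_2\in\mathbb N$ with $N_1<N$ and $1\le N_2\le N-N_1$; $\gamma\ge 0$; $2<\alpha\le 4$; and let the bandwidth $W$, rate demand $R_0$, backhaul capacity $C_b$, user density $\lambda_u$, station densities $\lambda_1,\lambda_2$ and transmit powers $P_1,P_2$ be positive. Content $n\in\{1,\dots,N\}$ has popularity $q_n=n^{-\gamma}/\sum_{i=1}^N i^{-\gamma}$; $\mathrm{Mp}=\{1,\dots,N_1\}$, $\mathrm{Lp}=\{N_1+1,\dots,N\}$, $Q_{Mp}=\sum_{n\in \mathrm{Mp}}q_n$, $Q_{Lp}=\sum_{n\in \mathrm{Lp}}q_n$, $p_{Lp}=N_2/(N-N_1)$. Put $\lambda_1'=\lambda_1$, $\lambda_2'=p_{Lp}\lambda_2$, $$A_{Lp,k}=\frac{\lambda_k'P_k^{2/\alpha}}{\sum_{i=1}^2\lambda_i'P_i^{2/\alpha}},\quad A_1=Q_{Mp}+Q_{Lp}A_{Lp,1},\quad A_2=Q_{Lp}A_{Lp,2},\quad p_b=\frac{Q_{Lp}A_{Lp,1}}{A_1},\quad N_b=\lfloor C_b/R_0\rfloor ,$$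 $$P_{L_k}(l+1)=\frac{3.5^{3.5}}{l!}\frac{\Gamma(l+4.5)}{\Gamma(3.5)}\Big(\frac{A_k\lambda_u}{\lambda_k}\Big)^{l}\Big(3.5+\frac{A_k\lambda_u}{\lambda_k}\Big)^{-(l+4.5)}\quad(l\ge 0),$$ $$p_a=1-\int_0^\infty e^{-\lambda_u x}f_S(x)\,dx,\qquad f_S(x)=\frac{3.5^{3.5}}{\Gamma(3.5)}\Big(\frac{\lambda_2}{A_2}\Big)^{3.5}x^{2.5}e^{-3.5\lambda_2x/A_2}.$$ **Model.** The following are mutually independent. The macro base stations (MBSs, tier $1$) and helpers (tier $2$) form Poisson point processes in $\mathbb R^2$ of intensities $\lambda_1,\lambda_2$. All channels have i.i.d. fading gains $h\sim\exp(1)$. Each helper stores $N_2$ contents of $\mathrm{Lp}$, each with probability $p_{Lp}$, and is active with probability $p_a$. The load (number of served users, the tagged user included) of the serving station, if it is of tier $k$, is $L_k$, with $\Pr(L_k=l+1)=P_{L_k}(l+1)$. Each other user of the serving MBS needs the backhaul link with probability $p_b$. The tagged user, at the origin and requesting content $n$, is served by the station with the largest $P_k z^{-\alpha}$ ($z$ its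 distance) among all MBSs and the helpers that store $n$. All MBSs and all active helpers other than the serving station interfere; the noise power is $\sigma^2\ge0$. With $k$ the serving tier, the access rate is $$R=\frac{W}{L_k}\log_2\Big(1+\frac{P_k h z^{-\alpha}}{I+\sigma^2}\Big),\qquad I=\sum P_i h_{i,j}z_{i,j}^{-\alpha}\ \text{ over the interfering stations.}$$ If the tagged user needs the backhaul link together with $m$ other users of its MBS, then $\min(N_b,m+1)$ of these $m+1$ users, chosen uniformly at random, get the backhaul rate $R_0$ and the others get $0$. **Average successful delivery rate.** With $Z$ the serving distance and $L$ the load of the serving station, let $$R^{suc}_{n,k}=\mathbb E\big[\mathbf 1\{\text{serving tier}=k\}\;\mathbb E(R\mid R\ge R_0,Z,L,\text{serving tier})\big],$$ $C^w_{n,1}=\Pr(R\ge R_0,\ \text{serving tier}=1)$, and let $C^b_{n,1}$ be the probability that the backhaul rate is at least $R_0$ given serving tier $1$ (and $C^b_{n,1}(l+1)$ the same given also $L_1=l+1$), all for a request for content $n$. The average successful delivery rate is the combination over the requested content and the three ways of delivery $$R^{suc}=\sum_{n\in \mathrm{Mp}}q_nR^{suc}_{n,1}+\sum_{n\in \mathrm{Lp}}q_n\big(R^{suc}_{n,2}+\Pr(\text{serving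 tier}=1)\,C^w_{n,1}\,C^b_{n,1}\,R_0\big).$$ **Closed expressions.** Let $B$ be the Beta function, ${}_2F_1$ the Gauss hypergeometric function, $$G(x,y)=\frac{2x}{y-2}\,{}_2F_1\Big(1,1-\frac2y;2-\frac2y;-x\Big),\qquad H(x,y)=\frac2y\,x^{2/y}B\Big(\frac2y,1-\frac2y\Big),$$ $G^*(x_1,x_2,y)=G(x_1,y)-G(x_2,y)$, $H^*(x_1,x_2,y)=H(x_1,y)-H(x_2,y)$, $\delta^r_l=2^{(l+1)r/W}-1$, $\delta_l=\delta_l^{R_0}$, and $$\xi_k=\frac{\lambda_1P_1^{2/\alpha}+p_ap_{Lp}\lambda_2P_2^{2/\alpha}}{\lambda_k'P_k^{2/\alpha}},\quad \varsigma_k=\frac{p_a(1-p_{Lp})\lambda_2P_2^{2/\alpha}}{\lambda_k'P_k^{2/\alpha}},\quad \zeta_k=\frac{\lambda_1P_1^{2/\alpha}+p_{Lp}\lambda_2P_2^{2/\alpha}}{\lambda_k'P_k^{2/\alpha}},$$ $$\tilde R^{suc}_{Mp,1}=R_0+\int_{R_0}^\infty\sum_{l=0}^\infty\Big(G^*(\delta^r_l,\delta_l,\alpha)+p_a\frac{\lambda_2}{\lambda_1}\Big(\frac{P_2}{P_1}\Big)^{2/\alpha}H^*(\delta^r_l,\delta_l,\alpha)+1\Big)^{-1}P_{L_1}(l+1)\,dr,$$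 $$\tilde R^{suc}_{Lp,2}=A_{Lp,2}R_0+\int_{R_0}^\infty\sum_{l=0}^\infty\big(\xi_2G^*(\delta^r_l,\delta_l,\alpha)+\varsigma_2H^*(\delta^r_l,\delta_l,\alpha)+\zeta_2\big)^{-1}P_{L_2}(l+1)\,dr,$$ $$\tilde C^w_{Lp,1}=\sum_{l=0}^\infty\big(\xi_1G(\delta_l,\alpha)+\varsigma_1H(\delta_l,\alpha)+\zeta_1\big)^{-1}P_{L_1}(l+1),$$ $$C^b_{Lp,1}(l+1)=\sum_{m=0}^{l}\binom lm(1-p_b)^{l-m}p_b^m\min\Big\{1,\frac{N_b}{m+1}\Big\},\qquad C^b_{Lp,1}=\sum_{l=0}^\infty C^b_{Lp,1}(l+1)P_{L_1}(l+1).$$ **Corollary.** In the interference-limited scenario, that is, for $\sigma^2=0$ and likewise in the limit $\sigma^2\downarrow0$, the average successful delivery rate is $$\tilde R^{suc}=Q_{Mp}\tilde R^{suc}_{Mp,1}+Q_{Lp}\tilde R^{suc}_{Lp,2}+Q_{Lp}A_{Lp,1}\tilde C^w_{Lp,1}C^b_{Lp,1}R_0,$$ where all sums and integrals over $r$ converge.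 Moreover (again for $\sigma^2=0$ and as $\sigma^2\downarrow0$) $R^{suc}_{n,1}$ is $\tilde R^{suc}_{Mp,1}$ for $n\in\mathrm{Mp}$, and for $n\in\mathrm{Lp}$, $R^{suc}_{n,2}$ is $\tilde R^{suc}_{Lp,2}$ and $C^w_{n,1}$ is $\tilde C^w_{Lp,1}$. For $n\in\mathrm{Lp}$, regardless of the noise, the probability of association with tier $k$ is $A_{Lp,k}$, $C^b_{n,1}(l+1)=C^b_{Lp,1}(l+1)$ for every $l\ge0$, and $C^b_{n,1}=C^b_{Lp,1}$. -/

import Mathlib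

open MeasureTheory ProbabilityTheory Filter Topology

noncomputable section

namespace HetNet

/-! ### Special functions -/

/-- Gauss hypergeometric function `₂F₁(a, b; c; z)` for real `0 < b < c` and `z < 1`, by the Euler
integral. (The power series converges only for `|z| < 1`, while negative arguments of arbitrary
size are needed here.) -/
def gauss2F1 (a b c z : ℝ) : ℝ :=
  Real.Gamma c / (Real.Gamma b * Real.Gamma (c - b)) *
    ∫ t in (0 : ℝ)..1, t ^ (b - 1) * (1 - t) ^ (c - b - 1) * (1 - z * t) ^ (-a)

/-- Interference function of the stations that lie outside an exclusion disc. -/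
def G (x y : ℝ) : ℝ := 2 * x / (y - 2) * gauss2F1 1 (1 - 2 / y) (2 - 2 / y) (-x)

/-- Interference function of the stations spread over the whole plane;
`beta` is Mathlib's (real) Beta function. -/
def H (x y : ℝ) : ℝ := 2 / y * x ^ (2 / y) * beta (2 / y) (1 - 2 / y)

def GStar (x₁ x₂ y : ℝ) : ℝ := G x₁ y - G x₂ y

def HStar (x₁ x₂ y : ℝ) : ℝ := H x₁ y - H x₂ y

/-! ### Parameters of the network -/

/-- Tiers are numbered from zero: `0` is the tier of macro base stations (MBSs),
`1` is the tier of helpers. -/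
abbrev Tier := Fin 2

/-- A base station: the `j`-th one of tier `k` is `(k, j)`. -/
abbrev Station := Tier × ℕ

structure Params where
  /-- size of the content library; the contents are `1, …, N` by decreasing popularity -/
  N : ℕ
  /-- cache size of an MBS, which is also the size of the first content group `{1, …, N₁}` -/
  N₁ : ℕ
  /-- cache size of a helper -/
  N₂ : ℕ
  /-- Zipf exponent -/
  γ : ℝ
  /-- path loss exponent -/
  α : ℝ
  /-- system bandwidth -/
  W : ℝ
  /-- rate demand -/
  R₀ : ℝ
  /-- backhaul capacity of an MBS -/
  Cb : ℝ
  /-- density of the users -/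
  lamU : ℝ
  /-- density of the stations of each tier -/
  lam : Tier → ℝ
  /-- transmission power of the stations of each tier -/
  P : Tier → ℝ

namespace Params

structure Valid (p : Params) : Prop where
  N₁_lt : p.N₁ < p.N
  N₂_pos : 0 < p.N₂
  N₂_le : p.N₂ ≤ p.N - p.N₁
  γ_nonneg : 0 ≤ p.γ
  two_lt_α : 2 < p.α
  α_le_four : p.α ≤ 4
  W_pos : 0 < p.W
  R₀_pos : 0 < p.R₀
  Cb_pos : 0 < p.Cb
  lamU_pos : 0 < p.lamU
  lam_pos : ∀ k, 0 < p.lam k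
  P_pos : ∀ k, 0 < p.P k

variable (p : Params)

/-- The first (most popular) content group. -/
def Mp : Finset ℕ := Finset.Icc 1 p.N₁

/-- The second (less popular) content group. -/
def Lp : Finset ℕ := Finset.Icc (p.N₁ + 1) p.N

/-- Zipf popularity of the `n`-th content. -/
def q (n : ℕ) : ℝ := (n : ℝ) ^ (-p.γ) / ∑ i ∈ Finset.Icc 1 p.N, (i : ℝ) ^ (-p.γ)

def QMp : ℝ := ∑ n ∈ p.Mp, p.q n

def QLp : ℝ := ∑ n ∈ p.Lp, p.q n

/-- Caching probability of a content of the second group in a helper. -/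
def pLp : ℝ := (p.N₂ : ℝ) / (p.Lp.card : ℝ)

/-- Equivalent densities `λ'₁ = λ₁`, `λ'₂ = p_Lp λ₂`. -/
def lam' (k : Tier) : ℝ := if k = 0 then p.lam 0 else p.pLp * p.lam 1

/-- Association probability with tier `k` for a request from the second group. -/
def ALp (k : Tier) : ℝ :=
  p.lam' k * p.P k ^ (2 / p.α) / ∑ i : Tier, p.lam' i * p.P i ^ (2 / p.α)

/-- Overall association probability with tier `k`. -/
def A (k : Tier) : ℝ := if k = 0 then p.QMp + p.QLp * p.ALp 0 else p.QLp * p.ALp 1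

/-- Probability that a user of an MBS needs the backhaul link. -/
def pb : ℝ := p.QLp * p.ALp 0 / p.A 0

/-- Probability that the load of a station of tier `k` that serves the tagged user is `l + 1`. -/
def loadPMF (k : Tier) (l : ℕ) : ℝ :=
  (3.5 : ℝ) ^ (3.5 : ℝ) / (l.factorial : ℝ) * (Real.Gamma ((l : ℝ) + 4.5) / Real.Gamma 3.5) *
    (p.A k * p.lamU / p.lam k) ^ l *
    (3.5 + p.A k * p.lamU / p.lam k) ^ (-((l : ℝ) + 4.5))

/-- Density of the area of the coverage region of a helper. -/
def coverageDensity (x : ℝ) : ℝ :=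
  (3.5 : ℝ) ^ (3.5 : ℝ) / Real.Gamma 3.5 * (p.lam 1 / p.A 1) ^ (3.5 : ℝ) * x ^ (2.5 : ℝ) *
    Real.exp (-(3.5 * p.lam 1 * x / p.A 1))

/-- Probability that a helper is active, that is, that its coverage region contains a user. -/
def pa : ℝ :=
  1 - ∫ x in Set.Ioi (0 : ℝ), Real.exp (-(p.lamU * x)) * p.coverageDensity x

/-- Number of users whose rate demand the backhaul link of an MBS can support. -/
def Nb : ℕ := ⌊p.Cb / p.R₀⌋₊

/-- SINR threshold for the rate `r` under the load `l + 1`. -/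
def δ (r : ℝ) (l : ℕ) : ℝ := (2 : ℝ) ^ (((l : ℝ) + 1) * r / p.W) - 1

/-- `ξ_k`. -/
def ξ (k : Tier) : ℝ :=
  (p.lam 0 * p.P 0 ^ (2 / p.α) + p.pa * p.pLp * p.lam 1 * p.P 1 ^ (2 / p.α)) /
    (p.lam' k * p.P k ^ (2 / p.α))

/-- `ς_k`. -/
def vs (k : Tier) : ℝ :=
  p.pa * (1 - p.pLp) * p.lam 1 * p.P 1 ^ (2 / p.α) / (p.lam' k * p.P k ^ (2 / p.α))

/-- `ζ_k`. -/
def ζ (k : Tier) : ℝ :=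
  (p.lam 0 * p.P 0 ^ (2 / p.α) + p.pLp * p.lam 1 * p.P 1 ^ (2 / p.α)) /
    (p.lam' k * p.P k ^ (2 / p.α))

/-! ### The closed expressions -/

/-- `Σ_l (G* + p_a λ̂₂₁ P̂₂₁^(2/α) H* + 1)⁻¹ P_{L₁}(l + 1)`, term `l`. -/
def termMp (r : ℝ) (l : ℕ) : ℝ :=
  (GStar (p.δ r l) (p.δ p.R₀ l) p.α +
      p.pa * (p.lam 1 / p.lam 0) * (p.P 1 / p.P 0) ^ (2 / p.α) *
        HStar (p.δ r l) (p.δ p.R₀ l) p.α + 1)⁻¹ * p.loadPMF 0 l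

/-- `Σ_l (ξ₂ G* + ς₂ H* + ζ₂)⁻¹ P_{L₂}(l + 1)`, term `l`. -/
def termLp (r : ℝ) (l : ℕ) : ℝ :=
  (p.ξ 1 * GStar (p.δ r l) (p.δ p.R₀ l) p.α +
      p.vs 1 * HStar (p.δ r l) (p.δ p.R₀ l) p.α + p.ζ 1)⁻¹ * p.loadPMF 1 l

/-- `R̃^suc_{Mp,1}`. -/
def rateMp : ℝ := p.R₀ + ∫ r in Set.Ioi p.R₀, ∑' l : ℕ, p.termMp r l

/-- `R̃^suc_{Lp,2}`. -/
def rateLp : ℝ := p.ALp 1 * p.R₀ + ∫ r in Set.Ioi p.R₀, ∑' l : ℕ, p.termLp r l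

/-- Term `l` of `C̃^w_{Lp,1}`. -/
def termAccess (l : ℕ) : ℝ :=
  (p.ξ 0 * G (p.δ p.R₀ l) p.α + p.vs 0 * H (p.δ p.R₀ l) p.α + p.ζ 0)⁻¹ * p.loadPMF 0 l

/-- `C̃^w_{Lp,1}`. -/
def accessLp : ℝ := ∑' l : ℕ, p.termAccess l

/-- `C^b_{Lp,1}(l + 1)`: successful backhaul delivery probability under the load `l + 1`. -/
def backhaulAt (l : ℕ) : ℝ :=
  ∑ m ∈ Finset.range (l + 1),
    (l.choose m : ℝ) * (1 - p.pb) ^ (l - m) * p.pb ^ m * min 1 ((p.Nb : ℝ) / ((m : ℝ) + 1))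

/-- `C^b_{Lp,1}`: average of `C^b_{Lp,1}(l + 1)` over the load. -/
def backhaul : ℝ := ∑' l : ℕ, p.backhaulAt l * p.loadPMF 0 l

end Params

/-! ### The random network -/

abbrev Plane := EuclideanSpace ℝ (Fin 2)

/-- `x 0, x 1, …` are the points of a homogeneous Poisson point process of intensity `lam` in the
plane: the numbers of points in sets of finite area are Poisson, and independent for disjoint
sets. -/
structure IsPoissonProcess {Ω : Type*} [MeasurableSpace Ω] (x : ℕ → Ω → Plane) (lam : ℝ)
    (μ : Measure Ω) : Prop where
  measurable : ∀ j, Measurable (x j)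
  count_law : ∀ B : Set Plane, MeasurableSet B → volume B ≠ ⊤ → ∀ i : ℕ,
    μ.real {ω | {j | x j ω ∈ B}.encard = i} =
      Real.exp (-(lam * volume.real B)) * (lam * volume.real B) ^ i / (i.factorial : ℝ)
  count_indep : ∀ (m : ℕ) (B : Fin m → Set Plane), (∀ i, MeasurableSet (B i)) →
    (∀ i, volume (B i) ≠ ⊤) → Pairwise (fun i i' => Disjoint (B i) (B i')) →
    iIndepFun (fun i ω => {j | x j ω ∈ B i}.encard) μ

/-- Labels of the independent sources of randomness. -/
inductive Source
  | pos (k : Tier)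
  | fade (b : Station)
  | cache (j : ℕ)
  | active (j : ℕ)
  | load (k : Tier)
  | miss (i : ℕ)
  | pick (m : ℕ)

/-- The random elements of the network seen by the tagged user at the origin. -/
structure Elements (Ω : Type*) where
  /-- position of the station `(k, j)` -/
  pos : Tier → ℕ → Ω → Plane
  /-- power gain of the fading channel from a station -/
  fade : Station → Ω → ℝ
  /-- set of contents stored by the `j`-th helper -/
  cache : ℕ → Ω → Finset ℕ
  /-- whether the `j`-th helper is active (has users to serve) -/
  active : ℕ → Ω → Bool
  /-- load (the tagged user included) of the serving station, if this is of tier `k` -/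
  load : Tier → Ω → ℕ
  /-- whether the `i`-th other user of the serving MBS needs the backhaul link -/
  miss : ℕ → Ω → Bool
  /-- the users picked for the backhaul link when the tagged user, labelled `0`, competes with
  `m` further ones, labelled `1, …, m` -/
  pick : ℕ → Ω → Finset ℕ

namespace Elements

variable {Ω : Type*} (X : Elements Ω)

/-- The σ-algebra generated by a source of randomness. -/
@[reducible] def sigma : Source → MeasurableSpace Ω
  | .pos k => MeasurableSpace.comap (fun ω j => X.pos k j ω) inferInstance
  | .fade b => MeasurableSpace.comap (X.fade b) inferInstance
  | .cache j => MeasurableSpace.comap (X.cache j) ⊤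
  | .active j => MeasurableSpace.comap (X.active j) ⊤
  | .load k => MeasurableSpace.comap (X.load k) ⊤
  | .miss i => MeasurableSpace.comap (X.miss i) ⊤
  | .pick m => MeasurableSpace.comap (X.pick m) ⊤

/-- The probabilistic model. -/
structure Law (p : Params) [MeasurableSpace Ω] (μ : Measure Ω) : Prop where
  /-- all random elements are measurable … -/
  sigma_le : ∀ s, X.sigma s ≤ ‹MeasurableSpace Ω›
  /-- … and mutually independent -/
  indep : iIndep X.sigma μ
  /-- the stations of each tier form a Poisson process -/
  pos_law : ∀ k, IsPoissonProcess (X.pos k) (p.lam k) μ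
  /-- Rayleigh fading -/
  fade_law : ∀ b, μ.map (X.fade b) = expMeasure 1
  /-- a helper stores `N₂` contents of the second group … -/
  cache_subset : ∀ j ω, X.cache j ω ⊆ p.Lp
  cache_card : ∀ j ω, (X.cache j ω).card = p.N₂
  /-- … each of them with the same probability -/
  cache_law : ∀ j, ∀ n ∈ p.Lp, μ.real {ω | n ∈ X.cache j ω} = p.pLp
  active_law : ∀ j, μ.real {ω | X.active j ω = true} = p.pa
  load_law : ∀ k l, μ.real {ω | X.load k ω = l + 1} = p.loadPMF k l
  miss_law : ∀ i, μ.real {ω | X.miss i ω = true} = p.pb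
  /-- all `m + 1` users are picked if `m + 1 ≤ N_b`, otherwise a uniformly random set of `N_b`
  of them -/
  pick_law : ∀ m, ∀ S ∈ Finset.powersetCard (min p.Nb (m + 1)) (Finset.range (m + 1)),
    μ.real {ω | X.pick m ω = S} = 1 / ((m + 1).choose (min p.Nb (m + 1)) : ℝ)

variable (p : Params)

/-- Distance of a station from the tagged user. -/
def dist (b : Station) (ω : Ω) : ℝ := ‖X.pos b.1 b.2 ω‖

/-- Stations that can deliver content `n`: all MBSs (from the cache if `n` is in the first group,
through the backhaul link otherwise) and the helpers that store `n`. -/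
def candidates (n : ℕ) (ω : Ω) : Set Station := {b | b.1 = 0 ∨ n ∈ X.cache b.2 ω}

/-- Candidates of maximal average received power `P_k z^(-α)`. -/
def strongest (n : ℕ) (ω : Ω) : Set Station :=
  {b | b ∈ X.candidates n ω ∧ ∀ b' ∈ X.candidates n ω,
    p.P b'.1 * X.dist b' ω ^ (-p.α) ≤ p.P b.1 * X.dist b ω ^ (-p.α)}

open Classical in
/-- The serving station: the strongest candidate. (It exists and is unique almost surely; otherwise
ties are broken by an enumeration of the stations, with a default if there is none.) -/
def serving (n : ℕ) (ω : Ω) : Station :=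
  if h : (X.strongest p n ω).Nonempty then
    Function.argminOn (Encodable.encode : Station → ℕ) (X.strongest p n ω) h
  else (0, 0)

def servingTier (n : ℕ) (ω : Ω) : Tier := (X.serving p n ω).1

def servingDist (n : ℕ) (ω : Ω) : ℝ := X.dist (X.serving p n ω) ω

def servingLoad (n : ℕ) (ω : Ω) : ℕ := X.load (X.servingTier p n ω) ω

/-- Received power from a station. -/
def received (b : Station) (ω : Ω) : ℝ := p.P b.1 * X.fade b ω * X.dist b ω ^ (-p.α)

open Classical in
/-- Total interference: all MBSs and all active helpers transmit, except the serving station. -/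
def interference (n : ℕ) (ω : Ω) : ℝ :=
  ∑' b : Station,
    if b ≠ X.serving p n ω ∧ (b.1 = 0 ∨ X.active b.2 ω = true) then X.received p b ω else 0

/-- Signal to interference plus noise ratio, with noise power `s = σ²`. -/
def sinr (s : ℝ) (n : ℕ) (ω : Ω) : ℝ :=
  X.received p (X.serving p n ω) ω / (X.interference p n ω + s)

/-- Access delivery rate for content `n`. -/
def rate (s : ℝ) (n : ℕ) (ω : Ω) : ℝ :=
  p.W / (X.servingLoad p n ω : ℝ) * Real.logb 2 (1 + X.sinr p s n ω)

/-- Number of other users of the serving MBS that need the backhaul link. -/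
def missCount (ω : Ω) : ℕ :=
  ((Finset.range (X.load 0 ω - 1)).filter (fun i => X.miss i ω = true)).card

/-- Backhaul delivery rate of the tagged user: the rate demand if it is picked, otherwise zero. -/
def backhaulRate (ω : Ω) : ℝ := if 0 ∈ X.pick (X.missCount ω) ω then p.R₀ else 0

/-- The σ-algebra generated by serving tier, serving distance and load. -/
@[reducible] def info (n : ℕ) : MeasurableSpace Ω :=
  MeasurableSpace.comap
    (fun ω => (X.servingTier p n ω, X.servingDist p n ω, X.servingLoad p n ω)) inferInstance

/-- The event that the access delivery rate meets the demand. -/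
def success (s : ℝ) (n : ℕ) : Set Ω := {ω | p.R₀ ≤ X.rate p s n ω}

variable [MeasurableSpace Ω] (μ : Measure Ω)

/-- Average successful access delivery rate of tier `k`: the average, over the event of association
with tier `k`, of the mean rate given success, serving distance and load, that is of
`E[R 1{R ≥ R₀} | Z, L] / P(R ≥ R₀ | Z, L)`. -/
def sucRate (s : ℝ) (n : ℕ) (k : Tier) : ℝ :=
  ∫ ω in {ω | X.servingTier p n ω = k},
    (μ[(X.success p s n).indicator (X.rate p s n) | X.info p n]) ω /
      (μ[(X.success p s n).indicator (fun _ => (1 : ℝ)) | X.info p n]) ω ∂μ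

/-- Probability of association with tier `k`. -/
def assocProb (n : ℕ) (k : Tier) : ℝ := μ.real {ω | X.servingTier p n ω = k}

/-- Successful access delivery probability: association with tier `k` and a sufficient rate. -/
def accessProb (s : ℝ) (n : ℕ) (k : Tier) : ℝ :=
  μ.real {ω | p.R₀ ≤ X.rate p s n ω ∧ X.servingTier p n ω = k}

/-- Successful backhaul delivery probability of a user associated with the MBSs. -/
def backhaulProb (n : ℕ) : ℝ :=
  (cond μ {ω | X.servingTier p n ω = 0}).real {ω | p.R₀ ≤ X.backhaulRate p ω}

/-- Successful backhaul delivery probability of a user associated with the MBSs, given the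
load `l + 1`. -/
def backhaulProbAt (n l : ℕ) : ℝ :=
  (cond μ {ω | X.servingTier p n ω = 0 ∧ X.load 0 ω = l + 1}).real
    {ω | p.R₀ ≤ X.backhaulRate p ω}

/-- Average successful delivery rate with noise power `s`, over the requested content and the
three ways of delivery. -/
def totalRate (s : ℝ) : ℝ :=
  ∑ n ∈ p.Mp, p.q n * X.sucRate p μ s n 0 +
  ∑ n ∈ p.Lp, p.q n * (X.sucRate p μ s n 1 +
    X.assocProb p μ n 0 * X.accessProb p μ s n 0 * X.backhaulProb p μ n * p.R₀)

end Elements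

end HetNet

end

noncomputable section

namespace HetNet

open scoped ENNReal NNReal

/-! All probabilities reduce to one kind of mean: a sum over the stations `b` of a quantity of `b`,
times the exponential of minus a sum of weights over the other stations. Weights live in `[0, ∞]`.
An infinite weight forbids a station; a weight proportional to its received power produces the
Laplace transform of the interference. Hence "no other candidate is preferred to `b`" and "the
interference seen from `b`" form a single exponential (`Params.weight`,
`Elements.expNeg_tsum_weight`).

For one Poisson process, `E exp(-Σ v) = exp(-λ ∫ (1 - e^{-v}))` follows from the law and
independence of the counts. Independent marks (storing, transmitting, fading gain) replace `e^{-v}`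
by its mean over the mark. Difference quotients of this functional in a direction `ψ` give the Mecke
formula; choosing `ψ` with the point's own factor divided out gives its reduced form; discretising
the norm of the distinguished point then lets the weight depend on its distance
(`IsMarkedPoisson.lintegral_tsum_mul_expNeg_nnnorm`).

The path loss is a power law, so with the area `u = π z²` of the disc up to the station as
coordinate the exponent for the threshold `δ` is linear: `K(δ) u` with `K = Params.rateK`.
Candidates inside their exclusion disc contribute the constant term, transmitting candidates outside
it contribute `G`, and transmitting non-candidates, which may lie anywhere, contribute `H`
(`Params.laplaceExponent_weight`). At `δ = 0` the mean number of strongest stations comes out as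
one. Almost surely there is at least one, so it is unique, and sums over strongest stations become
evaluations at the serving station (`Elements.Law.ae_mem_strongest_iff`).

Under the load `l + 1`, the rate reaches `r` iff the gain of the serving station is at least `δ z^α
(I + σ²) / P_k`, and the exponential tail turns this into a Laplace transform. Given tier, distance
and load, the rate therefore reaches `r` with probability `exp(-E(r))`, where `E(r) = δ σ² z^α / P_k
+ (K(δ) - K(0)) u` (`Elements.Law.lintegral_rate`). By the layer-cake formula, the conditional mean
given success is `R₀ + ∫_{R₀}^∞ exp(-(E(r) - E(R₀))) dr` (`condExp_success`, `condExp_rate`,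
`sucRate_eq`). On association with tier `k`, the area `u` has density `λ_k c_k e^{-K(0) u}`, with
`c_k` the probability of being a candidate. Without noise the integral over `u` is elementary and
yields `λ_k c_k / (K(δ_r) - K(δ_{R₀}) + K(0))`; dividing `K` by `λ_k c_k` exposes `ξ`, `ς` and `ζ`.
Contents of the first group are stored by no helper, which is the case `c = 0`. The success
probability comes in the same way from `λ_k c_k / K(δ_{R₀})`.

The integral over `r` converges because `G` gains at least a multiple of `x^{2/α}` between `x/2` and
`x` for large `x`, while the threshold grows exponentially in `r`, uniformly in the load
(`Params.exists_rateTerm_le`). Noise only enlarges `E(r) - E(R₀)`, so the noiseless integrands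
dominate and the limit of vanishing noise is dominated convergence.

The backhaul link involves loads, misses and picks only, which are independent of the positions and
caches that determine the association. The number `m` of competitors is binomial, and a uniform
choice includes the tagged user with probability `min(1, N_b/(m+1))`
(`Elements.Law.backhaulProb_eq`). -/

/-! ### The exponential `v ↦ exp (-v)` on `[0, ∞]` -/

/-- `exp (-v)` for `v ∈ [0, ∞]`. -/
def expNeg (v : ℝ≥0∞) : ℝ≥0∞ := EReal.exp (-(v : EReal))

@[simp] lemma expNeg_zero : expNeg 0 = 1 := by simp [expNeg]

@[simp] lemma expNeg_top : expNeg ⊤ = 0 := by simp [expNeg]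

lemma expNeg_le_one (v : ℝ≥0∞) : expNeg v ≤ 1 := by
  simp [expNeg, EReal.coe_ennreal_nonneg]

lemma expNeg_ne_top (v : ℝ≥0∞) : expNeg v ≠ ⊤ :=
  ((expNeg_le_one v).trans_lt ENNReal.one_lt_top).ne

lemma expNeg_antitone : Antitone expNeg := by
  intro a b h
  simp only [expNeg, EReal.exp_le_exp_iff, EReal.neg_le_neg_iff]
  exact_mod_cast h

lemma continuous_expNeg : Continuous expNeg :=
  ENNReal.continuous_exp.comp (continuous_neg.comp continuous_coe_ennreal_ereal)

@[fun_prop] lemma measurable_expNeg : Measurable expNeg := continuous_expNeg.measurable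

lemma expNeg_ofReal {x : ℝ} (hx : 0 ≤ x) :
    expNeg (ENNReal.ofReal x) = ENNReal.ofReal (Real.exp (-x)) := by
  rw [expNeg, EReal.coe_ennreal_ofReal, max_eq_left hx, ← EReal.coe_neg, EReal.exp_coe]

lemma expNeg_eq_zero {v : ℝ≥0∞} : expNeg v = 0 ↔ v = ⊤ := by
  simp [expNeg, EReal.neg_eq_bot_iff]

lemma expNeg_eq_of_ne_top {v : ℝ≥0∞} (hv : v ≠ ⊤) :
    expNeg v = ENNReal.ofReal (Real.exp (-v.toReal)) := by
  rw [← expNeg_ofReal ENNReal.toReal_nonneg, ENNReal.ofReal_toReal hv]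

lemma expNeg_add (a b : ℝ≥0∞) : expNeg (a + b) = expNeg a * expNeg b := by
  by_cases ha : a = ⊤
  · simp [ha]
  by_cases hb : b = ⊤
  · simp [hb]
  rw [expNeg_eq_of_ne_top ha, expNeg_eq_of_ne_top hb, expNeg_eq_of_ne_top (by simp [ha, hb]),
    ← ENNReal.ofReal_mul (Real.exp_pos _).le, ← Real.exp_add, ENNReal.toReal_add ha hb]
  ring_nf

lemma expNeg_sum {ι : Type*} (s : Finset ι) (f : ι → ℝ≥0∞) :
    expNeg (∑ i ∈ s, f i) = ∏ i ∈ s, expNeg (f i) := by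
  classical
  induction s using Finset.induction_on with
  | empty => simp
  | insert a s ha ih => rw [Finset.sum_insert ha, Finset.prod_insert ha, expNeg_add, ih]

/-- No summability is needed: `expNeg` is continuous up to `⊤`, where it vanishes, so divergent sums
correspond to products tending to zero. -/
lemma tendsto_prod_expNeg {ι : Type*} (f : ι → ℝ≥0∞) :
    Tendsto (fun s : Finset ι => ∏ i ∈ s, expNeg (f i)) atTop (𝓝 (expNeg (∑' i, f i))) := by
  simp_rw [← expNeg_sum]
  exact (continuous_expNeg.tendsto _).comp ENNReal.summable.hasSum

/-- `-log y` for `y ∈ [0, 1]`, the inverse of `expNeg`. -/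
def negLog (y : ℝ≥0∞) : ℝ≥0∞ := (-ENNReal.log y).toENNReal

/-- The bound on `y` keeps `-log y` nonnegative, so `toENNReal` truncates nothing. The lemma is
applied to means of values of `expNeg`, which never exceed one. -/
lemma expNeg_negLog {y : ℝ≥0∞} (hy : y ≤ 1) : expNeg (negLog y) = y := by
  have h : 0 ≤ -ENNReal.log y := by
    rw [EReal.neg_nonneg]
    simpa using hy
  rw [negLog, expNeg, EReal.coe_toENNReal h, neg_neg, ENNReal.exp_log]

@[fun_prop] lemma measurable_negLog : Measurable negLog :=
  measurable_ereal_toENNReal.comp (measurable_neg.comp ENNReal.measurable_log)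

/-! ### The Laplace functional of a Poisson process -/

section Poisson

/-- Links the counts, in which the Poisson law is phrased, with sums over the points, in which
measurability and Laplace functionals are phrased. -/
lemma encard_eq_tsum_indicator {Ω : Type*} (x : ℕ → Ω → Plane) (B : Set Plane) (ω : Ω) :
    (({j | x j ω ∈ B}.encard : ℕ∞) : ℝ≥0∞) = ∑' j, B.indicator 1 (x j ω) := by
  rw [← ENNReal.tsum_set_one, tsum_subtype _ (fun _ => (1 : ℝ≥0∞))]
  rfl

variable {Ω : Type*} [MeasurableSpace Ω]

variable {x : ℕ → Ω → Plane} {lam : ℝ} {μ : Measure Ω}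

lemma measurable_encard (hx : ∀ j, Measurable (x j)) {B : Set Plane} (hB : MeasurableSet B) :
    Measurable fun ω => {j | x j ω ∈ B}.encard := by
  refine measurable_to_countable' fun i => ?_
  have h : (fun ω => {j | x j ω ∈ B}.encard) ⁻¹' {i} =
      {ω | ∑' j, B.indicator (1 : Plane → ℝ≥0∞) (x j ω) = (i : ℝ≥0∞)} := by
    ext ω
    rw [Set.mem_ofPred_eq, ← encard_eq_tsum_indicator]
    simp
  rw [h]
  have : Measurable fun ω => ∑' j, B.indicator (1 : Plane → ℝ≥0∞) (x j ω) :=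
    Measurable.tsum fun j => (measurable_one.indicator hB).comp (hx j)
  exact this (measurableSet_singleton _)

namespace IsPoissonProcess

/-- The Poisson masses of the finite counts already add up to one, which leaves nothing for an
infinite count. -/
lemma ae_encard_ne_top [IsProbabilityMeasure μ] (h : IsPoissonProcess x lam μ) {B : Set Plane}
    (hB : MeasurableSet B) (hBv : volume B ≠ ⊤) (hlam : 0 ≤ lam) :
    ∀ᵐ ω ∂μ, {j | x j ω ∈ B}.encard ≠ ⊤ := by
  have hm := measurable_encard h.measurable hB
  have hms : ∀ i : ℕ, MeasurableSet {ω | {j | x j ω ∈ B}.encard = i} :=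
    fun i => hm (measurableSet_singleton _)
  set r := lam * volume.real B with hr
  have hr0 : 0 ≤ r := by positivity
  have hU : μ (⋃ i : ℕ, {ω | {j | x j ω ∈ B}.encard = i}) = 1 := by
    rw [measure_iUnion _ hms]
    · have : ∀ i : ℕ, μ {ω | {j | x j ω ∈ B}.encard = i} =
          ENNReal.ofReal (Real.exp (-r) * (r ^ i / (i.factorial : ℝ))) := by
        intro i
        rw [← mul_div_assoc, ← h.count_law B hB hBv i, ofReal_measureReal]
      simp_rw [this]
      have hs := (NormedSpace.expSeries_div_hasSum_exp (𝔸 := ℝ) r).mul_left (Real.exp (-r))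
      rw [← ENNReal.ofReal_tsum_of_nonneg (fun i => by positivity) hs.summable, hs.tsum_eq,
        ← Real.exp_eq_exp_ℝ, ← Real.exp_add]
      simp
    · intro i j hij
      refine Set.disjoint_left.2 fun ω h1 h2 => hij ?_
      have := h1.symm.trans h2
      exact_mod_cast this
  have : ∀ᵐ ω ∂μ, ω ∈ ⋃ i : ℕ, {ω | {j | x j ω ∈ B}.encard = i} := by
    rw [← prob_compl_eq_zero_iff (MeasurableSet.iUnion hms)] at hU
    exact hU
  filter_upwards [this] with ω hω
  obtain ⟨i, hi⟩ := Set.mem_iUnion.1 hω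
  rw [hi]
  exact ENat.natCast_ne_top i

/-- The generating function of a Poisson variable: with `y = e^{-c}` and mean `r`, the series `Σ
e^{-r} (r y)^i / i!` sums to `e^{-r (1 - y)}`. -/
lemma lintegral_expNeg_mul_encard [IsProbabilityMeasure μ] (h : IsPoissonProcess x lam μ)
    {B : Set Plane} (hB : MeasurableSet B) (hBv : volume B ≠ ⊤) (hlam : 0 ≤ lam) {c : ℝ≥0∞}
    (hc : c ≠ ⊤) :
    ∫⁻ ω, expNeg (c * ({j | x j ω ∈ B}.encard : ℕ∞)) ∂μ =
      expNeg (ENNReal.ofReal lam * ((1 - expNeg c) * volume B)) := by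
  have hm := measurable_encard h.measurable hB
  have hms : ∀ i : ℕ, MeasurableSet {ω | {j | x j ω ∈ B}.encard = i} :=
    fun i => hm (measurableSet_singleton _)
  set r := lam * volume.real B with hr
  have hr0 : 0 ≤ r := by positivity
  have h1 : ∀ᵐ ω ∂μ, expNeg (c * ({j | x j ω ∈ B}.encard : ℕ∞)) =
      ∑' i : ℕ, {ω | {j | x j ω ∈ B}.encard = i}.indicator (fun _ => expNeg (c * i)) ω := by
    filter_upwards [h.ae_encard_ne_top hB hBv hlam] with ω hω
    obtain ⟨n, hn⟩ := ENat.ne_top_iff_exists.1 hω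
    rw [tsum_eq_single n]
    · simp [← hn]
    · intro i hi
      have : (n : ℕ∞) ≠ i := by exact_mod_cast hi.symm
      simp [← hn, this]
  set y := Real.exp (-c.toReal) with hy
  have hci : ∀ i : ℕ, expNeg (c * i) = ENNReal.ofReal (y ^ i) := by
    intro i
    rw [expNeg_eq_of_ne_top (ENNReal.mul_ne_top hc (by simp)), hy, ← Real.exp_nat_mul]
    simp [mul_comm]
  have hterm : ∀ i : ℕ, expNeg (c * i) * μ {ω | {j | x j ω ∈ B}.encard = i} =
      ENNReal.ofReal (Real.exp (-r) * ((r * y) ^ i / (i.factorial : ℝ))) := by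
    intro i
    rw [hci, ← ofReal_measureReal, h.count_law B hB hBv i, ← ENNReal.ofReal_mul (by positivity)]
    congr 1
    rw [mul_pow, ← hr]
    ring
  rw [lintegral_congr_ae h1, lintegral_tsum fun i =>
    (measurable_const.indicator (hms i)).aemeasurable]
  simp_rw [lintegral_indicator_const (hms _), hterm]
  have hs := (NormedSpace.expSeries_div_hasSum_exp (𝔸 := ℝ) (r * y)).mul_left (Real.exp (-r))
  rw [← ENNReal.ofReal_tsum_of_nonneg (fun i => by positivity) hs.summable, hs.tsum_eq,
    ← Real.exp_eq_exp_ℝ, ← Real.exp_add, expNeg_eq_of_ne_top hc, ← hy]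
  have hy1 : y ≤ 1 := by rw [hy]; simp
  have : ENNReal.ofReal lam * ((1 - ENNReal.ofReal y) * volume B) =
      ENNReal.ofReal (r * (1 - y)) := by
    rw [← ENNReal.ofReal_one, ← ENNReal.ofReal_sub _ (Real.exp_pos _).le,
      ← ofReal_measureReal hBv, ← ENNReal.ofReal_mul (by linarith), ← ENNReal.ofReal_mul hlam]
    congr 1
    rw [hr]
    ring
  rw [this, expNeg_ofReal (mul_nonneg hr0 (by linarith))]
  congr 2
  ring

/-- The sum over the points is a combination of the counts in the level sets of the nonzero values.
These sets are disjoint, so the counts are independent and the Laplace functional factors into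
generating functions. The level set of zero is left out, since its area may be infinite. -/
lemma lintegral_expNeg_tsum_simpleFunc [IsProbabilityMeasure μ] (h : IsPoissonProcess x lam μ)
    (hlam : 0 ≤ lam) (f : SimpleFunc Plane ℝ≥0∞) (hf : ∀ z, f z ≠ ⊤)
    (hfv : ∀ c, c ≠ 0 → volume (f ⁻¹' {c}) ≠ ⊤) :
    ∫⁻ ω, expNeg (∑' j, f (x j ω)) ∂μ =
      expNeg (ENNReal.ofReal lam * ∫⁻ z, (1 - expNeg (f z))) := by
  classical
  set s : Finset ℝ≥0∞ := f.range.filter (· ≠ 0) with hs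
  let e := s.equivFin
  let c : Fin s.card → ℝ≥0∞ := fun i => (e.symm i : ℝ≥0∞)
  let B : Fin s.card → Set Plane := fun i => f ⁻¹' {c i}
  have hc0 : ∀ i, c i ≠ 0 := fun i => (Finset.mem_filter.1 (e.symm i).2).2
  have hct : ∀ i, c i ≠ ⊤ := by
    intro i
    obtain ⟨z, hz⟩ := SimpleFunc.mem_range.1 (Finset.mem_filter.1 (e.symm i).2).1
    change ((e.symm i : s) : ℝ≥0∞) ≠ ⊤
    rw [← hz]
    exact hf z
  have hBm : ∀ i, MeasurableSet (B i) := fun i => f.measurableSet_preimage _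
  have hBv : ∀ i, volume (B i) ≠ ⊤ := fun i => hfv _ (hc0 i)
  have hinj : Function.Injective c := fun i i' hii => e.symm.injective (Subtype.ext hii)
  have hdisj : Pairwise (fun i i' => Disjoint (B i) (B i')) := by
    intro i i' hii
    refine Set.disjoint_left.2 fun z h1 h2 => hii (hinj ?_)
    exact (Set.mem_singleton_iff.1 h1).symm.trans (Set.mem_singleton_iff.1 h2)
  -- Needed for two functions of the value, the identity and `1 - expNeg`. Both vanish at zero, so
  -- the discarded level set does not contribute.
  have hdec : ∀ (g : ℝ≥0∞ → ℝ≥0∞), g 0 = 0 → ∀ z,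
      g (f z) = ∑ i, g (c i) * (B i).indicator 1 z := by
    intro g hg z
    by_cases hz : f z = 0
    · rw [hz, hg, eq_comm]
      refine Finset.sum_eq_zero fun i _ => ?_
      have : z ∉ B i := by
        change f z ≠ c i
        rw [hz]
        exact (hc0 i).symm
      simp [this]
    · have hzs : f z ∈ s := Finset.mem_filter.2 ⟨f.mem_range_self z, hz⟩
      have hci : c (e ⟨f z, hzs⟩) = f z := by simp [c]
      rw [Finset.sum_eq_single (e ⟨f z, hzs⟩)]
      · have : z ∈ B (e ⟨f z, hzs⟩) := hci.symm
        simp [this, hci]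
      · intro i _ hi
        have : z ∉ B i := fun hzi => hi (hinj (Eq.trans (Eq.symm hzi) hci.symm))
        simp [this]
      · simp
  have hsum : ∀ ω, ∑' j, f (x j ω) = ∑ i, c i * ({j | x j ω ∈ B i}.encard : ℕ∞) := by
    intro ω
    simp_rw [encard_eq_tsum_indicator, ← ENNReal.tsum_mul_left]
    rw [← Summable.tsum_finsetSum fun i _ => ENNReal.summable]
    exact tsum_congr fun j => hdec id rfl _
  have hind := h.count_indep s.card B hBm hBv hdisj
  have hint : ∫⁻ z, (1 - expNeg (f z)) = ∑ i, (1 - expNeg (c i)) * volume (B i) := by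
    simp_rw [hdec (fun c => 1 - expNeg c) (by simp)]
    rw [lintegral_finsetSum _ fun i _ => (measurable_one.indicator (hBm i)).const_mul _]
    refine Finset.sum_congr rfl fun i _ => ?_
    rw [lintegral_const_mul _ (measurable_one.indicator (hBm i)), lintegral_indicator_one (hBm i)]
  simp_rw [hsum, expNeg_sum]
  have hind' := hind.comp (fun i N => expNeg (c i * (N : ℝ≥0∞))) fun i => measurable_of_countable _
  have := lintegral_prod_eq_prod_lintegral_of_indepFun (μ := μ) Finset.univ
    (fun i ω => expNeg (c i * ({j | x j ω ∈ B i}.encard : ℕ∞))) hind'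
    (fun i => (measurable_of_countable (fun N : ℕ∞ => expNeg (c i * (N : ℝ≥0∞)))).comp
      (measurable_encard h.measurable (hBm i)))
  rw [this, hint, Finset.mul_sum, expNeg_sum]
  exact Finset.prod_congr rfl fun i _ =>
    h.lintegral_expNeg_mul_encard (hBm i) (hBv i) hlam (hct i)

/-- The Laplace functional of a Poisson process. -/
theorem lintegral_expNeg_tsum [IsProbabilityMeasure μ] (h : IsPoissonProcess x lam μ)
    (hlam : 0 ≤ lam) {v : Plane → ℝ≥0∞} (hv : Measurable v) :
    ∫⁻ ω, expNeg (∑' j, v (x j ω)) ∂μ =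
      expNeg (ENNReal.ofReal lam * ∫⁻ z, (1 - expNeg (v z))) := by
  -- Cutting off to balls gives the nonzero level sets finite area, and the approximations still
  -- increase to `v` at every point.
  let f : ℕ → SimpleFunc Plane ℝ≥0∞ := fun n =>
    (SimpleFunc.eapprox v n).restrict (Metric.ball 0 n)
  have hfa : ∀ n z, f n z = (Metric.ball (0 : Plane) n).indicator (SimpleFunc.eapprox v n) z :=
    fun n z => SimpleFunc.restrict_apply _ measurableSet_ball z
  have hmono : ∀ z, Monotone fun n => f n z := by
    intro z n m hnm
    simp only [hfa]
    refine (Set.indicator_le_indicator (SimpleFunc.monotone_eapprox v hnm z)).trans ?_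
    exact Set.indicator_le_indicator_of_subset
      (Metric.ball_subset_ball (by exact_mod_cast hnm)) (fun _ => zero_le) z
  have hlim : ∀ z, Tendsto (fun n => f n z) atTop (𝓝 (v z)) := by
    intro z
    refine (SimpleFunc.tendsto_eapprox hv z).congr' ?_
    obtain ⟨N, hN⟩ := exists_nat_gt ‖z‖
    filter_upwards [eventually_ge_atTop N] with n hn
    rw [hfa, Set.indicator_of_mem]
    rw [mem_ball_zero_iff]
    exact hN.trans_le (by exact_mod_cast hn)
  have hft : ∀ n z, f n z ≠ ⊤ := by
    intro n z
    rw [hfa]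
    refine ((Set.indicator_le_self _ _ z).trans_lt (SimpleFunc.eapprox_lt_top v n z)).ne
  have hfv : ∀ n c, c ≠ 0 → volume (f n ⁻¹' {c}) ≠ ⊤ := by
    intro n c hc
    refine (lt_of_le_of_lt (measure_mono ?_) (measure_ball_lt_top (x := (0 : Plane)) (r := n))).ne
    intro z hz
    by_contra hzb
    refine hc ?_
    have : f n z = c := hz
    rw [← this, hfa, Set.indicator_of_notMem hzb]
  have hL : Tendsto (fun n => ∫⁻ ω, expNeg (∑' j, f n (x j ω)) ∂μ) atTop
      (𝓝 (∫⁻ ω, expNeg (∑' j, v (x j ω)) ∂μ)) := by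
    refine tendsto_lintegral_of_dominated_convergence (fun _ => 1) (fun n => ?_) (fun n => ?_)
      (by simp) ?_
    · exact measurable_expNeg.comp
        (Measurable.tsum fun j => (f n).measurable.comp (h.measurable j))
    · exact Eventually.of_forall fun ω => expNeg_le_one _
    · refine Eventually.of_forall fun ω => (continuous_expNeg.tendsto _).comp ?_
      have := lintegral_tendsto_of_tendsto_of_monotone (μ := Measure.count (α := ℕ))
        (f := fun n j => f n (x j ω)) (F := fun j => v (x j ω))
        (fun n => (measurable_of_countable _).aemeasurable)
        (Eventually.of_forall fun j => hmono _) (Eventually.of_forall fun j => hlim _)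
      simpa [lintegral_count] using this
  have hR : Tendsto (fun n => expNeg (ENNReal.ofReal lam * ∫⁻ z, (1 - expNeg (f n z)))) atTop
      (𝓝 (expNeg (ENNReal.ofReal lam * ∫⁻ z, (1 - expNeg (v z))))) := by
    refine (continuous_expNeg.tendsto _).comp (ENNReal.Tendsto.const_mul ?_ (Or.inr (by simp)))
    refine lintegral_tendsto_of_tendsto_of_monotone (fun n => ?_)
      (Eventually.of_forall fun z n m hnm => ?_) (Eventually.of_forall fun z => ?_)
    · exact (measurable_const.sub (measurable_expNeg.comp (f n).measurable)).aemeasurable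
    · exact tsub_le_tsub_left (expNeg_antitone (hmono z hnm)) _
    · exact ENNReal.Tendsto.sub tendsto_const_nhds
        ((continuous_expNeg.tendsto _).comp (hlim z)) (Or.inl (by simp))
  refine tendsto_nhds_unique hL (hR.congr fun n => ?_)
  exact (h.lintegral_expNeg_tsum_simpleFunc hlam (f n) (hft n) (hfv n)).symm

end IsPoissonProcess

end Poisson

/-! ### Independent marks -/

section Marks

/-- A random element that is independent of a σ-algebra can be integrated out separately. -/
lemma lintegral_indep_subst {Ω M : Type*} {𝓖 : MeasurableSpace Ω} [mΩ : MeasurableSpace Ω]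
    {μ : Measure Ω} [IsProbabilityMeasure μ] [MeasurableSpace M] (h𝓖 : 𝓖 ≤ mΩ) {E : Type*} [MeasurableSpace E]
    {η : Ω → E} (hη : Measurable[𝓖] η) {ξ : Ω → M} (hξ : Measurable ξ)
    (hind : Indep (MeasurableSpace.comap ξ inferInstance) 𝓖 μ) {g : E × M → ℝ≥0∞}
    (hg : Measurable g) :
    ∫⁻ ω, g (η ω, ξ ω) ∂μ = ∫⁻ ω, ∫⁻ y, g (η ω, y) ∂(μ.map ξ) ∂μ := by
  have hη' : Measurable η := hη.mono h𝓖 le_rfl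
  have hif : IndepFun η ξ μ :=
    (indep_of_indep_of_le_right hind (measurable_iff_comap_le.1 hη)).symm
  have hmap := (indepFun_iff_map_prod_eq_prod_map_map hη'.aemeasurable hξ.aemeasurable).1 hif
  have : IsProbabilityMeasure (μ.map ξ) := Measure.isProbabilityMeasure_map hξ.aemeasurable
  rw [← lintegral_map hg (hη'.prodMk hξ), hmap, lintegral_prod _ hg.aemeasurable,
    lintegral_map hg.lintegral_prod_right' hη']

variable {Ω : Type*} [mΩ : MeasurableSpace Ω] {μ : Measure Ω}
  {M : Type*} [MeasurableSpace M]

/-- Two independent Poisson processes whose points carry independent marks, with the distribution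
of the marks depending only on the process. The σ-algebra `𝓕 b` contains everything but the
mark of `b`. -/
structure IsMarkedPoisson (x : Tier → ℕ → Ω → Plane) (m : Station → Ω → M) (lam : Tier → ℝ)
    (ν : Tier → Measure M) (𝓕 : Station → MeasurableSpace Ω) (μ : Measure Ω) : Prop where
  pos_law : ∀ k, IsPoissonProcess (x k) (lam k) μ
  lam_nonneg : ∀ k, 0 ≤ lam k
  pos_indep : IndepFun (fun ω j => x 0 j ω) (fun ω j => x 1 j ω) μ
  mark_measurable : ∀ b, Measurable (m b)
  mark_law : ∀ b, μ.map (m b) = ν b.1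
  le : ∀ b, 𝓕 b ≤ mΩ
  pos_meas : ∀ b k j, Measurable[𝓕 b] (x k j)
  mark_meas : ∀ b b', b' ≠ b → Measurable[𝓕 b] (m b')
  indep : ∀ b, Indep (MeasurableSpace.comap (m b) inferInstance) (𝓕 b) μ

namespace IsMarkedPoisson

variable {x : Tier → ℕ → Ω → Plane} {m : Station → Ω → M} {lam : Tier → ℝ}
  {ν : Tier → Measure M} {𝓕 : Station → MeasurableSpace Ω}

lemma isProbabilityMeasure [IsProbabilityMeasure μ] (h : IsMarkedPoisson x m lam ν 𝓕 μ) (k : Tier) :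
    IsProbabilityMeasure (ν k) := by
  have := h.mark_law (k, 0)
  exact this ▸ Measure.isProbabilityMeasure_map (h.mark_measurable _).aemeasurable

lemma pos_measurable (h : IsMarkedPoisson x m lam ν 𝓕 μ) (k : Tier) (j : ℕ) :
    Measurable (x k j) := (h.pos_law k).measurable j

variable [IsProbabilityMeasure μ]

/-- Induction over the stations: the mark of `b` is independent of `𝓕 b`, for which the positions
and all other marks are measurable, so it can be averaged first. The spare factor `Y` collects the
averages already taken; they depend on positions only and are thus measurable for every `𝓕 b`, which
keeps the induction going. -/
lemma lintegral_finset_prod (h : IsMarkedPoisson x m lam ν 𝓕 μ)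
    {u : Tier → Plane × M → ℝ≥0∞} (hu : ∀ k, Measurable (u k)) (s : Finset Station)
    {Y : Ω → ℝ≥0∞} (hY : ∀ b, Measurable[𝓕 b] Y) :
    ∫⁻ ω, (∏ b ∈ s, u b.1 (x b.1 b.2 ω, m b ω)) * Y ω ∂μ =
      ∫⁻ ω, (∏ b ∈ s, ∫⁻ y, u b.1 (x b.1 b.2 ω, y) ∂(ν b.1)) * Y ω ∂μ := by
  classical
  have hprob := h.isProbabilityMeasure
  induction s using Finset.induction_on generalizing Y with
  | empty => simp
  | insert b s hb ih =>
    have hrest : Measurable[𝓕 b] fun ω => (∏ b ∈ s, u b.1 (x b.1 b.2 ω, m b ω)) * Y ω := by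
      refine Measurable.mul ?_ (hY b)
      refine Finset.measurable_fun_prod s fun b' hb' => ?_
      exact (hu _).comp ((h.pos_meas b _ _).prodMk
        (h.mark_meas b b' fun hbb => hb (hbb ▸ hb')))
    have hsub := lintegral_indep_subst (μ := μ) (h.le b)
      (η := fun ω => (x b.1 b.2 ω, (∏ b ∈ s, u b.1 (x b.1 b.2 ω, m b ω)) * Y ω))
      ((h.pos_meas b b.1 b.2).prodMk hrest)
      (h.mark_measurable b) (h.indep b)
      (g := fun q => u b.1 (q.1.1, q.2) * q.1.2)
      (((hu b.1).comp ((measurable_fst.comp measurable_fst).prodMk measurable_snd)).mul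
        (measurable_snd.comp measurable_fst))
    have hY' : ∀ b', Measurable[𝓕 b'] fun ω =>
        (∫⁻ y, u b.1 (x b.1 b.2 ω, y) ∂(ν b.1)) * Y ω := by
      intro b'
      refine Measurable.mul ?_ (hY b')
      exact (hu b.1).lintegral_prod_right'.comp (h.pos_meas b' _ _)
    have hih := ih hY'
    simp_rw [Finset.prod_insert hb]
    calc _ = ∫⁻ ω, u b.1 (x b.1 b.2 ω, m b ω) *
          ((∏ b ∈ s, u b.1 (x b.1 b.2 ω, m b ω)) * Y ω) ∂μ := by simp_rw [mul_assoc]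
      _ = ∫⁻ ω, ∫⁻ y, u b.1 (x b.1 b.2 ω, y) *
          ((∏ b ∈ s, u b.1 (x b.1 b.2 ω, m b ω)) * Y ω) ∂(ν b.1) ∂μ := by
            rw [← h.mark_law b]
            exact hsub
      _ = ∫⁻ ω, (∏ b ∈ s, u b.1 (x b.1 b.2 ω, m b ω)) *
          ((∫⁻ y, u b.1 (x b.1 b.2 ω, y) ∂(ν b.1)) * Y ω) ∂μ := by
            refine lintegral_congr fun ω => ?_
            have hm : Measurable fun y => u b.1 (x b.1 b.2 ω, y) :=
              (hu b.1).comp measurable_prodMk_left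
            rw [lintegral_mul_const _ hm]
            ring
      _ = _ := by
            rw [hih]
            refine lintegral_congr fun ω => ?_
            ring

/-- The marks can be integrated out. -/
lemma lintegral_expNeg_marks (h : IsMarkedPoisson x m lam ν 𝓕 μ)
    {v : Tier → Plane × M → ℝ≥0∞} (hv : ∀ k, Measurable (v k)) :
    ∫⁻ ω, expNeg (∑' b : Station, v b.1 (x b.1 b.2 ω, m b ω)) ∂μ =
      ∫⁻ ω, expNeg (∑' b : Station,
        negLog (∫⁻ y, expNeg (v b.1 (x b.1 b.2 ω, y)) ∂(ν b.1))) ∂μ := by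
  have hprob := h.isProbabilityMeasure
  have hle : ∀ k z, ∫⁻ y, expNeg (v k (z, y)) ∂(ν k) ≤ 1 := by
    intro k z
    calc _ ≤ ∫⁻ _, 1 ∂(ν k) := lintegral_mono fun y => expNeg_le_one _
      _ = 1 := by simp
  have hu : ∀ k, Measurable fun q => expNeg (v k q) := fun k => measurable_expNeg.comp (hv k)
  have hum : ∀ k, Measurable fun z => ∫⁻ y, expNeg (v k (z, y)) ∂(ν k) :=
    fun k => (hu k).lintegral_prod_right'
  -- Finite products of values of `expNeg` are bounded by one, so dominated convergence along finite
  -- sets reaches the full sum.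
  have key : ∀ f : Station → Ω → ℝ≥0∞, (∀ b, Measurable (f b)) →
      Tendsto (fun s : Finset Station => ∫⁻ ω, ∏ b ∈ s, expNeg (f b ω) ∂μ) atTop
        (𝓝 (∫⁻ ω, expNeg (∑' b, f b ω) ∂μ)) := by
    intro f hf
    refine tendsto_lintegral_filter_of_dominated_convergence (fun _ => 1)
      (Eventually.of_forall fun s => ?_) (Eventually.of_forall fun s => ?_) (by simp)
      (Eventually.of_forall fun ω => tendsto_prod_expNeg _)
    · exact Finset.measurable_fun_prod s fun b _ => measurable_expNeg.comp (hf b)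
    · exact Eventually.of_forall fun ω => Finset.prod_le_one' fun b _ => expNeg_le_one _
  have h1 := key (fun b ω => v b.1 (x b.1 b.2 ω, m b ω))
    fun b => (hv _).comp ((h.pos_measurable _ _).prodMk (h.mark_measurable b))
  have h2 := key (fun b ω => negLog (∫⁻ y, expNeg (v b.1 (x b.1 b.2 ω, y)) ∂(ν b.1)))
    fun b => measurable_negLog.comp ((hum b.1).comp (h.pos_measurable _ _))
  refine tendsto_nhds_unique h1 (h2.congr fun s => ?_)
  have := h.lintegral_finset_prod hu s (Y := fun _ => 1) fun b => measurable_const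
  simp only [mul_one] at this
  rw [this]
  refine lintegral_congr fun ω => Finset.prod_congr rfl fun b _ => ?_
  rw [expNeg_negLog (hle _ _)]

/-- The exponent of the Laplace functional. -/
def laplaceExponent (lam : Tier → ℝ) (ν : Tier → Measure M) (v : Tier → Plane × M → ℝ≥0∞) :
    ℝ≥0∞ :=
  ∑ k, ENNReal.ofReal (lam k) * ∫⁻ z, (1 - ∫⁻ y, expNeg (v k (z, y)) ∂(ν k))

/-- The Laplace functional of the marked process. -/
theorem lintegral_expNeg_tsum (h : IsMarkedPoisson x m lam ν 𝓕 μ)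
    {v : Tier → Plane × M → ℝ≥0∞} (hv : ∀ k, Measurable (v k)) :
    ∫⁻ ω, expNeg (∑' b : Station, v b.1 (x b.1 b.2 ω, m b ω)) ∂μ =
      expNeg (laplaceExponent lam ν v) := by
  have hprob := h.isProbabilityMeasure
  have hle : ∀ k z, ∫⁻ y, expNeg (v k (z, y)) ∂(ν k) ≤ 1 := by
    intro k z
    calc _ ≤ ∫⁻ _, 1 ∂(ν k) := lintegral_mono fun y => expNeg_le_one _
      _ = 1 := by simp
  set w : Tier → Plane → ℝ≥0∞ := fun k z => negLog (∫⁻ y, expNeg (v k (z, y)) ∂(ν k)) with hw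
  have hwm : ∀ k, Measurable (w k) := fun k =>
    measurable_negLog.comp (measurable_expNeg.comp (hv k)).lintegral_prod_right'
  have hwe : ∀ k z, expNeg (w k z) = ∫⁻ y, expNeg (v k (z, y)) ∂(ν k) :=
    fun k z => expNeg_negLog (hle k z)
  rw [h.lintegral_expNeg_marks hv]
  have hF : ∀ k, Measurable fun f : ℕ → Plane => expNeg (∑' j, w k (f j)) := fun k =>
    measurable_expNeg.comp
      (Measurable.tsum fun j => (hwm k).comp (measurable_pi_apply j))
  have hx : ∀ k, Measurable fun ω j => x k j ω := fun k =>
    measurable_pi_lambda _ fun j => h.pos_measurable k j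
  have hprod : ∀ ω, expNeg (∑' b : Station, w b.1 (x b.1 b.2 ω)) =
      expNeg (∑' j, w 0 (x 0 j ω)) * expNeg (∑' j, w 1 (x 1 j ω)) := by
    intro ω
    rw [ENNReal.tsum_prod', tsum_fintype, Fin.sum_univ_two, expNeg_add]
  have hmul := lintegral_mul_eq_lintegral_mul_lintegral_of_indepFun (μ := μ)
    ((hF 0).comp (hx 0)) ((hF 1).comp (hx 1)) (h.pos_indep.comp (hF 0) (hF 1))
  calc _ = ∫⁻ ω, expNeg (∑' j, w 0 (x 0 j ω)) * expNeg (∑' j, w 1 (x 1 j ω)) ∂μ :=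
        lintegral_congr hprod
    _ = (∫⁻ ω, expNeg (∑' j, w 0 (x 0 j ω)) ∂μ) * ∫⁻ ω, expNeg (∑' j, w 1 (x 1 j ω)) ∂μ := hmul
    _ = _ := by
      rw [(h.pos_law 0).lintegral_expNeg_tsum (h.lam_nonneg 0) (hwm 0),
        (h.pos_law 1).lintegral_expNeg_tsum (h.lam_nonneg 1) (hwm 1), laplaceExponent,
        Fin.sum_univ_two, expNeg_add]
      simp_rw [hwe]

end IsMarkedPoisson

end Marks

/-! ### The Mecke formula -/

/-- Difference quotients of `1 - exp (-x)` at `0`. -/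
def expQuot (n : ℕ) (x : ℝ≥0∞) : ℝ≥0∞ := 2 ^ n * (1 - expNeg (x / 2 ^ n))

lemma expQuot_mono (n : ℕ) : Monotone (expQuot n) := fun _ _ h =>
  mul_le_mul_right (tsub_le_tsub_left (expNeg_antitone (ENNReal.div_le_div_right h _)) _) _

@[fun_prop] lemma measurable_expQuot (n : ℕ) : Measurable (expQuot n) := by
  unfold expQuot
  fun_prop

/-- Halving the step: with `q = exp(-x / 2^(n+1))` one has `1 - q² = (1 - q)(1 + q) ≤ 2 (1 - q)`.
The dyadic steps are chosen so that this gives a monotone sequence. -/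
lemma expQuot_le_succ (n : ℕ) (x : ℝ≥0∞) : expQuot n x ≤ expQuot (n + 1) x := by
  set q := expNeg (x / 2 ^ (n + 1)) with hq
  have hx : x / 2 ^ n = x / 2 ^ (n + 1) + x / 2 ^ (n + 1) := by
    rw [← ENNReal.add_div, ← two_mul, pow_succ, mul_comm (2 ^ n) 2]
    exact (ENNReal.mul_div_mul_left _ _ two_ne_zero ENNReal.ofNat_ne_top).symm
  have h1 : 1 - q * q ≤ 2 * (1 - q) := by
    obtain ⟨r, hr⟩ : ∃ r : NNReal, (r : ℝ≥0∞) = expNeg (x / 2 ^ (n + 1)) :=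
      ⟨_, ENNReal.coe_toNNReal (expNeg_ne_top _)⟩
    rw [hq, ← hr]
    have hr1 : r ≤ 1 := by
      have := expNeg_le_one (x / 2 ^ (n + 1))
      rw [← hr] at this
      exact_mod_cast this
    have : 1 - r * r ≤ 2 * (1 - r) := by
      have h2 : r * r ≤ 1 := mul_le_one' hr1 hr1
      rw [← NNReal.coe_le_coe]
      push_cast [NNReal.coe_sub h2, NNReal.coe_sub hr1]
      nlinarith [sq_nonneg (1 - (r : ℝ))]
    exact_mod_cast this
  calc expQuot n x = 2 ^ n * (1 - q * q) := by rw [expQuot, hx, expNeg_add]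
    _ ≤ 2 ^ n * (2 * (1 - q)) := by gcongr
    _ = expQuot (n + 1) x := by rw [expQuot, ← hq, pow_succ, mul_assoc]

lemma monotone_expQuot (x : ℝ≥0∞) : Monotone fun n => expQuot n x :=
  monotone_nat_of_le_succ fun n => expQuot_le_succ n x

/-- For finite `x` the quotient is squeezed between `x - x²/2^n` and `x`; for `x = ⊤` it equals
`2^n`. -/
lemma tendsto_expQuot (x : ℝ≥0∞) : Tendsto (fun n => expQuot n x) atTop (𝓝 x) := by
  by_cases hx : x = ⊤
  · subst hx
    have : ∀ n, expQuot n ⊤ = 2 ^ n := by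
      intro n
      rw [expQuot, ENNReal.top_div_of_ne_top (by simp)]
      simp
    simp_rw [this]
    exact ENNReal.tendsto_pow_atTop_nhds_top_iff.2 (by norm_num)
  set y := x.toReal with hy
  have hy0 : 0 ≤ y := ENNReal.toReal_nonneg
  have hval : ∀ n : ℕ, expQuot n x = ENNReal.ofReal (2 ^ n * (1 - Real.exp (-(y / 2 ^ n)))) := by
    intro n
    have h2 : x / 2 ^ n = ENNReal.ofReal (y / 2 ^ n) := by
      rw [ENNReal.ofReal_div_of_pos (by positivity), hy, ENNReal.ofReal_toReal hx]
      simp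
    rw [expQuot, h2, expNeg_ofReal (by positivity), ENNReal.ofReal_mul (by positivity),
      ENNReal.ofReal_sub _ (Real.exp_pos _).le]
    simp
  simp_rw [hval]
  rw [← ENNReal.ofReal_toReal hx, ← hy]
  refine (ENNReal.continuous_ofReal.tendsto y).comp ?_
  have hp : Tendsto (fun n : ℕ => (2 : ℝ) ^ n) atTop atTop :=
    tendsto_pow_atTop_atTop_of_one_lt (by norm_num)
  refine tendsto_of_tendsto_of_tendsto_of_le_of_le (g := fun n : ℕ => y - y * y / 2 ^ n)
    (h := fun _ => y) ?_ tendsto_const_nhds (fun n => ?_) (fun n => ?_)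
  · simpa using (tendsto_const_nhds (x := y)).sub (hp.const_div_atTop (y * y))
  · have hpos : (0 : ℝ) < 2 ^ n := by positivity
    set z := y / 2 ^ n with hz
    have hz0 : 0 ≤ z := by positivity
    have he : Real.exp (-z) ≤ 1 - z + z * z := by
      have h1 : 1 + z ≤ Real.exp z := by linarith [Real.add_one_le_exp z]
      have h2 : Real.exp (-z) ≤ (1 + z)⁻¹ := by
        rw [Real.exp_neg]
        exact inv_anti₀ (by linarith) h1
      refine h2.trans ?_
      rw [inv_le_iff_one_le_mul₀ (by linarith)]
      nlinarith [mul_nonneg hz0 (mul_nonneg hz0 hz0)]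
    have hyz : y = 2 ^ n * z := by rw [hz]; field_simp
    calc y - y * y / 2 ^ n = 2 ^ n * (z - z * z) := by rw [hyz]; field_simp
      _ ≤ 2 ^ n * (1 - Real.exp (-z)) := by
        refine mul_le_mul_of_nonneg_left (by linarith) hpos.le
  · have hpos : (0 : ℝ) < 2 ^ n := by positivity
    have := Real.add_one_le_exp (-(y / 2 ^ n))
    calc (2 : ℝ) ^ n * (1 - Real.exp (-(y / 2 ^ n))) ≤ 2 ^ n * (y / 2 ^ n) :=
          mul_le_mul_of_nonneg_left (by linarith) hpos.le
      _ = y := by field_simp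

lemma iSup_expQuot (x : ℝ≥0∞) : ⨆ n, expQuot n x = x :=
  iSup_eq_of_tendsto (monotone_expQuot x) (tendsto_expQuot x)

/-- Monotone in both indices, so the diagonal supremum is the double supremum. In the Mecke formula
the step occurs both in the outer quotient and inside the increment of the exponent, which produces
exactly such a diagonal. -/
lemma iSup_expQuot_diag {b : ℕ → ℝ≥0∞} (hb : Monotone b) : ⨆ n, expQuot n (b n) = ⨆ n, b n := by
  refine le_antisymm (iSup_mono fun n => ?_) (iSup_le fun m => ?_)
  · conv_rhs => rw [← iSup_expQuot (b n)]
    exact le_iSup (fun k => expQuot k (b n)) n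
  · rw [← iSup_expQuot (b m)]
    refine iSup_le fun n => ?_
    refine le_trans ?_ (le_iSup (fun k => expQuot k (b k)) (max n m))
    exact (monotone_expQuot (b m) (le_max_left n m)).trans
      (expQuot_mono _ (hb (le_max_right n m)))

namespace IsMarkedPoisson

variable {Ω : Type*} [mΩ : MeasurableSpace Ω] {μ : Measure Ω}
  {M : Type*} [MeasurableSpace M] [IsProbabilityMeasure μ]
  {x : Tier → ℕ → Ω → Plane} {m : Station → Ω → M} {lam : Tier → ℝ}
  {ν : Tier → Measure M} {𝓕 : Station → MeasurableSpace Ω}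

/-- The pointwise identity `e^{-v} - e^{-v - ψ/2^n} = e^{-v} · expQuot n ψ / 2^n` is exact, so
integrating it gives the increment of the exponent without an error term. -/
lemma laplaceExponent_add_div (hν : ∀ k, IsProbabilityMeasure (ν k))
    {v ψ : Tier → Plane × M → ℝ≥0∞} (hv : ∀ k, Measurable (v k)) (hψ : ∀ k, Measurable (ψ k))
    (n : ℕ) :
    laplaceExponent lam ν (fun k q => v k q + ψ k q / 2 ^ n) = laplaceExponent lam ν v +
      (∑ k, ENNReal.ofReal (lam k) *
        ∫⁻ z, ∫⁻ y, expNeg (v k (z, y)) * expQuot n (ψ k (z, y)) ∂(ν k)) / 2 ^ n := by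
  have hev : ∀ k, Measurable fun q => expNeg (v k q) := fun k => measurable_expNeg.comp (hv k)
  have hq : ∀ k, Measurable fun q => expNeg (v k q) * expQuot n (ψ k q) := fun k =>
    (hev k).mul ((measurable_expQuot n).comp (hψ k))
  rw [laplaceExponent, laplaceExponent, div_eq_mul_inv, Finset.sum_mul, ← Finset.sum_add_distrib]
  refine Finset.sum_congr rfl fun k _ => ?_
  have hp := hν k
  have hm0 : Measurable fun z => 1 - ∫⁻ y, expNeg (v k (z, y)) ∂(ν k) :=
    measurable_const.sub (hev k).lintegral_prod_right'
  rw [mul_assoc, ← mul_add, ← lintegral_mul_const _ (hq k).lintegral_prod_right',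
    ← lintegral_add_left hm0]
  congr 1
  refine lintegral_congr fun z => ?_
  have hm1 : Measurable fun y => expNeg (v k (z, y)) := (hev k).comp measurable_prodMk_left
  have hm2 : Measurable fun y => expNeg (v k (z, y) + ψ k (z, y) / 2 ^ n) :=
    measurable_expNeg.comp (((hv k).comp measurable_prodMk_left).add
      (((hψ k).comp measurable_prodMk_left).div_const _))
  have hm3 : Measurable fun y => expNeg (v k (z, y)) * expQuot n (ψ k (z, y)) :=
    (hq k).comp measurable_prodMk_left
  have hle : ∫⁻ y, expNeg (v k (z, y)) ∂(ν k) ≤ 1 := by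
    calc _ ≤ ∫⁻ _, 1 ∂(ν k) := lintegral_mono fun y => expNeg_le_one _
      _ = 1 := by simp
  have hpt : ∀ y, expNeg (v k (z, y)) = expNeg (v k (z, y) + ψ k (z, y) / 2 ^ n) +
      expNeg (v k (z, y)) * expQuot n (ψ k (z, y)) * (2 ^ n)⁻¹ := by
    intro y
    rw [expQuot, expNeg_add, mul_assoc, mul_right_comm (2 ^ n),
      ENNReal.mul_inv_cancel (by simp) (by simp), one_mul, ← mul_add,
      add_tsub_cancel_of_le (expNeg_le_one _), mul_one]
  have hsum : ∫⁻ y, expNeg (v k (z, y)) ∂(ν k) =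
      ∫⁻ y, expNeg (v k (z, y) + ψ k (z, y) / 2 ^ n) ∂(ν k) +
        (∫⁻ y, expNeg (v k (z, y)) * expQuot n (ψ k (z, y)) ∂(ν k)) * (2 ^ n)⁻¹ := by
    rw [← lintegral_mul_const _ hm3, ← lintegral_add_left hm2]
    exact lintegral_congr hpt
  -- The mean of `e^{-v}` is at most one, so the truncated subtractions in `[0, ∞]` lose nothing.
  have hfin : ∀ {a b c : ℝ≥0∞}, a = b + c → a ≤ 1 → 1 - b = 1 - a + c := by
    intro a b c habc ha
    have hb : b ≠ ⊤ := ((le_self_add.trans habc.symm.le).trans ha |>.trans_lt ENNReal.one_lt_top).ne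
    refine ENNReal.sub_eq_of_eq_add hb ?_
    rw [add_assoc, add_comm c b, ← habc, tsub_add_cancel_of_le ha]
  exact hfin hsum hle

/-- The Mecke formula for a weight that is the exponential of a sum over the process. -/
theorem lintegral_tsum_mul_expNeg (h : IsMarkedPoisson x m lam ν 𝓕 μ)
    {v ψ : Tier → Plane × M → ℝ≥0∞} (hv : ∀ k, Measurable (v k)) (hψ : ∀ k, Measurable (ψ k)) :
    ∫⁻ ω, expNeg (∑' b : Station, v b.1 (x b.1 b.2 ω, m b ω)) *
        ∑' b : Station, ψ b.1 (x b.1 b.2 ω, m b ω) ∂μ =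
      expNeg (laplaceExponent lam ν v) *
        ∑ k, ENNReal.ofReal (lam k) *
          ∫⁻ z, ∫⁻ y, expNeg (v k (z, y)) * ψ k (z, y) ∂(ν k) := by
  have hprob := h.isProbabilityMeasure
  have hmb : ∀ {f : Tier → Plane × M → ℝ≥0∞} (_ : ∀ k, Measurable (f k)),
      Measurable fun ω => ∑' b : Station, f b.1 (x b.1 b.2 ω, m b ω) := by
    intro f hf
    exact Measurable.tsum fun b =>
      (hf b.1).comp ((h.pos_measurable _ _).prodMk (h.mark_measurable b))
  set V : Ω → ℝ≥0∞ := fun ω => ∑' b : Station, v b.1 (x b.1 b.2 ω, m b ω) with hV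
  set Ψ : Ω → ℝ≥0∞ := fun ω => ∑' b : Station, ψ b.1 (x b.1 b.2 ω, m b ω) with hΨ
  have hVm : Measurable fun ω => expNeg (V ω) := measurable_expNeg.comp (hmb hv)
  have hΨm : Measurable Ψ := hmb hψ
  set a := laplaceExponent lam ν v with ha
  set b : ℕ → ℝ≥0∞ := fun n => ∑ k, ENNReal.ofReal (lam k) *
        ∫⁻ z, ∫⁻ y, expNeg (v k (z, y)) * expQuot n (ψ k (z, y)) ∂(ν k) with hb
  have hev : ∀ k, Measurable fun q => expNeg (v k q) := fun k => measurable_expNeg.comp (hv k)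
  have hq : ∀ n k, Measurable fun q => expNeg (v k q) * expQuot n (ψ k q) := fun n k =>
    (hev k).mul ((measurable_expQuot n).comp (hψ k))
  have hqm : ∀ k z y, Monotone fun n => expNeg (v k (z, y)) * expQuot n (ψ k (z, y)) :=
    fun k z y n n' hn => mul_le_mul_right (monotone_expQuot _ hn) _
  have hbm : Monotone b := by
    intro n n' hn
    refine Finset.sum_le_sum fun k _ => mul_le_mul_right ?_ _
    exact lintegral_mono fun z => lintegral_mono fun y => hqm k z y hn
  have hbsup : ⨆ n, b n = ∑ k, ENNReal.ofReal (lam k) *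
          ∫⁻ z, ∫⁻ y, expNeg (v k (z, y)) * ψ k (z, y) ∂(ν k) := by
    rw [← ENNReal.finsetSum_iSup_of_monotone]
    · refine Finset.sum_congr rfl fun k _ => ?_
      rw [← ENNReal.mul_iSup, ← lintegral_iSup]
      · congr 1
        refine lintegral_congr fun z => ?_
        rw [← lintegral_iSup]
        · refine lintegral_congr fun y => ?_
          rw [← ENNReal.mul_iSup, iSup_expQuot]
        · exact fun n => (hq n k).comp measurable_prodMk_left
        · exact fun n n' hn y => hqm k z y hn
      · exact fun n => (hq n k).lintegral_prod_right'
      · exact fun n n' hn z => lintegral_mono fun y => hqm k z y hn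
    · exact fun k n n' hn => mul_le_mul_right
        (lintegral_mono fun z => lintegral_mono fun y => hqm k z y hn) _
  -- Both sides are the difference quotient, with step `2⁻ⁿ`, of the Laplace functional in the
  -- direction `ψ`: computed under the integral on the left, and from the closed form on the right.
  -- Both increase with `n`, so the derivative is a supremum.
  have hstep : ∀ n, ∫⁻ ω, expNeg (V ω) * expQuot n (Ψ ω) ∂μ = expNeg a * expQuot n (b n) := by
    intro n
    have h1 : ∀ ω, expNeg (V ω) * expQuot n (Ψ ω) =
        2 ^ n * (expNeg (V ω) - expNeg (V ω + Ψ ω / 2 ^ n)) := by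
      intro ω
      rw [expQuot, expNeg_add, mul_left_comm, ENNReal.mul_sub fun _ _ => expNeg_ne_top _, mul_one]
    have h2 : ∀ ω, V ω + Ψ ω / 2 ^ n =
        ∑' b : Station, (v b.1 (x b.1 b.2 ω, m b ω) + ψ b.1 (x b.1 b.2 ω, m b ω) / 2 ^ n) := by
      intro ω
      simp_rw [hV, hΨ, div_eq_mul_inv]
      rw [ENNReal.tsum_add, ENNReal.tsum_mul_right]
    have h2m : Measurable fun ω => expNeg (V ω + Ψ ω / 2 ^ n) :=
      measurable_expNeg.comp ((hmb hv).add (hΨm.div_const _))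
    have hVle : ∀ ω, expNeg (V ω + Ψ ω / 2 ^ n) ≤ expNeg (V ω) :=
      fun ω => expNeg_antitone le_self_add
    have hfin : ∫⁻ ω, expNeg (V ω + Ψ ω / 2 ^ n) ∂μ ≠ ⊤ := by
      refine (lt_of_le_of_lt (lintegral_mono fun ω => expNeg_le_one _) ?_).ne
      simp
    have hL1 : ∫⁻ ω, expNeg (V ω) ∂μ = expNeg a := h.lintegral_expNeg_tsum hv
    have hL2 : ∫⁻ ω, expNeg (V ω + Ψ ω / 2 ^ n) ∂μ = expNeg (a + b n / 2 ^ n) := by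
      simp_rw [h2]
      rw [ha, hb, ← laplaceExponent_add_div hprob hv hψ]
      exact h.lintegral_expNeg_tsum (v := fun k q => v k q + ψ k q / 2 ^ n)
        fun k => (hv k).add ((hψ k).div_const _)
    simp_rw [h1]
    have hdm : Measurable fun ω => expNeg (V ω) - expNeg (V ω + Ψ ω / 2 ^ n) := hVm.sub h2m
    rw [lintegral_const_mul _ hdm, lintegral_sub h2m hfin (Eventually.of_forall hVle),
      hL1, hL2, expQuot, expNeg_add, mul_left_comm (expNeg a),
      ENNReal.mul_sub fun _ _ => expNeg_ne_top _, mul_one]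
  calc ∫⁻ ω, expNeg (V ω) * Ψ ω ∂μ = ∫⁻ ω, ⨆ n, expNeg (V ω) * expQuot n (Ψ ω) ∂μ := by
        refine lintegral_congr fun ω => ?_
        rw [← ENNReal.mul_iSup, iSup_expQuot]
    _ = ⨆ n, ∫⁻ ω, expNeg (V ω) * expQuot n (Ψ ω) ∂μ := by
        refine lintegral_iSup (fun n => hVm.mul ((measurable_expQuot n).comp hΨm)) ?_
        exact fun n n' hn ω => mul_le_mul_right (monotone_expQuot _ hn) _
    _ = expNeg a * ⨆ n, b n := by
        simp_rw [hstep]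
        rw [← ENNReal.mul_iSup, iSup_expQuot_diag hbm]
    _ = _ := by rw [hbsup]

/-- The reduced Mecke formula: the weight is the exponential of a sum over the other points. -/
theorem lintegral_tsum_mul_expNeg_ne (h : IsMarkedPoisson x m lam ν 𝓕 μ) (k : Tier)
    {v : Tier → Plane × M → ℝ≥0∞} (hv : ∀ k, Measurable (v k)) {φ : Plane × M → ℝ≥0∞}
    (hφ : Measurable φ) (hvφ : ∀ q, φ q ≠ 0 → v k q ≠ ⊤) :
    ∫⁻ ω, ∑' j, φ (x k j ω, m (k, j) ω) *
        expNeg (∑' b : Station, if b = (k, j) then 0 else v b.1 (x b.1 b.2 ω, m b ω)) ∂μ =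
      expNeg (laplaceExponent lam ν v) *
        (ENNReal.ofReal (lam k) * ∫⁻ z, ∫⁻ y, φ (z, y) ∂(ν k)) := by
  -- Dividing by the point's own factor removes that point from the exponential of the full sum. The
  -- quotient is legitimate because `v` is finite wherever `φ` does not vanish.
  set ψ : Tier → Plane × M → ℝ≥0∞ := fun k' q => if k' = k then φ q * (expNeg (v k' q))⁻¹ else 0
    with hψ
  have hψm : ∀ k', Measurable (ψ k') := by
    intro k'
    by_cases hk : k' = k
    · simp only [hψ, if_pos hk]
      exact hφ.mul (measurable_expNeg.comp (hv k')).inv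
    · simp only [hψ, if_neg hk]
      exact measurable_const
  have hcancel : ∀ q, expNeg (v k q) * ψ k q = φ q := by
    intro q
    simp only [hψ, if_true]
    by_cases hq : φ q = 0
    · simp [hq]
    · rw [mul_left_comm, ENNReal.mul_inv_cancel (fun h0 => hvφ q hq (expNeg_eq_zero.1 h0))
        (expNeg_ne_top _), mul_one]
  have hmecke := h.lintegral_tsum_mul_expNeg hv hψm
  have hR : ∑ k', ENNReal.ofReal (lam k') *
      ∫⁻ z, ∫⁻ y, expNeg (v k' (z, y)) * ψ k' (z, y) ∂(ν k') =
      ENNReal.ofReal (lam k) * ∫⁻ z, ∫⁻ y, φ (z, y) ∂(ν k) := by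
    rw [Finset.sum_eq_single k]
    · simp_rw [hcancel]
    · intro k' _ hk
      simp [hψ, hk]
    · simp
  rw [hR] at hmecke
  rw [← hmecke]
  refine lintegral_congr fun ω => ?_
  have hψs : ∑' b : Station, ψ b.1 (x b.1 b.2 ω, m b ω) = ∑' j, ψ k (x k j ω, m (k, j) ω) := by
    rw [ENNReal.tsum_prod', tsum_fintype, Finset.sum_eq_single k]
    · intro k' _ hk
      simp [hψ, hk]
    · simp
  rw [hψs, ← ENNReal.tsum_mul_left]
  refine tsum_congr fun j => ?_
  have hsplit : ∑' b : Station, v b.1 (x b.1 b.2 ω, m b ω) = v k (x k j ω, m (k, j) ω) +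
      ∑' b : Station, if b = (k, j) then 0 else v b.1 (x b.1 b.2 ω, m b ω) :=
    (ENNReal.tsum_eq_add_tsum_ite (k, j)).trans <| by
      congr 2
      ext b
      congr
  rw [hsplit, expNeg_add, mul_right_comm, hcancel]

end IsMarkedPoisson

/-! ### The Mecke formula with a weight depending on the norm of the point -/

/-- Dyadic approximation from below. -/
def dyadicFloor (n : ℕ) (z : ℝ≥0) : ℝ≥0 := (⌊2 ^ n * z⌋₊ : ℝ≥0) / 2 ^ n

lemma dyadicFloor_le (n : ℕ) (z : ℝ≥0) : dyadicFloor n z ≤ z := by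
  rw [dyadicFloor, div_le_iff₀ (by positivity), mul_comm z]
  exact Nat.floor_le (by positivity)

lemma monotone_dyadicFloor (z : ℝ≥0) : Monotone fun n => dyadicFloor n z := by
  refine monotone_nat_of_le_succ fun n => ?_
  rw [dyadicFloor, dyadicFloor, div_le_div_iff₀ (by positivity) (by positivity), pow_succ,
    mul_comm (2 ^ n : ℝ≥0) 2, ← mul_assoc]
  refine mul_le_mul_left ?_ _
  have : ⌊2 ^ n * z⌋₊ * 2 ≤ ⌊2 * 2 ^ n * z⌋₊ := by
    refine Nat.le_floor ?_
    push_cast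
    calc (⌊2 ^ n * z⌋₊ : ℝ≥0) * 2 ≤ 2 ^ n * z * 2 :=
          mul_le_mul_left (Nat.floor_le (by positivity)) _
      _ = 2 * 2 ^ n * z := by ring
  exact_mod_cast this

lemma tendsto_dyadicFloor (z : ℝ≥0) : Tendsto (fun n => dyadicFloor n z) atTop (𝓝 z) := by
  rw [← NNReal.tendsto_coe]
  have hp : Tendsto (fun n : ℕ => (2 : ℝ) ^ n) atTop atTop :=
    tendsto_pow_atTop_atTop_of_one_lt (by norm_num)
  refine tendsto_of_tendsto_of_tendsto_of_le_of_le (g := fun n : ℕ => (z : ℝ) - 1 / 2 ^ n)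
    (h := fun _ => (z : ℝ)) ?_ tendsto_const_nhds (fun n => ?_)
    (fun n => NNReal.coe_le_coe.2 (dyadicFloor_le n z))
  · simpa using (tendsto_const_nhds (x := (z : ℝ))).sub (hp.const_div_atTop 1)
  · have h1 : (2 : ℝ≥0) ^ n * z < ⌊2 ^ n * z⌋₊ + 1 := Nat.lt_floor_add_one _
    have h2 : (2 : ℝ) ^ n * z < ⌊2 ^ n * z⌋₊ + 1 := by exact_mod_cast h1
    have h3 : (0 : ℝ) < 2 ^ n := by positivity
    simp only [dyadicFloor, NNReal.coe_div, NNReal.coe_natCast, NNReal.coe_pow, NNReal.coe_ofNat]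
    rw [sub_le_iff_le_add, ← add_div, le_div_iff₀ h3]
    linarith

/-- The discretised argument has countably many values, so measurability of every section `F z` is
enough and no joint measurability is required. -/
lemma measurable_apply_dyadicFloor {Ω : Type*} [MeasurableSpace Ω] (n : ℕ)
    {F : ℝ≥0 → Ω → ℝ≥0∞} (hF : ∀ z, Measurable (F z)) {r : Ω → ℝ≥0} (hr : Measurable r) :
    Measurable fun ω => F (dyadicFloor n (r ω)) ω := by
  have hc : Measurable (Function.uncurry fun (i : ℕ) ω => F ((i : ℝ≥0) / 2 ^ n) ω) :=
    measurable_from_prod_countable_right fun i => hF ((i : ℝ≥0) / 2 ^ n)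
  have hi : Measurable fun ω => ⌊2 ^ n * r ω⌋₊ :=
    Nat.measurable_floor.comp (hr.const_mul (2 ^ n))
  have := hc.comp (hi.prodMk measurable_id)
  simpa only [Function.comp_def, Function.uncurry, dyadicFloor, id] using this

lemma tendsto_tsum_of_monotone {ι : Type*} [Countable ι] {f : ℕ → ι → ℝ≥0∞} {g : ι → ℝ≥0∞}
    (hf : ∀ i, Monotone fun n => f n i) (hfg : ∀ i, Tendsto (fun n => f n i) atTop (𝓝 (g i))) :
    Tendsto (fun n => ∑' i, f n i) atTop (𝓝 (∑' i, g i)) := by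
  let _ : MeasurableSpace ι := ⊤
  have := lintegral_tendsto_of_tendsto_of_monotone (μ := Measure.count (α := ι))
    (f := f) (F := g) (fun n => (measurable_of_countable _).aemeasurable)
    (Eventually.of_forall hf) (Eventually.of_forall hfg)
  simpa [lintegral_count] using this

namespace IsMarkedPoisson

variable {Ω : Type*} [mΩ : MeasurableSpace Ω] {μ : Measure Ω}
  {M : Type*} [MeasurableSpace M] [IsProbabilityMeasure μ]
  {x : Tier → ℕ → Ω → Plane} {m : Station → Ω → M} {lam : Tier → ℝ}
  {ν : Tier → Measure M} {𝓕 : Station → MeasurableSpace Ω}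

/-- Campbell's formula. -/
theorem campbell_formula (h : IsMarkedPoisson x m lam ν 𝓕 μ) (k : Tier) {φ : Plane × M → ℝ≥0∞}
    (hφ : Measurable φ) :
    ∫⁻ ω, ∑' j, φ (x k j ω, m (k, j) ω) ∂μ =
      ENNReal.ofReal (lam k) * ∫⁻ z, ∫⁻ y, φ (z, y) ∂(ν k) := by
  have hprob := h.isProbabilityMeasure
  have := h.lintegral_tsum_mul_expNeg_ne k (v := fun _ _ => 0) (fun _ => measurable_const) hφ
    (by simp)
  simpa [laplaceExponent] using this

/-- Domination by one handles the mean over the mark. The integral over the plane may be infinite,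
so there monotone convergence is used instead. -/
lemma tendsto_laplaceExponent (hν : ∀ k, IsProbabilityMeasure (ν k))
    {v : ℕ → Tier → Plane × M → ℝ≥0∞} {w : Tier → Plane × M → ℝ≥0∞}
    (hv : ∀ n k, Measurable (v n k)) (hmono : ∀ k q, Monotone fun n => v n k q)
    (hlim : ∀ k q, Tendsto (fun n => v n k q) atTop (𝓝 (w k q))) :
    Tendsto (fun n => laplaceExponent lam ν (v n)) atTop (𝓝 (laplaceExponent lam ν w)) := by
  unfold laplaceExponent
  refine tendsto_finsetSum _ fun k _ => ENNReal.Tendsto.const_mul ?_ (Or.inr (by simp))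
  have hp := hν k
  refine lintegral_tendsto_of_tendsto_of_monotone (fun n => ?_)
    (Eventually.of_forall fun z n m hnm => ?_) (Eventually.of_forall fun z => ?_)
  · have : Measurable fun q => expNeg (v n k q) := measurable_expNeg.comp (hv n k)
    exact (measurable_const.sub this.lintegral_prod_right').aemeasurable
  · exact tsub_le_tsub_left (lintegral_mono fun y => expNeg_antitone (hmono k _ hnm)) _
  · refine ENNReal.Tendsto.sub tendsto_const_nhds ?_ (Or.inl (by simp))
    refine tendsto_lintegral_of_dominated_convergence (fun _ => 1) (fun n => ?_)
      (fun n => Eventually.of_forall fun y => expNeg_le_one _) (by simp)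
      (Eventually.of_forall fun y => (continuous_expNeg.tendsto _).comp (hlim k _))
    exact measurable_expNeg.comp ((hv n k).comp measurable_prodMk_left)

/-- The reduced Mecke formula with a weight that depends on the norm of the point. -/
theorem lintegral_tsum_mul_expNeg_nnnorm (h : IsMarkedPoisson x m lam ν 𝓕 μ) (k : Tier)
    {v : ℝ≥0 → Tier → Plane × M → ℝ≥0∞} (hv : ∀ z k, Measurable (v z k))
    (hmono : ∀ k q, Monotone fun z => v z k q)
    (hleft : ∀ k q z, Tendsto (fun n => v (dyadicFloor n z) k q) atTop (𝓝 (v z k q)))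
    {φ : Plane × M → ℝ≥0∞} (hφ : Measurable φ)
    (hvφ : ∀ q z, φ q ≠ 0 → z ≤ ‖q.1‖₊ → v z k q ≠ ⊤)
    (hfin : ∫⁻ z, ∫⁻ y, φ (z, y) ∂(ν k) ≠ ⊤) :
    ∫⁻ ω, ∑' j, φ (x k j ω, m (k, j) ω) *
        expNeg (∑' b : Station, if b = (k, j) then 0 else
          v ‖x k j ω‖₊ b.1 (x b.1 b.2 ω, m b ω)) ∂μ =
      ENNReal.ofReal (lam k) *
        ∫⁻ z, expNeg (laplaceExponent lam ν (v ‖z‖₊)) * ∫⁻ y, φ (z, y) ∂(ν k) := by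
  have hprob := h.isProbabilityMeasure
  have hφν : Measurable fun z => ∫⁻ y, φ (z, y) ∂(ν k) := hφ.lintegral_prod_right'
  have hφj : ∀ j, Measurable fun ω => φ (x k j ω, m (k, j) ω) := fun j =>
    hφ.comp ((h.pos_measurable _ _).prodMk (h.mark_measurable _))
  have hvm : ∀ z (b₀ : Station), Measurable fun ω => ∑' b : Station, if b = b₀ then 0 else
      v z b.1 (x b.1 b.2 ω, m b ω) := by
    intro z b₀
    refine Measurable.tsum fun b => ?_
    split_ifs
    · exact measurable_const
    · exact (hv z b.1).comp ((h.pos_measurable _ _).prodMk (h.mark_measurable _))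
  have hfl : ∀ n : ℕ, Measurable fun z : Plane => ⌊2 ^ n * ‖z‖₊⌋₊ := fun n =>
    Nat.measurable_floor.comp (measurable_const.mul measurable_nnnorm)
  -- the formula for the dyadic approximation
  have hstep : ∀ n : ℕ, ∫⁻ ω, ∑' j, φ (x k j ω, m (k, j) ω) *
        expNeg (∑' b : Station, if b = (k, j) then 0 else
          v (dyadicFloor n ‖x k j ω‖₊) b.1 (x b.1 b.2 ω, m b ω)) ∂μ =
      ENNReal.ofReal (lam k) * ∫⁻ z, expNeg (laplaceExponent lam ν (v (dyadicFloor n ‖z‖₊))) *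
        ∫⁻ y, φ (z, y) ∂(ν k) := by
    intro n
    -- Splits the points by the integer part of `2^n ‖·‖`. On each piece the weight no longer
    -- depends on the distinguished point, and the reduced Mecke formula applies.
    let φ' : ℕ → Plane × M → ℝ≥0∞ := fun i q => if ⌊2 ^ n * ‖q.1‖₊⌋₊ = i then φ q else 0
    have hset : ∀ i, MeasurableSet {q : Plane × M | ⌊2 ^ n * ‖q.1‖₊⌋₊ = i} := fun i =>
      ((hfl n).comp measurable_fst) (measurableSet_singleton i)
    have hφ' : ∀ i, Measurable (φ' i) := fun i => Measurable.ite (hset i) hφ measurable_const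
    have hsum : ∀ (q : Plane × M) (F : ℝ≥0 → ℝ≥0∞), φ q * F (dyadicFloor n ‖q.1‖₊) =
        ∑' i : ℕ, φ' i q * F ((i : ℝ≥0) / 2 ^ n) := by
      intro q F
      rw [tsum_eq_single ⌊2 ^ n * ‖q.1‖₊⌋₊]
      · simp [φ', dyadicFloor]
      · intro i hi
        simp [φ', hi.symm]
    have hL : ∀ ω, ∑' j, φ (x k j ω, m (k, j) ω) *
          expNeg (∑' b : Station, if b = (k, j) then 0 else
            v (dyadicFloor n ‖x k j ω‖₊) b.1 (x b.1 b.2 ω, m b ω)) =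
        ∑' i : ℕ, ∑' j, φ' i (x k j ω, m (k, j) ω) *
          expNeg (∑' b : Station, if b = (k, j) then 0 else
            v ((i : ℝ≥0) / 2 ^ n) b.1 (x b.1 b.2 ω, m b ω)) := by
      intro ω
      rw [ENNReal.tsum_comm]
      exact tsum_congr fun j => hsum (x k j ω, m (k, j) ω) fun z =>
        expNeg (∑' b : Station, if b = (k, j) then 0 else v z b.1 (x b.1 b.2 ω, m b ω))
    simp_rw [hL]
    rw [lintegral_tsum]
    · have hmk : ∀ i : ℕ, ∫⁻ ω, ∑' j, φ' i (x k j ω, m (k, j) ω) *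
          expNeg (∑' b : Station, if b = (k, j) then 0 else
            v ((i : ℝ≥0) / 2 ^ n) b.1 (x b.1 b.2 ω, m b ω)) ∂μ =
          ENNReal.ofReal (lam k) * ∫⁻ z, ∫⁻ y, φ' i (z, y) *
            expNeg (laplaceExponent lam ν (v ((i : ℝ≥0) / 2 ^ n))) ∂(ν k) := by
        intro i
        rw [h.lintegral_tsum_mul_expNeg_ne k (hv _) (hφ' i)]
        · rw [mul_left_comm, ← lintegral_const_mul _ (hφ' i).lintegral_prod_right']
          congr 1
          refine lintegral_congr fun z => ?_
          have hm : Measurable fun y => φ' i (z, y) := (hφ' i).comp measurable_prodMk_left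
          rw [lintegral_mul_const _ hm, mul_comm]
        · intro q hq
          have hqi : ⌊2 ^ n * ‖q.1‖₊⌋₊ = i := by
            by_contra hne
            exact hq (if_neg hne)
          have hq0 : φ q ≠ 0 := by
            intro h0
            exact hq (by simp [φ', h0])
          refine hvφ q _ hq0 ?_
          rw [← hqi]
          exact dyadicFloor_le n _
      simp_rw [hmk]
      rw [ENNReal.tsum_mul_left, ← lintegral_tsum]
      · congr 1
        refine lintegral_congr fun z => ?_
        rw [← lintegral_tsum]
        · have := fun y => hsum (z, y) fun t => expNeg (laplaceExponent lam ν (v t))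
          simp_rw [← this]
          have hm : Measurable fun y => φ (z, y) := hφ.comp measurable_prodMk_left
          rw [lintegral_mul_const _ hm, mul_comm]
        · exact fun i => (((hφ' i).comp measurable_prodMk_left).mul_const _).aemeasurable
      · exact fun i => ((hφ' i).mul_const _).lintegral_prod_right'.aemeasurable
    · intro i
      refine (Measurable.tsum fun j => ?_).aemeasurable
      exact ((hφ' i).comp ((h.pos_measurable _ _).prodMk (h.mark_measurable _))).mul
        (measurable_expNeg.comp (hvm _ _))
  have hdy : ∀ j n, Measurable fun ω => φ (x k j ω, m (k, j) ω) *
        expNeg (∑' b : Station, if b = (k, j) then 0 else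
          v (dyadicFloor n ‖x k j ω‖₊) b.1 (x b.1 b.2 ω, m b ω)) := by
    intro j n
    exact (hφj j).mul (measurable_apply_dyadicFloor n (F := fun z ω =>
      expNeg (∑' b : Station, if b = (k, j) then 0 else v z b.1 (x b.1 b.2 ω, m b ω)))
      (fun z => measurable_expNeg.comp (hvm z _)) (h.pos_measurable k j).nnnorm)
  -- passage to the limit
  have hLlim : Tendsto (fun n : ℕ => ∫⁻ ω, ∑' j, φ (x k j ω, m (k, j) ω) *
        expNeg (∑' b : Station, if b = (k, j) then 0 else
          v (dyadicFloor n ‖x k j ω‖₊) b.1 (x b.1 b.2 ω, m b ω)) ∂μ) atTop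
      (𝓝 (∫⁻ ω, ∑' j, φ (x k j ω, m (k, j) ω) *
        expNeg (∑' b : Station, if b = (k, j) then 0 else
          v ‖x k j ω‖₊ b.1 (x b.1 b.2 ω, m b ω)) ∂μ)) := by
    -- The exponentials decrease along the approximation, so monotone convergence is unavailable;
    -- Campbell's formula together with `hfin` supplies an integrable majorant.
    have hbound : ∫⁻ ω, ∑' j, φ (x k j ω, m (k, j) ω) ∂μ ≠ ⊤ := by
      rw [h.campbell_formula k hφ]
      exact ENNReal.mul_ne_top (by simp) hfin
    refine tendsto_lintegral_of_dominated_convergence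
      (fun ω => ∑' j, φ (x k j ω, m (k, j) ω)) (fun n => Measurable.tsum fun j => hdy j n)
      (fun n => Eventually.of_forall fun ω => ENNReal.tsum_le_tsum fun j =>
        mul_le_of_le_one_right' (expNeg_le_one _)) hbound ?_
    filter_upwards [ae_lt_top (Measurable.tsum hφj) hbound] with ω hω
    simp_rw [← lintegral_count]
    refine tendsto_lintegral_of_dominated_convergence
      (fun j => φ (x k j ω, m (k, j) ω)) (fun n => measurable_of_countable _)
      (fun n => Eventually.of_forall fun j => mul_le_of_le_one_right' (expNeg_le_one _))
      (by rw [lintegral_count]; exact hω.ne) (Eventually.of_forall fun j => ?_)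
    have hφt : φ (x k j ω, m (k, j) ω) ≠ ⊤ := ((ENNReal.le_tsum j).trans_lt hω).ne
    refine ENNReal.Tendsto.const_mul ((continuous_expNeg.tendsto _).comp ?_) (Or.inr hφt)
    simp_rw [lintegral_count]
    refine tendsto_tsum_of_monotone (fun b n n' hn => ?_) fun b => ?_
    · dsimp only
      split_ifs
      · exact le_rfl
      · exact hmono _ _ (monotone_dyadicFloor _ hn)
    · split_ifs
      · exact tendsto_const_nhds
      · exact hleft _ _ _
  have hRlim : Tendsto (fun n : ℕ => ENNReal.ofReal (lam k) *
        ∫⁻ z, expNeg (laplaceExponent lam ν (v (dyadicFloor n ‖z‖₊))) *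
          ∫⁻ y, φ (z, y) ∂(ν k)) atTop
      (𝓝 (ENNReal.ofReal (lam k) *
        ∫⁻ z, expNeg (laplaceExponent lam ν (v ‖z‖₊)) * ∫⁻ y, φ (z, y) ∂(ν k))) := by
    refine ENNReal.Tendsto.const_mul ?_ (Or.inr (by simp))
    refine tendsto_lintegral_of_dominated_convergence (fun z => ∫⁻ y, φ (z, y) ∂(ν k))
      (fun n => ?_) (fun n => Eventually.of_forall fun z =>
        mul_le_of_le_one_left' (expNeg_le_one _)) hfin ?_
    · refine Measurable.mul ?_ hφν
      exact (measurable_of_countable fun i : ℕ =>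
        expNeg (laplaceExponent lam ν (v ((i : ℝ≥0) / 2 ^ n)))).comp (hfl n)
    · filter_upwards [ae_lt_top hφν hfin] with z hz
      refine ENNReal.Tendsto.mul_const ((continuous_expNeg.tendsto _).comp ?_) (Or.inr hz.ne)
      exact tendsto_laplaceExponent hprob (fun n k => hv _ k)
        (fun k q n n' hn => hmono k q (monotone_dyadicFloor _ hn)) (fun k q => hleft k q _)
  exact tendsto_nhds_unique hLlim (hRlim.congr fun n => (hstep n).symm)

end IsMarkedPoisson

/-! ### Radial integrals in the plane -/

/-- The disc `π ‖z‖² < b` has area `b`, so preimages of intervals are annuli of the right area. Area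
is the coordinate in which all later radial integrals become exponential integrals on the half-line.
-/
lemma map_area_volume :
    (volume : Measure Plane).map (fun z => Real.pi * ‖z‖ ^ 2) = volume.restrict (Set.Ioi 0) := by
  have hm : Measurable fun z : Plane => Real.pi * ‖z‖ ^ 2 := by fun_prop
  have hball : ∀ b : ℝ, 0 ≤ b → volume {z : Plane | Real.pi * ‖z‖ ^ 2 < b} = ENNReal.ofReal b := by
    intro b hb
    have hset : {z : Plane | Real.pi * ‖z‖ ^ 2 < b} = Metric.ball 0 (√(b / Real.pi)) := by
      ext z
      rw [mem_ball_zero_iff, Set.mem_ofPred_eq, Real.lt_sqrt (norm_nonneg _),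
        lt_div_iff₀ Real.pi_pos, mul_comm]
    rw [hset, EuclideanSpace.volume_ball_fin_two, ← ENNReal.ofReal_pow (Real.sqrt_nonneg _),
      ← ENNReal.ofReal_mul (by positivity), Real.sq_sqrt (by positivity),
      div_mul_cancel₀ _ Real.pi_pos.ne']
  have hcball : ∀ b : ℝ, 0 ≤ b → volume {z : Plane | Real.pi * ‖z‖ ^ 2 ≤ b} = ENNReal.ofReal b := by
    intro b hb
    have hset : {z : Plane | Real.pi * ‖z‖ ^ 2 ≤ b} = Metric.closedBall 0 (√(b / Real.pi)) := by
      ext z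
      rw [mem_closedBall_zero_iff, Set.mem_ofPred_eq, Real.le_sqrt (norm_nonneg _) (by positivity),
        le_div_iff₀ Real.pi_pos, mul_comm]
    rw [hset, EuclideanSpace.volume_closedBall_fin_two, ← ENNReal.ofReal_pow (Real.sqrt_nonneg _),
      ← ENNReal.ofReal_mul (by positivity), Real.sq_sqrt (by positivity),
      div_mul_cancel₀ _ Real.pi_pos.ne']
  symm
  refine Real.measure_ext_Ioo_rat fun a b => ?_
  rw [Measure.map_apply hm measurableSet_Ioo, Measure.restrict_apply measurableSet_Ioo,
    Set.Ioo_inter_Ioi, Real.volume_Ioo]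
  rcases le_or_gt (b : ℝ) 0 with hb | hb
  · have : (fun z : Plane => Real.pi * ‖z‖ ^ 2) ⁻¹' Set.Ioo (a : ℝ) b = ∅ := by
      ext z
      simp only [Set.mem_preimage, Set.mem_Ioo, Set.mem_empty_iff_false, iff_false, not_and, not_lt]
      exact fun _ => hb.trans (by positivity)
    rw [this, measure_empty, ENNReal.ofReal_of_nonpos]
    have := le_max_right (a : ℝ) 0
    linarith
  rcases lt_or_ge (a : ℝ) 0 with ha | ha
  · have : (fun z : Plane => Real.pi * ‖z‖ ^ 2) ⁻¹' Set.Ioo (a : ℝ) b =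
        {z : Plane | Real.pi * ‖z‖ ^ 2 < b} := by
      ext z
      simp only [Set.mem_preimage, Set.mem_Ioo, Set.mem_ofPred_eq, and_iff_right_iff_imp]
      exact fun _ => ha.trans_le (by positivity)
    rw [this, hball _ hb.le, max_eq_right ha.le, sub_zero]
  · have : (fun z : Plane => Real.pi * ‖z‖ ^ 2) ⁻¹' Set.Ioo (a : ℝ) b =
        {z : Plane | Real.pi * ‖z‖ ^ 2 < b} \ {z : Plane | Real.pi * ‖z‖ ^ 2 ≤ a} := by
      ext z
      simp only [Set.mem_preimage, Set.mem_Ioo, Set.mem_ofPred_eq, Set.mem_sdiff, not_le, and_comm]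
    rw [this, max_eq_left ha]
    rcases lt_or_ge (a : ℝ) b with hab | hab
    · rw [measure_sdiff, hball _ hb.le, hcball _ ha, ENNReal.ofReal_sub _ ha]
      · exact fun z hz => lt_of_le_of_lt hz hab
      · exact (hm measurableSet_Iic).nullMeasurableSet
      · rw [hcball _ ha]
        exact ENNReal.ofReal_ne_top
    · rw [ENNReal.ofReal_of_nonpos (by linarith)]
      rw [Set.sdiff_eq_empty.2, measure_empty]
      exact fun z hz => (lt_of_lt_of_le hz hab).le

lemma lintegral_area {f : ℝ → ℝ≥0∞} (hf : Measurable f) :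
    ∫⁻ z : Plane, f (Real.pi * ‖z‖ ^ 2) = ∫⁻ u in Set.Ioi 0, f u := by
  rw [← map_area_volume, lintegral_map hf (by fun_prop)]

lemma lintegral_Ioi_div {f : ℝ → ℝ≥0∞} (hf : Measurable f) {U : ℝ} (hU : 0 < U) (c : ℝ) :
    ∫⁻ u in Set.Ioi (U * c), f (u / U) = ENNReal.ofReal U * ∫⁻ u in Set.Ioi c, f u := by
  have hf' : Measurable fun u => f (u / U) := hf.comp (measurable_id.div_const U)
  conv_lhs => rw [← Real.smul_map_volume_mul_left hU.ne']
  rw [Measure.restrict_smul, lintegral_smul_measure, abs_of_pos hU, smul_eq_mul,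
    setLIntegral_map measurableSet_Ioi hf' (measurable_const_mul U)]
  congr 1
  have : (fun x => U * x) ⁻¹' Set.Ioi (U * c) = Set.Ioi c := by
    ext x
    exact ⟨fun h => lt_of_mul_lt_mul_left h hU.le, fun h => mul_lt_mul_of_pos_left h hU⟩
  rw [this]
  simp_rw [mul_div_cancel_left₀ _ hU.ne']

lemma lintegral_exp_neg_Ioi {K : ℝ} (hK : 0 < K) :
    ∫⁻ u in Set.Ioi (0 : ℝ), ENNReal.ofReal (Real.exp (-(K * u))) = ENNReal.ofReal K⁻¹ := by
  have h1 : ∫ u in Set.Ioi (0 : ℝ), Real.exp (-K * u) = K⁻¹ := by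
    have := integral_exp_mul_Ioi (a := -K) (by linarith) 0
    simpa using this
  have hint : IntegrableOn (fun u => Real.exp (-K * u)) (Set.Ioi 0) :=
    integrableOn_exp_mul_Ioi (by linarith) 0
  rw [← h1, ofReal_integral_eq_lintegral_ofReal hint
    (Eventually.of_forall fun u => (Real.exp_pos _).le)]
  simp_rw [neg_mul]

/-! ### The interference functions -/

section Interference

variable {α : ℝ}

lemma integrableOn_div_add_rpow (hα : 2 < α) {x : ℝ} (hx : 0 ≤ x) :
    IntegrableOn (fun u : ℝ => x / (x + u ^ (α / 2))) (Set.Ioi 1) := by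
  refine Integrable.mono'
    ((integrableOn_Ioi_rpow_of_lt (a := -(α / 2)) (by linarith) one_pos).const_mul x) ?_ ?_
  · exact Measurable.aestronglyMeasurable (by fun_prop)
  · filter_upwards [ae_restrict_mem measurableSet_Ioi] with u hu
    have hu0 : (0 : ℝ) < u := one_pos.trans hu
    have hpos : 0 < u ^ (α / 2) := Real.rpow_pos_of_pos hu0 _
    rw [Real.norm_of_nonneg (by positivity), Real.rpow_neg hu0.le, ← div_eq_mul_inv]
    exact div_le_div_of_nonneg_left hx hpos (by linarith)

/-- Substitution `t = u^{-α/2}` in the Euler integral. Here `c - b = 1`, so no power of `1 - t`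
remains, and `Γ(c)/Γ(b) = 1 - 2/α` turns the prefactor into `2x/α`. -/
lemma G_eq_integral (hα : 2 < α) {x : ℝ} (hx : 0 ≤ x) :
    G x α = ∫ u in Set.Ioi (1 : ℝ), x / (x + u ^ (α / 2)) := by
  have hα0 : 0 < α := by linarith
  have hb : 0 < 1 - 2 / α := by
    rw [sub_pos, div_lt_one hα0]
    exact hα
  -- Extension by zero beyond `1` lets the power substitution act on the whole half-line; `t < 1`
  -- corresponds to `u > 1`.
  let g : ℝ → ℝ := (Set.Iio 1).indicator fun t => 2 * x / α * (t ^ (-(2 / α)) * (1 + x * t)⁻¹)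
  have hG : G x α = ∫ t in Set.Ioi (0 : ℝ), g t := by
    have hcb : (2 - 2 / α) - (1 - 2 / α) = 1 := by ring
    have hΓ : Real.Gamma (2 - 2 / α) = (1 - 2 / α) * Real.Gamma (1 - 2 / α) := by
      rw [← Real.Gamma_add_one hb.ne']
      congr 1
      ring
    have hΓ0 : Real.Gamma (1 - 2 / α) ≠ 0 := (Real.Gamma_pos_of_pos hb).ne'
    rw [G, gauss2F1, hcb, hΓ, Real.Gamma_one, intervalIntegral.integral_of_le zero_le_one,
      setIntegral_indicator measurableSet_Iio, Set.Ioi_inter_Iio, integral_Ioc_eq_integral_Ioo,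
      integral_const_mul]
    have hint : ∫ t in Set.Ioo (0 : ℝ) 1, t ^ (1 - 2 / α - 1) * (1 - t) ^ ((1 : ℝ) - 1) *
        (1 - -x * t) ^ (-1 : ℝ) = ∫ t in Set.Ioo (0 : ℝ) 1, t ^ (-(2 / α)) * (1 + x * t)⁻¹ := by
      refine setIntegral_congr_fun measurableSet_Ioo fun t ht => ?_
      rw [sub_self, Real.rpow_zero, mul_one, Real.rpow_neg_one]
      congr 2 <;> ring
    rw [hint]
    have hα2 : α - 2 ≠ 0 := by linarith
    generalize ∫ t in Set.Ioo (0 : ℝ) 1, t ^ (-(2 / α)) * (1 + x * t)⁻¹ = I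
    generalize Real.Gamma (1 - 2 / α) = γ at hΓ0
    field_simp
  rw [hG, ← integral_comp_rpow_Ioi g (p := -(α / 2)) (by linarith)]
  have hsplit : ∀ u ∈ Set.Ioi (0 : ℝ), (|(-(α / 2))| * u ^ (-(α / 2) - 1)) • g (u ^ (-(α / 2))) =
      (Set.Ioi 1).indicator (fun u : ℝ => x / (x + u ^ (α / 2))) u := by
    intro u hu
    have hu0 : (0 : ℝ) < u := hu
    by_cases h1 : 1 < u
    · have hlt : u ^ (-(α / 2)) < 1 := Real.rpow_lt_one_of_one_lt_of_neg h1 (by linarith)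
      rw [Set.indicator_of_mem (Set.mem_Ioi.2 h1), smul_eq_mul]
      simp only [g]
      rw [Set.indicator_of_mem (Set.mem_Iio.2 hlt), abs_neg, abs_of_pos (by linarith),
        ← Real.rpow_mul hu0.le]
      have he : -(α / 2) * -(2 / α) = 1 := by field_simp
      have hw : 0 < u ^ (α / 2) := Real.rpow_pos_of_pos hu0 _
      rw [he, Real.rpow_one, Real.rpow_sub_one hu0.ne', Real.rpow_neg hu0.le]
      have : 0 < x + u ^ (α / 2) := by linarith
      have : 1 + x * (u ^ (α / 2))⁻¹ ≠ 0 := by positivity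
      field_simp
      ring
    · have hle : ¬ u ^ (-(α / 2)) < 1 := by
        rw [not_lt]
        exact Real.one_le_rpow_of_pos_of_le_one_of_nonpos hu0 (not_lt.1 h1) (by linarith)
      rw [Set.indicator_of_notMem (by simpa using h1)]
      simp only [g]
      rw [Set.indicator_of_notMem (by simpa using hle), smul_zero]
  rw [setIntegral_congr_fun measurableSet_Ioi hsplit, setIntegral_indicator measurableSet_Ioi,
    Set.Ioi_inter_Ioi, max_eq_right zero_le_one]

lemma G_nonneg (hα : 2 < α) {x : ℝ} (hx : 0 ≤ x) : 0 ≤ G x α := by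
  rw [G_eq_integral hα hx]
  refine setIntegral_nonneg measurableSet_Ioi fun u hu => ?_
  have hu0 : (0 : ℝ) < u := one_pos.trans hu
  positivity

lemma G_zero : G 0 α = 0 := by simp [G]

lemma ofReal_G (hα : 2 < α) {x : ℝ} (hx : 0 ≤ x) :
    ∫⁻ u in Set.Ioi (1 : ℝ), ENNReal.ofReal (x / (x + u ^ (α / 2))) = ENNReal.ofReal (G x α) := by
  rw [G_eq_integral hα hx, ofReal_integral_eq_lintegral_ofReal (integrableOn_div_add_rpow hα hx)]
  filter_upwards [ae_restrict_mem measurableSet_Ioi] with u hu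
  have hu0 : (0 : ℝ) < u := one_pos.trans hu
  simp only [Pi.zero_apply]
  positivity

/-- The integrands are ordered, so the integral may be restricted to `u > x^{2/α}`. There `u^{α/2} ≥
x ≥ y`, and the difference of the integrands is at least `(x - y) / (4 u^{α/2})`, whose integral is
explicit. This growth is what makes the integral over the rate converge. -/
lemma G_sub_ge (hα : 2 < α) {x y : ℝ} (hx : 1 ≤ x) (hy : 0 ≤ y) (hyx : y ≤ x) :
    (1 - y / x) * x ^ (2 / α) / (2 * α) ≤ G x α - G y α := by
  have hx0 : 0 < x := one_pos.trans_le hx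
  have hα0 : 0 < α := by linarith
  set c := x ^ (2 / α) with hc
  have hc1 : 1 ≤ c := Real.one_le_rpow hx (by positivity)
  have hc0 : 0 < c := one_pos.trans_le hc1
  have hcx : c ^ (α / 2) = x := by
    rw [hc, ← Real.rpow_mul hx0.le]
    have : 2 / α * (α / 2) = 1 := by field_simp
    rw [this, Real.rpow_one]
  have hix := integrableOn_div_add_rpow hα hx0.le
  have hiy := integrableOn_div_add_rpow hα hy
  have hip := (integrableOn_Ioi_rpow_of_lt (a := -(α / 2)) (by linarith) hc0).const_mul
    ((x - y) / 4)
  rw [G_eq_integral hα hx0.le, G_eq_integral hα hy, ← integral_sub hix hiy]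
  have hval : ∫ u in Set.Ioi c, (x - y) / 4 * u ^ (-(α / 2)) =
      (1 - y / x) * c / (2 * (α - 2)) := by
    rw [integral_const_mul, integral_Ioi_rpow_of_lt (by linarith) hc0, Real.rpow_add hc0,
      Real.rpow_neg hc0.le, hcx, Real.rpow_one]
    have h1 : -(α / 2) + 1 ≠ 0 := by linarith
    have h2 : α - 2 ≠ 0 := by linarith
    have h3 : -(α / 2) + 1 = -((α - 2) / 2) := by ring
    rw [h3]
    field_simp
    ring
  have hpt : ∀ u : ℝ, 0 < u → 0 ≤ x / (x + u ^ (α / 2)) - y / (y + u ^ (α / 2)) := by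
    intro u hu
    have hw : 0 < u ^ (α / 2) := Real.rpow_pos_of_pos hu _
    rw [sub_nonneg, div_le_div_iff₀ (by linarith) (by linarith)]
    nlinarith [mul_nonneg hw.le (sub_nonneg.2 hyx)]
  calc (1 - y / x) * c / (2 * α) ≤ (1 - y / x) * c / (2 * (α - 2)) := by
        have : 0 ≤ 1 - y / x := by
          rw [sub_nonneg, div_le_one hx0]
          exact hyx
        have h2 : 0 < α - 2 := by linarith
        refine div_le_div_of_nonneg_left (by positivity) (by linarith) (by linarith)
    _ = ∫ u in Set.Ioi c, (x - y) / 4 * u ^ (-(α / 2)) := hval.symm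
    _ ≤ ∫ u in Set.Ioi c, (x / (x + u ^ (α / 2)) - y / (y + u ^ (α / 2))) := by
        refine setIntegral_mono_on hip
          ((hix.sub hiy).mono_set (Set.Ioi_subset_Ioi hc1)) measurableSet_Ioi fun u hu => ?_
        have hu0 : (0 : ℝ) < u := hc0.trans hu
        have hw : x ≤ u ^ (α / 2) := by
          rw [← hcx]
          exact Real.rpow_le_rpow hc0.le (le_of_lt hu) (by positivity)
        rw [Real.rpow_neg hu0.le]
        set w := u ^ (α / 2)
        have hw0 : 0 < w := hx0.trans_le hw
        have heq : x / (x + w) - y / (y + w) = (x - y) * (w / ((x + w) * (y + w))) := by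
          field_simp
          ring
        have heq' : (x - y) / 4 * w⁻¹ = (x - y) * (1 / (4 * w)) := by
          field_simp
        rw [heq, heq']
        refine mul_le_mul_of_nonneg_left ?_ (by linarith)
        rw [div_le_div_iff₀ (by positivity) (by positivity)]
        nlinarith [mul_nonneg (sub_nonneg.2 hw) (sub_nonneg.2 (hyx.trans hw)),
          mul_nonneg hw0.le (sub_nonneg.2 hw), mul_nonneg hw0.le (sub_nonneg.2 (hyx.trans hw))]
    _ ≤ ∫ u in Set.Ioi (1 : ℝ), (x / (x + u ^ (α / 2)) - y / (y + u ^ (α / 2))) := by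
        refine setIntegral_mono_set (hix.sub hiy) ?_ (Set.Ioi_subset_Ioi hc1).eventuallyLE
        filter_upwards [ae_restrict_mem measurableSet_Ioi] with u hu
        exact hpt u (one_pos.trans hu)

lemma G_mono (hα : 2 < α) {x y : ℝ} (hy : 0 ≤ y) (hyx : y ≤ x) : G y α ≤ G x α := by
  rw [G_eq_integral hα (hy.trans hyx), G_eq_integral hα hy]
  refine setIntegral_mono_on (integrableOn_div_add_rpow hα hy)
    (integrableOn_div_add_rpow hα (hy.trans hyx)) measurableSet_Ioi fun u hu => ?_
  have hw : 0 < u ^ (α / 2) := Real.rpow_pos_of_pos (one_pos.trans hu) _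
  rw [div_le_div_iff₀ (by linarith) (by linarith)]
  nlinarith [mul_nonneg hw.le (sub_nonneg.2 hyx)]

lemma measurable_G : Measurable fun x => G x α := by
  unfold G gauss2F1
  refine Measurable.mul (by fun_prop) (Measurable.const_mul ?_ _)
  simp_rw [intervalIntegral.integral_of_le zero_le_one]
  refine StronglyMeasurable.measurable (StronglyMeasurable.integral_prod_right
    (Measurable.stronglyMeasurable ?_))
  unfold Function.uncurry
  fun_prop

lemma measurable_H : Measurable fun x => H x α := by
  unfold H
  fun_prop

lemma H_zero (hα : 2 < α) : H 0 α = 0 := by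
  rw [H, Real.zero_rpow (by positivity)]
  simp

lemma beta_two_div_pos (hα : 2 < α) : 0 < beta (2 / α) (1 - 2 / α) := by
  have hα0 : 0 < α := by linarith
  refine beta_pos (by positivity) ?_
  rw [sub_pos, div_lt_one hα0]
  exact hα

lemma H_nonneg (hα : 2 < α) {x : ℝ} (hx : 0 ≤ x) : 0 ≤ H x α := by
  have := beta_two_div_pos hα
  have hα0 : 0 < α := by linarith
  unfold H
  positivity

lemma H_mono (hα : 2 < α) {x y : ℝ} (hy : 0 ≤ y) (hyx : y ≤ x) : H y α ≤ H x α := by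
  have := beta_two_div_pos hα
  have hα0 : 0 < α := by linarith
  unfold H
  gcongr

/-- Writing `x / (x + w)` as `∫ x e^{-(x + w) h} dh` and exchanging the integrals leaves a product
of two Gamma integrals; their Gamma values form the Beta function because its arguments add up to
one. -/
lemma ofReal_H (hα : 2 < α) {x : ℝ} (hx : 0 ≤ x) :
    ∫⁻ u in Set.Ioi (0 : ℝ), ENNReal.ofReal (x / (x + u ^ (α / 2))) = ENNReal.ofReal (H x α) := by
  have hα0 : 0 < α := by linarith
  rcases hx.eq_or_lt with rfl | hx0
  · simp [H_zero hα]
  have hb : 0 < 1 - 2 / α := by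
    rw [sub_pos, div_lt_one hα0]
    exact hα
  have hΓ1 : 0 < Real.Gamma (2 / (α) + 1) := Real.Gamma_pos_of_pos (by positivity)
  have hΓ2 : 0 < Real.Gamma (1 - 2 / α) := Real.Gamma_pos_of_pos hb
  have h1 : ∀ u ∈ Set.Ioi (0 : ℝ), ENNReal.ofReal (x / (x + u ^ (α / 2))) =
      ∫⁻ h in Set.Ioi (0 : ℝ), ENNReal.ofReal (x * Real.exp (-((x + u ^ (α / 2)) * h))) := by
    intro u hu
    have hw : 0 < x + u ^ (α / 2) := add_pos hx0 (Real.rpow_pos_of_pos hu _)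
    simp_rw [ENNReal.ofReal_mul hx]
    rw [lintegral_const_mul _ (by fun_prop), lintegral_exp_neg_Ioi hw, ← ENNReal.ofReal_mul hx,
      div_eq_mul_inv]
  rw [setLIntegral_congr_fun measurableSet_Ioi h1, lintegral_lintegral_swap
    (Measurable.aemeasurable (by unfold Function.uncurry; fun_prop))]
  have h2 : ∀ h ∈ Set.Ioi (0 : ℝ), ∫⁻ u in Set.Ioi (0 : ℝ),
      ENNReal.ofReal (x * Real.exp (-((x + u ^ (α / 2)) * h))) =
      ENNReal.ofReal (x * Real.Gamma (2 / α + 1) *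
        (h ^ ((1 - 2 / α) - 1) * Real.exp (-(x * h)))) := by
    intro h hh
    have hh0 : (0 : ℝ) < h := hh
    have hI := integral_exp_neg_mul_rpow (p := α / 2) (b := h) (by positivity) hh0
    -- A nonzero Bochner integral certifies integrability, since integrals of non-integrable
    -- functions are zero by convention.
    have hne : ∫ u in Set.Ioi (0 : ℝ), Real.exp (-h * u ^ (α / 2)) ≠ 0 := by
      rw [hI, one_div_div]
      have := Real.rpow_pos_of_pos hh0 (-1 / (α / 2))
      positivity
    have hint : IntegrableOn (fun u => Real.exp (-h * u ^ (α / 2))) (Set.Ioi 0) :=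
      not_imp_comm.1 integral_undef hne
    have hsplit : ∀ u : ℝ, ENNReal.ofReal (x * Real.exp (-((x + u ^ (α / 2)) * h))) =
        ENNReal.ofReal (x * Real.exp (-(x * h))) *
          ENNReal.ofReal (Real.exp (-h * u ^ (α / 2))) := by
      intro u
      rw [← ENNReal.ofReal_mul (by positivity), mul_assoc, ← Real.exp_add]
      congr 3
      ring
    simp_rw [hsplit]
    rw [lintegral_const_mul _ (by fun_prop), ← ofReal_integral_eq_lintegral_ofReal hint
      (Eventually.of_forall fun u => (Real.exp_pos _).le), hI, ← ENNReal.ofReal_mul (by positivity),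
      one_div_div]
    congr 1
    have he : -1 / (α / 2) = 1 - 2 / α - 1 := by
      field_simp
      ring
    rw [he]
    ring
  rw [setLIntegral_congr_fun measurableSet_Ioi h2]
  have hJ := Real.integral_rpow_mul_exp_neg_mul_Ioi hb hx0
  have hne : ∫ t in Set.Ioi (0 : ℝ), t ^ ((1 - 2 / α) - 1) * Real.exp (-(x * t)) ≠ 0 := by
    rw [hJ]
    positivity
  have hint : IntegrableOn (fun t => t ^ ((1 - 2 / α) - 1) * Real.exp (-(x * t))) (Set.Ioi 0) :=
    not_imp_comm.1 integral_undef hne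
  simp_rw [ENNReal.ofReal_mul (show 0 ≤ x * Real.Gamma (2 / α + 1) by positivity)]
  rw [lintegral_const_mul _ (by fun_prop), ← ofReal_integral_eq_lintegral_ofReal hint ?_, hJ,
    ← ENNReal.ofReal_mul (by positivity)]
  · congr 1
    rw [H, beta, Real.Gamma_add_one (by positivity), one_div, Real.inv_rpow hx,
      Real.rpow_sub hx0, Real.rpow_one]
    have : 2 / α + (1 - 2 / α) = 1 := by ring
    rw [this, Real.Gamma_one]
    have hxp := Real.rpow_pos_of_pos hx0 (2 / α)
    field_simp
  · filter_upwards [ae_restrict_mem measurableSet_Ioi] with t ht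
    have ht0 : (0 : ℝ) < t := ht
    simp only [Pi.zero_apply]
    positivity

end Interference

/-! ### Exponential and Bernoulli marks -/

lemma lintegral_expMeasure_one {f : ℝ → ℝ≥0∞} (hf : Measurable f) :
    ∫⁻ h, f h ∂(expMeasure 1) =
      ∫⁻ h in Set.Ioi (0 : ℝ), f h * ENNReal.ofReal (Real.exp (-h)) := by
  have hmeas : Measurable (gammaPDF 1 1) := (measurable_gammaPDFReal 1 1).ennreal_ofReal
  rw [expMeasure, gammaMeasure, lintegral_withDensity_eq_lintegral_mul _ hmeas hf,
    ← lintegral_indicator measurableSet_Ioi]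
  refine lintegral_congr_ae ?_
  have h0 : ∀ᵐ h : ℝ, h ≠ 0 := by simp [ae_iff]
  filter_upwards [h0] with h hh
  have hpdf : gammaPDF 1 1 h = ENNReal.ofReal (if 0 ≤ h then 1 * Real.exp (-(1 * h)) else 0) :=
    exponentialPDF_eq 1 h
  simp only [Pi.mul_apply]
  rw [hpdf]
  rcases lt_or_gt_of_ne hh with hneg | hpos
  · rw [if_neg (not_le.2 hneg), Set.indicator_of_notMem (by simpa using hneg.le)]
    simp
  · rw [if_pos hpos.le, Set.indicator_of_mem (Set.mem_Ioi.2 hpos), mul_comm]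
    simp

instance isProbabilityMeasure_expMeasure_one : IsProbabilityMeasure (expMeasure 1) :=
  isProbabilityMeasure_expMeasure one_pos

lemma lintegral_expNeg_expMeasure {t : ℝ} (ht : 0 ≤ t) :
    ∫⁻ h, expNeg (ENNReal.ofReal (t * h)) ∂(expMeasure 1) = ENNReal.ofReal (1 + t)⁻¹ := by
  rw [lintegral_expMeasure_one (by fun_prop), ← lintegral_exp_neg_Ioi (by linarith)]
  refine setLIntegral_congr_fun measurableSet_Ioi fun h hh => ?_
  have hh0 : (0 : ℝ) < h := hh
  rw [expNeg_ofReal (by positivity), ← ENNReal.ofReal_mul (by positivity), ← Real.exp_add]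
  congr 2
  ring

/-- The exponential tail, including the level `⊤`, where both sides vanish. Through it a lower bound
on the gain of the serving station becomes a Laplace transform of interference and noise. -/
lemma expMeasure_le_ofReal (c : ℝ≥0∞) :
    expMeasure 1 {h | c ≤ ENNReal.ofReal h} = expNeg c := by
  have hset : MeasurableSet {h : ℝ | c ≤ ENNReal.ofReal h} :=
    measurableSet_le measurable_const (by fun_prop)
  by_cases hc : c = ⊤
  · simp [hc]
  rw [← lintegral_indicator_one hset, lintegral_expMeasure_one (measurable_one.indicator hset),
    expNeg_eq_of_ne_top hc, ← integral_exp_neg_Ioi,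
    ofReal_integral_eq_lintegral_ofReal (integrableOn_exp_neg_Ioi _)
      (Eventually.of_forall fun u => (Real.exp_pos _).le),
    ← lintegral_indicator measurableSet_Ioi, ← lintegral_indicator measurableSet_Ioi]
  refine lintegral_congr_ae ?_
  have h0 : ∀ᵐ h : ℝ, h ≠ c.toReal := by simp [ae_iff]
  filter_upwards [h0] with h hh
  have hc0 : 0 ≤ c.toReal := ENNReal.toReal_nonneg
  rcases lt_or_gt_of_ne hh with hlt | hgt
  · have h2 : h ∉ Set.Ioi c.toReal := by simpa using hlt.le
    rw [Set.indicator_of_notMem h2]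
    by_cases h3 : h ∈ Set.Ioi (0 : ℝ)
    · have h1 : h ∉ {h : ℝ | c ≤ ENNReal.ofReal h} := by
        rw [Set.mem_ofPred_eq, not_le]
        exact (ENNReal.ofReal_lt_iff_lt_toReal (le_of_lt h3) hc).2 hlt
      rw [Set.indicator_of_mem h3, Set.indicator_of_notMem h1, zero_mul]
    · rw [Set.indicator_of_notMem h3]
  · have h1 : h ∈ {h : ℝ | c ≤ ENNReal.ofReal h} := by
      rw [Set.mem_ofPred_eq]
      exact (ENNReal.le_ofReal_iff_toReal_le hc (hc0.trans hgt.le)).2 hgt.le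
    rw [Set.indicator_of_mem (Set.mem_Ioi.2 (hc0.trans_lt hgt)), Set.indicator_of_mem h1,
      Set.indicator_of_mem (Set.mem_Ioi.2 hgt)]
    simp

/-- The Bernoulli distribution on `Bool`. -/
def boolLaw (c : ℝ) : Measure Bool :=
  ENNReal.ofReal c • Measure.dirac true + ENNReal.ofReal (1 - c) • Measure.dirac false

lemma lintegral_boolLaw (c : ℝ) (f : Bool → ℝ≥0∞) :
    ∫⁻ b, f b ∂(boolLaw c) = ENNReal.ofReal c * f true + ENNReal.ofReal (1 - c) * f false := by
  rw [boolLaw, lintegral_add_measure, lintegral_smul_measure, lintegral_smul_measure,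
    lintegral_dirac, lintegral_dirac, smul_eq_mul, smul_eq_mul]

lemma eq_boolLaw {ρ : Measure Bool} [IsProbabilityMeasure ρ] {c : ℝ} (hc : ρ.real {true} = c) :
    ρ = boolLaw c := by
  have h1 : ρ {true} = ENNReal.ofReal c := by rw [← hc, ofReal_measureReal]
  have hcompl : ({false} : Set Bool) = {true}ᶜ := by
    ext b
    cases b <;> simp
  have h2 : ρ {false} = ENNReal.ofReal (1 - c) := by
    rw [← hc, hcompl, ← probReal_compl_eq_one_sub (MeasurableSet.singleton _), ofReal_measureReal]
  refine Measure.ext_of_singleton fun b => ?_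
  cases b <;> simp [boolLaw, h1, h2]

instance sFinite_boolLaw (c : ℝ) : SFinite (boolLaw c) := by
  unfold boolLaw
  infer_instance

/-! ### Marks and weights of the stations -/

/-- A station's mark: whether it can serve the tagged user, whether it is active, and its fading
gain. -/
abbrev Mark := Bool × Bool × ℝ

namespace Params

variable (p : Params)

/-- Probability that a station of tier `i` is a candidate, if a helper stores the content with
probability `c`. -/
def candProb (c : ℝ) (i : Tier) : ℝ := if i = 0 then 1 else c

def actProb (i : Tier) : ℝ := if i = 0 then 1 else p.pa

def markLaw (c : ℝ) (i : Tier) : Measure Mark :=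
  (boolLaw (candProb c i)).prod ((boolLaw (p.actProb i)).prod (expMeasure 1))

/-- A candidate of tier `i` is preferred to a station of tier `k` at distance `z` if it lies closer
than `p.ratio k i * z`. -/
def ratio (k i : Tier) : ℝ := (p.P i / p.P k) ^ (1 / p.α)

/-- Interference with parameter `θ z ^ α`, infinite if the station is preferred. -/
def weight (k : Tier) (θ : ℝ) (z : ℝ≥0) (i : Tier) (q : Plane × Mark) : ℝ≥0∞ :=
  (if q.2.1 = true ∧ ‖q.1‖ < p.ratio k i * z then ⊤ else 0) +
    if q.2.2.1 = true then
      ENNReal.ofReal (θ * (z : ℝ) ^ p.α) * ENNReal.ofReal (p.P i * q.2.2.2 * ‖q.1‖ ^ (-p.α))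
    else 0

/-- The exponent, per unit of area, of the probability of association and success for the
threshold `x`. -/
def rateK (c : ℝ) (k : Tier) (x : ℝ) : ℝ :=
  ∑ i : Tier, p.lam i * (p.P i / p.P k) ^ (2 / p.α) *
    (candProb c i * (1 + p.actProb i * G x p.α) + (1 - candProb c i) * p.actProb i * H x p.α)

variable {p}

lemma measurable_weight (k : Tier) (θ : ℝ) (z : ℝ≥0) (i : Tier) :
    Measurable (p.weight k θ z i) := by
  unfold weight
  refine Measurable.add ?_ ?_
  · refine Measurable.ite ?_ measurable_const measurable_const
    refine MeasurableSet.inter ?_ ?_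
    · exact (measurable_fst.comp measurable_snd) (measurableSet_singleton true)
    · exact measurableSet_lt (f := fun q : Plane × Mark => ‖q.1‖) (by fun_prop) measurable_const
  · refine Measurable.ite ?_ (by fun_prop) measurable_const
    exact (measurable_fst.comp (measurable_snd.comp measurable_snd)) (measurableSet_singleton true)

lemma ratio_nonneg (hp : p.Valid) (k i : Tier) : 0 ≤ p.ratio k i :=
  Real.rpow_nonneg (div_nonneg (hp.P_pos i).le (hp.P_pos k).le) _

lemma ratio_pos (hp : p.Valid) (k i : Tier) : 0 < p.ratio k i :=
  Real.rpow_pos_of_pos (div_pos (hp.P_pos i) (hp.P_pos k)) _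

lemma ratio_self (hp : p.Valid) (k : Tier) : p.ratio k k = 1 := by
  rw [ratio, div_self (hp.P_pos k).ne', Real.one_rpow]

lemma ratio_sq (hp : p.Valid) (k i : Tier) :
    p.ratio k i ^ 2 = (p.P i / p.P k) ^ (2 / p.α) := by
  rw [ratio, ← Real.rpow_natCast, ← Real.rpow_mul (div_nonneg (hp.P_pos i).le (hp.P_pos k).le)]
  congr 1
  push_cast
  ring

lemma α_pos (hp : p.Valid) : 0 < p.α := by linarith [hp.two_lt_α]

lemma ratio_rpow_α (hp : p.Valid) (k i : Tier) : p.ratio k i ^ p.α = p.P i / p.P k := by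
  rw [ratio, ← Real.rpow_mul (div_nonneg (hp.P_pos i).le (hp.P_pos k).le),
    one_div_mul_cancel (α_pos hp).ne', Real.rpow_one]

lemma weight_mono (hp : p.Valid) (k : Tier) {θ : ℝ} (hθ : 0 ≤ θ) (i : Tier) (q : Plane × Mark) :
    Monotone fun z => p.weight k θ z i q := by
  intro z z' hz
  have hz' : (z : ℝ) ≤ z' := NNReal.coe_le_coe.2 hz
  refine add_le_add ?_ ?_
  · by_cases h : q.2.1 = true ∧ ‖q.1‖ < p.ratio k i * z
    · rw [if_pos h, if_pos ⟨h.1, h.2.trans_le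
        (mul_le_mul_of_nonneg_left hz' (ratio_nonneg hp k i))⟩]
    · rw [if_neg h]
      exact zero_le
  · split_ifs
    · refine mul_le_mul_left (ENNReal.ofReal_le_ofReal ?_) _
      exact mul_le_mul_of_nonneg_left
        (Real.rpow_le_rpow z.coe_nonneg hz' (α_pos hp).le) hθ
    · exact le_rfl

/-- The strict inequality in the exclusion condition makes the infinite part continuous from below
in the distance, the direction in which dyadic floors converge. -/
lemma tendsto_weight (hp : p.Valid) (k : Tier) {θ : ℝ} (i : Tier)
    (q : Plane × Mark) (z : ℝ≥0) :
    Tendsto (fun n => p.weight k θ (dyadicFloor n z) i q) atTop (𝓝 (p.weight k θ z i q)) := by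
  have hd : Tendsto (fun n => (dyadicFloor n z : ℝ)) atTop (𝓝 (z : ℝ)) :=
    NNReal.tendsto_coe.2 (tendsto_dyadicFloor z)
  refine Tendsto.add ?_ ?_
  · by_cases h : q.2.1 = true ∧ ‖q.1‖ < p.ratio k i * z
    · rw [if_pos h]
      refine tendsto_const_nhds.congr' ?_
      filter_upwards [(hd.const_mul (p.ratio k i)).eventually_const_lt h.2] with n hn
      rw [if_pos ⟨h.1, hn⟩]
    · rw [if_neg h]
      refine tendsto_const_nhds.congr fun n => ?_
      rw [if_neg]
      exact fun hn => h ⟨hn.1, hn.2.trans_le (mul_le_mul_of_nonneg_left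
        (NNReal.coe_le_coe.2 (dyadicFloor_le n z)) (ratio_nonneg hp k i))⟩
  · split_ifs
    · refine ENNReal.Tendsto.mul_const ?_ (Or.inr ENNReal.ofReal_ne_top)
      refine (ENNReal.continuous_ofReal.tendsto _).comp (Tendsto.const_mul θ ?_)
      exact hd.rpow_const (Or.inr (α_pos hp).le)
    · exact tendsto_const_nhds

/-- The components of the mark are independent. A candidate in the exclusion disc contributes zero,
a silent station one, and the exponential gain of a transmitting station gives `1/(1 + t)`. -/
lemma lintegral_expNeg_weight (hp : p.Valid) {c : ℝ} (hc0 : 0 ≤ c) (hc1 : c ≤ 1)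
    (hpa0 : 0 ≤ p.pa) (hpa1 : p.pa ≤ 1) (k : Tier) {θ : ℝ} (hθ : 0 ≤ θ) (z : ℝ≥0) (i : Tier)
    (x : Plane) :
    ∫⁻ y, expNeg (p.weight k θ z i (x, y)) ∂(p.markLaw c i) =
      ENNReal.ofReal (((if ‖x‖ < p.ratio k i * z then 0 else candProb c i) +
        (1 - candProb c i)) *
        (p.actProb i * (1 + θ * (z : ℝ) ^ p.α * (p.P i * ‖x‖ ^ (-p.α)))⁻¹ +
          (1 - p.actProb i))) := by
  have hC0 : 0 ≤ candProb c i := by unfold candProb; split_ifs <;> linarith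
  have hC1 : candProb c i ≤ 1 := by unfold candProb; split_ifs <;> linarith
  have hA0 : 0 ≤ p.actProb i := by unfold actProb; split_ifs <;> linarith
  have hA1 : p.actProb i ≤ 1 := by unfold actProb; split_ifs <;> linarith
  have hP := hp.P_pos i
  have hx : 0 ≤ ‖x‖ ^ (-p.α) := Real.rpow_nonneg (norm_nonneg _) _
  have hz : 0 ≤ (z : ℝ) ^ p.α := Real.rpow_nonneg z.coe_nonneg _
  set t := θ * (z : ℝ) ^ p.α * (p.P i * ‖x‖ ^ (-p.α)) with ht
  have ht0 : 0 ≤ t := by positivity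
  have hmw : Measurable fun y => expNeg (p.weight k θ z i (x, y)) :=
    measurable_expNeg.comp ((measurable_weight k θ z i).comp measurable_prodMk_left)
  have hfade : ∀ b : Bool, ∫⁻ y, expNeg (if y.1 = true then
      ENNReal.ofReal (θ * (z : ℝ) ^ p.α) * ENNReal.ofReal (p.P i * y.2 * ‖x‖ ^ (-p.α)) else 0)
        ∂((boolLaw (p.actProb i)).prod (expMeasure 1)) =
      ENNReal.ofReal (p.actProb i * (1 + t)⁻¹ + (1 - p.actProb i)) := by
    intro b
    rw [lintegral_prod]
    · rw [lintegral_boolLaw]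
      have h1 : ∫⁻ h, expNeg (ENNReal.ofReal (θ * (z : ℝ) ^ p.α) *
          ENNReal.ofReal (p.P i * h * ‖x‖ ^ (-p.α))) ∂(expMeasure 1) =
          ENNReal.ofReal (1 + t)⁻¹ := by
        rw [← lintegral_expNeg_expMeasure ht0]
        refine lintegral_congr fun h => ?_
        rw [← ENNReal.ofReal_mul (by positivity)]
        congr 2
        rw [ht]
        ring
      simp only [if_true, h1, Bool.false_eq_true, if_false, expNeg_zero, lintegral_const,
        measure_univ, mul_one]
      rw [← ENNReal.ofReal_mul hA0, ← ENNReal.ofReal_add (by positivity) (by linarith)]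
    · refine Measurable.aemeasurable (measurable_expNeg.comp ?_)
      refine Measurable.ite ?_ (by fun_prop) measurable_const
      exact measurable_fst (measurableSet_singleton true)
  have hS0 : 0 ≤ p.actProb i * (1 + t)⁻¹ + (1 - p.actProb i) :=
    add_nonneg (by positivity) (by linarith)
  generalize p.actProb i * (1 + t)⁻¹ + (1 - p.actProb i) = S at hfade hS0 ⊢
  rw [markLaw, lintegral_prod _ hmw.aemeasurable, lintegral_boolLaw]
  simp only [weight, expNeg_add, true_and, Bool.false_eq_true, false_and, if_false, expNeg_zero,
    one_mul]
  rw [lintegral_const_mul' _ _ (expNeg_ne_top _), hfade true]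
  rw [ENNReal.ofReal_mul (by split_ifs <;> linarith), ENNReal.ofReal_add
    (by split_ifs <;> linarith) (by linarith), add_mul]
  congr 1
  rw [← mul_assoc]
  congr 1
  split_ifs <;> simp

/-- Scale invariance of the power law: the interference parameter depends only on the ratio between
the area up to `x` and the area of the exclusion disc. This is why the exponents are linear in `π
z²`. -/
lemma weight_arg (hp : p.Valid) (k i : Tier) {x z δ : ℝ} (hx : 0 < x) (hz : 0 < z) :
    δ / p.P k * z ^ p.α * (p.P i * x ^ (-p.α)) =
      δ / ((Real.pi * x ^ 2) / (Real.pi * (p.ratio k i * z) ^ 2)) ^ (p.α / 2) := by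
  have hr := ratio_pos hp k i
  have h1 : (Real.pi * x ^ 2) / (Real.pi * (p.ratio k i * z) ^ 2) =
      (x / (p.ratio k i * z)) ^ 2 := by
    rw [mul_div_mul_left _ _ Real.pi_pos.ne', div_pow]
  rw [h1, ← Real.rpow_natCast, ← Real.rpow_mul (by positivity)]
  have h2 : ((2 : ℕ) : ℝ) * (p.α / 2) = p.α := by
    push_cast
    ring
  rw [h2, Real.div_rpow hx.le (by positivity), Real.mul_rpow hr.le hz.le, ratio_rpow_α hp,
    Real.rpow_neg hx.le]
  have := hp.P_pos k
  have := hp.P_pos i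
  have := Real.rpow_pos_of_pos hx p.α
  have := Real.rpow_pos_of_pos hz p.α
  field_simp

/-- Let `U` be the area of the exclusion disc. Candidates contribute their full probability on areas
below `U` and, if they transmit, the integrand of `G` above `U`; transmitting non-candidates
contribute the integrand of `H` everywhere. Rescaling the area by `U` extracts the common factor. -/
lemma lintegral_one_sub_weight (hp : p.Valid) {c : ℝ} (hc0 : 0 ≤ c) (hc1 : c ≤ 1)
    (hpa0 : 0 ≤ p.pa) (hpa1 : p.pa ≤ 1) (k : Tier) {δ : ℝ} (hδ : 0 ≤ δ) {z : ℝ≥0} (hz : 0 < z)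
    (i : Tier) :
    ∫⁻ x, (1 - ∫⁻ y, expNeg (p.weight k (δ / p.P k) z i (x, y)) ∂(p.markLaw c i)) =
      ENNReal.ofReal (Real.pi * z ^ 2 * (p.P i / p.P k) ^ (2 / p.α) *
        (candProb c i * (1 + p.actProb i * G δ p.α) +
          (1 - candProb c i) * p.actProb i * H δ p.α)) := by
  have hC0 : 0 ≤ candProb c i := by unfold candProb; split_ifs <;> linarith
  have hC1 : candProb c i ≤ 1 := by unfold candProb; split_ifs <;> linarith
  have hA0 : 0 ≤ p.actProb i := by unfold actProb; split_ifs <;> linarith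
  have hA1 : p.actProb i ≤ 1 := by unfold actProb; split_ifs <;> linarith
  have hα := hp.two_lt_α
  have hr := ratio_pos hp k i
  have hzr : (0 : ℝ) < z := hz
  have hθ : 0 ≤ δ / p.P k := div_nonneg hδ (hp.P_pos k).le
  set U := Real.pi * (p.ratio k i * z) ^ 2 with hU
  have hU0 : 0 < U := by positivity
  let g : ℝ → ℝ := fun w => δ / (δ + w ^ (p.α / 2))
  have hg0 : ∀ w, 0 ≤ w → 0 ≤ g w := by
    intro w hw
    have := Real.rpow_nonneg hw (p.α / 2)
    positivity
  have hgm : Measurable fun w => ENNReal.ofReal (g w) := by fun_prop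
  let F : ℝ → ℝ≥0∞ := fun u => (Set.Iio U).indicator (fun _ => ENNReal.ofReal (candProb c i)) u +
    (ENNReal.ofReal (candProb c i * p.actProb i) *
        (Set.Ioi U).indicator (fun u => ENNReal.ofReal (g (u / U))) u +
      ENNReal.ofReal ((1 - candProb c i) * p.actProb i) * ENNReal.ofReal (g (u / U)))
  have hgU : Measurable fun u => ENNReal.ofReal (g (u / U)) := by fun_prop
  have hFm : Measurable F :=
    (measurable_const.indicator measurableSet_Iio).add
      ((Measurable.const_mul (hgU.indicator measurableSet_Ioi) _).add (hgU.const_mul _))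
  -- The origin and the boundary circle of the exclusion disc are null sets, so the formulas need
  -- not match there.
  have h0 : ∀ᵐ x : Plane, Real.pi * ‖x‖ ^ 2 ≠ 0 ∧ Real.pi * ‖x‖ ^ 2 ≠ U := by
    have hq : (fun x : Plane => Real.pi * ‖x‖ ^ 2) ⁻¹' {0, U} ∈ {s | (volume : Measure Plane) s = 0} := by
      rw [Set.mem_ofPred_eq, ← Measure.map_apply (by fun_prop) (Set.toFinite _).measurableSet,
        map_area_volume]
      exact (Set.toFinite _).measure_zero _
    filter_upwards [compl_mem_ae_iff.2 hq] with x hx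
    simp only [Set.mem_compl_iff, Set.mem_preimage, Set.mem_insert_iff, Set.mem_singleton_iff,
      not_or] at hx
    exact hx
  have hpt : ∀ᵐ x : Plane, 1 - ∫⁻ y, expNeg (p.weight k (δ / p.P k) z i (x, y)) ∂(p.markLaw c i) =
      F (Real.pi * ‖x‖ ^ 2) := by
    filter_upwards [h0] with x hx
    have hx0 : 0 < ‖x‖ := by
      refine lt_of_le_of_ne (norm_nonneg x) fun h => hx.1 ?_
      rw [← h]
      simp
    rw [lintegral_expNeg_weight hp hc0 hc1 hpa0 hpa1 k hθ, weight_arg hp k i hx0 hzr]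
    set u := Real.pi * ‖x‖ ^ 2 with hu
    have hu0 : 0 < u := by positivity
    set w := (u / U) ^ (p.α / 2) with hw
    have hw0 : 0 < w := Real.rpow_pos_of_pos (by positivity) _
    have hgw : g (u / U) = δ / (δ + w) := rfl
    have hgpos : 0 ≤ δ / (δ + w) := by positivity
    have hinv : (1 + δ / w)⁻¹ = 1 - δ / (δ + w) := by
      have : w + δ ≠ 0 := by positivity
      have : δ + w ≠ 0 := by positivity
      field_simp
      ring
    have hiff : ‖x‖ < p.ratio k i * z ↔ u < U := by
      rw [hu, hU, mul_lt_mul_iff_right₀ Real.pi_pos]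
      exact (pow_lt_pow_iff_left₀ hx0.le (by positivity) two_ne_zero).symm
    rw [hinv, ← ENNReal.ofReal_one]
    have hsub : ∀ {a b : ℝ}, 0 ≤ a → ENNReal.ofReal 1 - ENNReal.ofReal a = ENNReal.ofReal (1 - a) :=
      fun ha => (ENNReal.ofReal_sub _ ha).symm
    have hg1 : δ / (δ + w) ≤ 1 := by
      rw [div_le_one (by positivity)]
      linarith
    have hAg : 0 ≤ p.actProb i * (1 - δ / (δ + w)) + (1 - p.actProb i) := by
      have := mul_nonneg hA0 (sub_nonneg.2 hg1)
      linarith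
    rw [← ENNReal.ofReal_sub _ (mul_nonneg (by split_ifs <;> linarith) hAg)]
    simp only [F, hgw]
    rcases lt_or_gt_of_ne hx.2 with hlt | hgt
    · rw [if_pos (hiff.2 hlt), Set.indicator_of_mem (Set.mem_Iio.2 hlt),
        Set.indicator_of_notMem (by simpa using hlt.le), mul_zero, zero_add, zero_add,
        ← ENNReal.ofReal_mul (mul_nonneg (by linarith) hA0), ← ENNReal.ofReal_add hC0]
      · congr 1
        ring
      · exact mul_nonneg (mul_nonneg (by linarith) hA0) hgpos
    · rw [if_neg (fun h => (hiff.1 h).not_gt hgt), Set.indicator_of_mem (Set.mem_Ioi.2 hgt),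
        Set.indicator_of_notMem (by simpa using hgt.le), zero_add,
        ← ENNReal.ofReal_mul (mul_nonneg (by linarith) hA0), ← ENNReal.ofReal_mul (by positivity),
        ← ENNReal.ofReal_add]
      · congr 1
        ring
      · positivity
      · exact mul_nonneg (mul_nonneg (by linarith) hA0) hgpos
  rw [lintegral_congr_ae hpt, lintegral_area hFm]
  simp only [F]
  rw [lintegral_add_left (measurable_const.indicator measurableSet_Iio),
    lintegral_add_left (Measurable.const_mul (hgU.indicator measurableSet_Ioi) _),
    lintegral_const_mul _ (hgU.indicator measurableSet_Ioi), lintegral_const_mul _ hgU,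
    lintegral_indicator measurableSet_Iio, lintegral_indicator measurableSet_Ioi,
    Measure.restrict_restrict measurableSet_Iio, Measure.restrict_restrict measurableSet_Ioi,
    setLIntegral_const, Set.Ioi_inter_Ioi, max_eq_left hU0.le]
  have hG := lintegral_Ioi_div hgm hU0 1
  have hH := lintegral_Ioi_div hgm hU0 0
  rw [mul_one, ofReal_G hα hδ] at hG
  rw [mul_zero, ofReal_H hα hδ] at hH
  rw [hG, hH, Set.Iio_inter_Ioi, Real.volume_Ioo, sub_zero]
  have hGn := G_nonneg hα hδ
  have hHn := H_nonneg hα hδ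
  have h1C : 0 ≤ 1 - candProb c i := by linarith
  rw [← ENNReal.ofReal_mul hC0, ← ENNReal.ofReal_mul hU0.le, ← ENNReal.ofReal_mul (by positivity),
    ← ENNReal.ofReal_mul hU0.le, ← ENNReal.ofReal_mul (by positivity),
    ← ENNReal.ofReal_add (by positivity) (by positivity),
    ← ENNReal.ofReal_add (by positivity) (by positivity)]
  congr 1
  rw [hU, mul_pow, ratio_sq hp]
  ring

lemma laplaceExponent_weight (hp : p.Valid) {c : ℝ} (hc0 : 0 ≤ c) (hc1 : c ≤ 1)
    (hpa0 : 0 ≤ p.pa) (hpa1 : p.pa ≤ 1) (k : Tier) {δ : ℝ} (hδ : 0 ≤ δ) (z : ℝ≥0) :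
    IsMarkedPoisson.laplaceExponent p.lam (p.markLaw c) (p.weight k (δ / p.P k) z) =
      ENNReal.ofReal (Real.pi * z ^ 2 * p.rateK c k δ) := by
  have hC0 : ∀ i, 0 ≤ candProb c i := fun i => by unfold candProb; split_ifs <;> linarith
  have hC1 : ∀ i, 0 ≤ 1 - candProb c i := fun i => by unfold candProb; split_ifs <;> linarith
  have hA0 : ∀ i, 0 ≤ p.actProb i := fun i => by unfold actProb; split_ifs <;> linarith
  have hG := G_nonneg hp.two_lt_α hδ
  have hH := H_nonneg hp.two_lt_α hδ
  unfold IsMarkedPoisson.laplaceExponent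
  -- At `z = 0` the rescaling by the exclusion area is impossible, but the weight vanishes: the disc
  -- is empty and `0 ^ α = 0`.
  rcases eq_or_lt_of_le (zero_le (a := z)) with rfl | hz
  · have hw : ∀ i q, p.weight k (δ / p.P k) 0 i q = 0 := by
      intro i q
      simp [weight, Real.zero_rpow (α_pos hp).ne', not_lt.2 (norm_nonneg q.1)]
    have hν : ∀ i, p.markLaw c i Set.univ = 1 := by
      intro i
      have hle : (1 : ℝ) - candProb c i + candProb c i = 1 := by ring
      have h2 : ∀ a : ℝ, 0 ≤ a → a ≤ 1 → boolLaw a Set.univ = 1 := by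
        intro a ha ha1
        simp only [boolLaw, Measure.add_apply, Measure.smul_apply, measure_univ, smul_eq_mul,
          mul_one]
        rw [← ENNReal.ofReal_add ha (by linarith)]
        simp
      rw [markLaw, ← Set.univ_prod_univ, Measure.prod_prod, ← Set.univ_prod_univ,
        Measure.prod_prod, h2 _ (hC0 i) (by linarith [hC1 i]), h2 _ (hA0 i), measure_univ]
      · simp
      · unfold actProb
        split_ifs <;> linarith
    simp [hw, hν]
  · rw [rateK, Finset.mul_sum, ENNReal.ofReal_sum_of_nonneg]
    · refine Finset.sum_congr rfl fun i _ => ?_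
      rw [lintegral_one_sub_weight hp hc0 hc1 hpa0 hpa1 k hδ hz,
        ← ENNReal.ofReal_mul (hp.lam_pos i).le]
      congr 1
      ring
    · intro i _
      have := hC0 i
      have := hC1 i
      have := hA0 i
      have := hp.lam_pos i
      have := hp.P_pos i
      have := hp.P_pos k
      positivity

end Params

lemma isProbabilityMeasure_boolLaw {a : ℝ} (h0 : 0 ≤ a) (h1 : a ≤ 1) :
    IsProbabilityMeasure (boolLaw a) := by
  constructor
  simp only [boolLaw, Measure.add_apply, Measure.smul_apply, measure_univ, smul_eq_mul, mul_one]
  rw [← ENNReal.ofReal_add h0 (by linarith)]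
  simp

/-! ### Positivity and monotonicity of the exponent; the association formula. -/

namespace Params

variable {p : Params}

lemma candProb_nonneg {c : ℝ} (hc0 : 0 ≤ c) (i : Tier) : 0 ≤ candProb c i := by
  unfold candProb; split_ifs <;> linarith

lemma candProb_le_one {c : ℝ} (hc1 : c ≤ 1) (i : Tier) : candProb c i ≤ 1 := by
  unfold candProb; split_ifs <;> linarith

lemma actProb_nonneg (h : 0 ≤ p.pa) (i : Tier) : 0 ≤ p.actProb i := by
  unfold actProb; split_ifs <;> linarith

lemma actProb_le_one (h : p.pa ≤ 1) (i : Tier) : p.actProb i ≤ 1 := by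
  unfold actProb; split_ifs <;> linarith

lemma rateK_zero (hp : p.Valid) (c : ℝ) (k : Tier) :
    p.rateK c k 0 = ∑ i : Tier, p.lam i * (p.P i / p.P k) ^ (2 / p.α) * candProb c i := by
  unfold rateK
  simp [G_zero, H_zero hp.two_lt_α]

/-- The MBSs are always candidates, so `c = 0` is allowed; the contents of the first group need this
case. -/
lemma rateK_zero_pos (hp : p.Valid) {c : ℝ} (hc0 : 0 ≤ c) (k : Tier) : 0 < p.rateK c k 0 := by
  rw [rateK_zero hp, Fin.sum_univ_two]
  have h0 := hp.lam_pos 0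
  have h1 := hp.lam_pos 1
  have hP := hp.P_pos
  have : 0 < p.lam 0 * (p.P 0 / p.P k) ^ (2 / p.α) * candProb c 0 := by
    have := Real.rpow_pos_of_pos (div_pos (hP 0) (hP k)) (2 / p.α)
    simp only [candProb, if_true, mul_one]
    positivity
  have : 0 ≤ p.lam 1 * (p.P 1 / p.P k) ^ (2 / p.α) * candProb c 1 := by
    have := Real.rpow_pos_of_pos (div_pos (hP 1) (hP k)) (2 / p.α)
    have := candProb_nonneg hc0 1
    positivity
  linarith

lemma rateK_mono (hp : p.Valid) {c : ℝ} (hc0 : 0 ≤ c) (hc1 : c ≤ 1) (hpa : 0 ≤ p.pa) (k : Tier)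
    {x y : ℝ} (hy : 0 ≤ y) (hyx : y ≤ x) : p.rateK c k y ≤ p.rateK c k x := by
  unfold rateK
  refine Finset.sum_le_sum fun i _ => ?_
  have h1 := G_mono hp.two_lt_α hy hyx
  have h2 := H_mono hp.two_lt_α hy hyx
  have h3 := candProb_nonneg hc0 i
  have h4 := sub_nonneg.2 (candProb_le_one hc1 i)
  have h5 := actProb_nonneg hpa i
  have h6 := (hp.lam_pos i).le
  have h7 := Real.rpow_nonneg (div_nonneg (hp.P_pos i).le (hp.P_pos k).le) (2 / p.α)
  gcongr

lemma rateK_pos (hp : p.Valid) {c : ℝ} (hc0 : 0 ≤ c) (hc1 : c ≤ 1) (hpa : 0 ≤ p.pa) (k : Tier)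
    {x : ℝ} (hx : 0 ≤ x) : 0 < p.rateK c k x :=
  (rateK_zero_pos hp hc0 k).trans_le (rateK_mono hp hc0 hc1 hpa k le_rfl hx)

lemma measurable_rateK (c : ℝ) (k : Tier) : Measurable (p.rateK c k) := by
  unfold rateK
  have h1 := measurable_G (α := p.α)
  have h2 := measurable_H (α := p.α)
  fun_prop

section Association

variable {Ω : Type*} [MeasurableSpace Ω] {μ : Measure Ω} [IsProbabilityMeasure μ]
  {x : Tier → ℕ → Ω → Plane} {m : Station → Ω → Mark} {𝓕 : Station → MeasurableSpace Ω}

lemma lintegral_markLaw_cand {c : ℝ} (hpa0 : 0 ≤ p.pa)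
    (hpa1 : p.pa ≤ 1) (k : Tier) (a : ℝ≥0∞) :
    ∫⁻ y, (if y.1 = true then a else 0) ∂(p.markLaw c k) = ENNReal.ofReal (candProb c k) * a := by
  have := isProbabilityMeasure_boolLaw (actProb_nonneg hpa0 k) (actProb_le_one hpa1 k)
  rw [markLaw, lintegral_prod, lintegral_boolLaw]
  · simp
  · refine Measurable.aemeasurable (Measurable.ite ?_ measurable_const measurable_const)
    exact measurable_fst (measurableSet_singleton true)

/-- The mean over the stations `b` of tier `k` of a function of the distance of `b`, weighted with
the event that no other candidate is preferred to `b` and with the Laplace transform of the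
interference seen from `b`. -/
theorem lintegral_tsum_assoc (hp : p.Valid) {c : ℝ} (hc0 : 0 ≤ c) (hc1 : c ≤ 1)
    (hpa0 : 0 ≤ p.pa) (hpa1 : p.pa ≤ 1) (h : IsMarkedPoisson x m p.lam (p.markLaw c) 𝓕 μ)
    (k : Tier) {δ : ℝ} (hδ : 0 ≤ δ) {f : ℝ → ℝ≥0∞} (hf : Measurable f) :
    ∫⁻ ω, ∑' j, (if (m (k, j) ω).1 = true then f ‖x k j ω‖ else 0) *
        expNeg (∑' b : Station, if b = (k, j) then 0 else
          p.weight k (δ / p.P k) ‖x k j ω‖₊ b.1 (x b.1 b.2 ω, m b ω)) ∂μ =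
      ENNReal.ofReal (p.lam k * candProb c k) *
        ∫⁻ u in Set.Ioi (0 : ℝ), f √(u / Real.pi) *
          ENNReal.ofReal (Real.exp (-(p.rateK c k δ * u))) := by
  have hθ : 0 ≤ δ / p.P k := div_nonneg hδ (hp.P_pos k).le
  have hK := rateK_pos hp hc0 hc1 hpa0 k hδ
  have hmc : MeasurableSet {q : Plane × Mark | q.2.1 = true} :=
    (measurable_fst.comp measurable_snd) (measurableSet_singleton true)
  -- functions with a finite integral
  have hfin : ∀ f : ℝ → ℝ≥0∞, Measurable f → ∫⁻ z : Plane, f ‖z‖ ≠ ⊤ →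
      ∫⁻ ω, ∑' j, (if (m (k, j) ω).1 = true then f ‖x k j ω‖ else 0) *
        expNeg (∑' b : Station, if b = (k, j) then 0 else
          p.weight k (δ / p.P k) ‖x k j ω‖₊ b.1 (x b.1 b.2 ω, m b ω)) ∂μ =
      ENNReal.ofReal (p.lam k * candProb c k) *
        ∫⁻ u in Set.Ioi (0 : ℝ), f √(u / Real.pi) *
          ENNReal.ofReal (Real.exp (-(p.rateK c k δ * u))) := by
    intro f hf hfi
    let φ : Plane × Mark → ℝ≥0∞ := fun q => if q.2.1 = true then f ‖q.1‖ else 0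
    have hfn : Measurable fun z : Plane => f ‖z‖ := hf.comp measurable_norm
    have hφ : Measurable φ := Measurable.ite hmc (hfn.comp measurable_fst) measurable_const
    have hφi : ∀ z : Plane, ∫⁻ y, φ (z, y) ∂(p.markLaw c k) =
        ENNReal.ofReal (candProb c k) * f ‖z‖ :=
      fun z => lintegral_markLaw_cand hpa0 hpa1 k (f ‖z‖)
    have hmecke := h.lintegral_tsum_mul_expNeg_nnnorm k
      (v := fun z i q => p.weight k (δ / p.P k) z i q)
      (fun z i => measurable_weight k _ z i) (fun i q => weight_mono hp k hθ i q)
      (fun i q z => tendsto_weight hp k i q z) hφ ?_ ?_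
    · refine hmecke.trans ?_
      simp_rw [hφi]
      have hF : Measurable fun u => expNeg (ENNReal.ofReal (u * p.rateK c k δ)) *
          (ENNReal.ofReal (candProb c k) * f √(u / Real.pi)) := by fun_prop
      have hrad : ∀ z : Plane, expNeg (IsMarkedPoisson.laplaceExponent p.lam (p.markLaw c)
          fun i q => p.weight k (δ / p.P k) ‖z‖₊ i q) * (ENNReal.ofReal (candProb c k) * f ‖z‖) =
          (fun u => expNeg (ENNReal.ofReal (u * p.rateK c k δ)) *
            (ENNReal.ofReal (candProb c k) * f √(u / Real.pi))) (Real.pi * ‖z‖ ^ 2) := by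
        intro z
        have hl := laplaceExponent_weight hp hc0 hc1 hpa0 hpa1 k hδ ‖z‖₊
        simp only
        rw [mul_div_cancel_left₀ _ Real.pi_pos.ne', Real.sqrt_sq (norm_nonneg z)]
        rw [coe_nnnorm] at hl
        rw [← hl]
      simp_rw [hrad]
      have hFr : Measurable fun u => f √(u / Real.pi) *
          ENNReal.ofReal (Real.exp (-(p.rateK c k δ * u))) := by fun_prop
      rw [lintegral_area hF, ENNReal.ofReal_mul (hp.lam_pos k).le, mul_assoc,
        ← lintegral_const_mul (ENNReal.ofReal (candProb c k)) hFr]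
      congr 1
      refine setLIntegral_congr_fun measurableSet_Ioi fun u hu => ?_
      have hu0 : (0 : ℝ) < u := hu
      rw [expNeg_ofReal (by positivity), mul_comm u]
      ring
    · intro q z hq hz
      -- Within one tier the exclusion ratio is one, so a point at distance at least `z` is not
      -- excluded by its own weight, which therefore is finite.
      have hz' : (z : ℝ) ≤ ‖q.1‖ := hz
      have : ¬ (q.2.1 = true ∧ ‖q.1‖ < p.ratio k k * z) := by
        rw [ratio_self hp, one_mul]
        exact fun hh => absurd hh.2 (not_lt.2 hz')
      simp only [weight, if_neg this, zero_add]
      split_ifs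
      · exact ENNReal.mul_ne_top ENNReal.ofReal_ne_top ENNReal.ofReal_ne_top
      · exact ENNReal.zero_ne_top
    · simp_rw [hφi]
      rw [lintegral_const_mul _ hfn]
      exact ENNReal.mul_ne_top ENNReal.ofReal_ne_top hfi
  -- the general case
  let g : ℕ → ℝ → ℝ≥0∞ := fun n z => (Set.Iic (n : ℝ)).indicator (fun z => min (f z) n) z
  have hgm : ∀ n, Measurable (g n) := fun n =>
    (hf.min measurable_const).indicator (measurableSet_Iic (a := (n : ℝ)))
  have hgi : ∀ n, ∫⁻ z : Plane, g n ‖z‖ ≠ ⊤ := by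
    intro n
    have hle : ∀ z : Plane, g n ‖z‖ ≤ (Metric.closedBall (0 : Plane) n).indicator
        (fun _ => (n : ℝ≥0∞)) z := by
      intro z
      by_cases hz : ‖z‖ ≤ n
      · simp only [g]
        rw [Set.indicator_of_mem (Set.mem_Iic.2 hz), Set.indicator_of_mem
          (mem_closedBall_zero_iff.2 hz)]
        exact min_le_right _ _
      · simp only [g]
        rw [Set.indicator_of_notMem (by simpa using hz)]
        exact zero_le
    refine ((lintegral_mono hle).trans_lt ?_).ne
    rw [lintegral_indicator_const measurableSet_closedBall]
    exact ENNReal.mul_lt_top (by simp) measure_closedBall_lt_top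
  have hgmono : ∀ z, Monotone fun n => g n z := by
    intro z n n' hn
    have hn' : (n : ℝ) ≤ n' := by exact_mod_cast hn
    by_cases hz : z ≤ n
    · simp only [g]
      rw [Set.indicator_of_mem (Set.mem_Iic.2 hz),
        Set.indicator_of_mem (Set.mem_Iic.2 (hz.trans hn'))]
      exact min_le_min le_rfl (by exact_mod_cast hn)
    · simp only [g]
      rw [Set.indicator_of_notMem (by simpa using hz)]
      exact zero_le
  have hglim : ∀ z, Tendsto (fun n => g n z) atTop (𝓝 (f z)) := by
    intro z
    have h1 : Tendsto (fun n : ℕ => min (f z) (n : ℝ≥0∞)) atTop (𝓝 (min (f z) ⊤)) :=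
      tendsto_const_nhds.min ENNReal.tendsto_nat_nhds_top
    rw [min_eq_left le_top] at h1
    refine h1.congr' ?_
    obtain ⟨N, hN⟩ := exists_nat_ge z
    filter_upwards [eventually_ge_atTop N] with n hn
    simp only [g]
    rw [Set.indicator_of_mem]
    exact hN.trans (by exact_mod_cast hn)
  have hxm : ∀ k j, Measurable (x k j) := fun k j => h.pos_measurable k j
  -- The weight is taken at a random distance. Measurability comes from the dyadic approximations,
  -- which involve countably many distances, by passing to the limit.
  have hE : ∀ j, AEMeasurable (fun ω => expNeg (∑' b : Station, if b = (k, j) then 0 else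
          p.weight k (δ / p.P k) ‖x k j ω‖₊ b.1 (x b.1 b.2 ω, m b ω))) μ := by
    intro j
    have hn : ∀ n, Measurable fun ω => expNeg (∑' b : Station, if b = (k, j) then 0 else
        p.weight k (δ / p.P k) (dyadicFloor n ‖x k j ω‖₊) b.1 (x b.1 b.2 ω, m b ω)) := by
      intro n
      refine measurable_apply_dyadicFloor n (F := fun z ω => expNeg (∑' b : Station,
        if b = (k, j) then 0 else p.weight k (δ / p.P k) z b.1 (x b.1 b.2 ω, m b ω)))
        (fun z => measurable_expNeg.comp (Measurable.tsum fun b => ?_)) (hxm k j).nnnorm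
      split_ifs
      · exact measurable_const
      · exact (measurable_weight k _ z b.1).comp ((hxm _ _).prodMk (h.mark_measurable _))
    refine (measurable_of_tendsto_metrizable hn (tendsto_pi_nhds.2 fun ω => ?_)).aemeasurable
    refine (continuous_expNeg.tendsto _).comp (tendsto_tsum_of_monotone (fun b n n' hn => ?_)
      fun b => ?_)
    · dsimp only
      split_ifs
      · exact le_rfl
      · exact weight_mono hp k hθ _ _ (monotone_dyadicFloor _ hn)
    · split_ifs
      · exact tendsto_const_nhds
      · exact tendsto_weight hp k _ _ _
  have hL := lintegral_tendsto_of_tendsto_of_monotone (μ := μ)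
    (f := fun n ω => ∑' j, (if (m (k, j) ω).1 = true then g n ‖x k j ω‖ else 0) *
        expNeg (∑' b : Station, if b = (k, j) then 0 else
          p.weight k (δ / p.P k) ‖x k j ω‖₊ b.1 (x b.1 b.2 ω, m b ω)))
    (F := fun ω => ∑' j, (if (m (k, j) ω).1 = true then f ‖x k j ω‖ else 0) *
        expNeg (∑' b : Station, if b = (k, j) then 0 else
          p.weight k (δ / p.P k) ‖x k j ω‖₊ b.1 (x b.1 b.2 ω, m b ω)))
    (fun n => ?_) (Eventually.of_forall fun ω n n' hn => ?_) (Eventually.of_forall fun ω => ?_)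
  · have hR : Tendsto (fun n => ENNReal.ofReal (p.lam k * candProb c k) *
        ∫⁻ u in Set.Ioi (0 : ℝ), g n √(u / Real.pi) *
          ENNReal.ofReal (Real.exp (-(p.rateK c k δ * u)))) atTop
        (𝓝 (ENNReal.ofReal (p.lam k * candProb c k) *
        ∫⁻ u in Set.Ioi (0 : ℝ), f √(u / Real.pi) *
          ENNReal.ofReal (Real.exp (-(p.rateK c k δ * u))))) := by
      refine ENNReal.Tendsto.const_mul ?_ (Or.inr ENNReal.ofReal_ne_top)
      refine lintegral_tendsto_of_tendsto_of_monotone (fun n => ?_)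
        (Eventually.of_forall fun u n n' hn => ?_) (Eventually.of_forall fun u => ?_)
      · have := hgm n
        exact Measurable.aemeasurable (by fun_prop)
      · exact mul_le_mul_left (hgmono _ hn) _
      · exact ENNReal.Tendsto.mul_const (hglim _) (Or.inr ENNReal.ofReal_ne_top)
    exact tendsto_nhds_unique hL (hR.congr fun n => (hfin (g n) (hgm n) (hgi n)).symm)
  · refine AEMeasurable.tsum fun j => AEMeasurable.mul ?_ (hE j)
    refine Measurable.aemeasurable (Measurable.ite ?_ ?_ measurable_const)
    · exact (measurable_fst.comp (h.mark_measurable _)) (measurableSet_singleton true)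
    · exact (hgm n).comp (hxm k j).norm
  · refine ENNReal.tsum_le_tsum fun j => mul_le_mul_left ?_ _
    split_ifs
    · exact hgmono _ hn
    · exact le_rfl
  · refine tendsto_tsum_of_monotone (fun j n n' hn => mul_le_mul_left ?_ _) fun j => ?_
    · split_ifs
      · exact hgmono _ hn
      · exact le_rfl
    · refine ENNReal.Tendsto.mul_const ?_ (Or.inr (expNeg_ne_top _))
      split_ifs
      · exact hglim _
      · exact tendsto_const_nhds

end Association

end Params

namespace Elements

variable {Ω : Type*} {X : Elements Ω} {p : Params}

/-! ### The marked Poisson process of the stations -/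

/-- Probability that a helper stores content `n`. -/
def storeProb (p : Params) (n : ℕ) : ℝ := if n ∈ p.Lp then p.pLp else 0

def stores (X : Elements Ω) (n : ℕ) (b : Station) (ω : Ω) : Bool :=
  decide (b.1 = 0 ∨ n ∈ X.cache b.2 ω)

def transmits (X : Elements Ω) (b : Station) (ω : Ω) : Bool :=
  decide (b.1 = 0 ∨ X.active b.2 ω = true)

def mark (X : Elements Ω) (n : ℕ) (b : Station) (ω : Ω) : Mark :=
  (X.stores n b ω, X.transmits b ω, X.fade b ω)

/-- The σ-algebra generated by the sources of randomness in `S`. -/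
@[reducible] def sigmaOf (X : Elements Ω) (S : Set Source) : MeasurableSpace Ω := ⨆ s ∈ S, X.sigma s

lemma sigma_le_sigmaOf {S : Set Source} {s : Source} (hs : s ∈ S) : X.sigma s ≤ X.sigmaOf S :=
  le_iSup₂_of_le s hs le_rfl

lemma sigmaOf_mono {S T : Set Source} (h : S ⊆ T) : X.sigmaOf S ≤ X.sigmaOf T :=
  biSup_mono h

lemma measurable_pos {S : Set Source} {k : Tier} (hS : Source.pos k ∈ S) (j : ℕ) :
    Measurable[X.sigmaOf S] (X.pos k j) := by
  have h : Measurable[X.sigma (.pos k)] fun ω j => X.pos k j ω := comap_measurable _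
  exact ((measurable_pi_apply j).comp h).mono (sigma_le_sigmaOf hS) le_rfl

lemma measurable_fade {S : Set Source} {b : Station} (hS : Source.fade b ∈ S) :
    Measurable[X.sigmaOf S] (X.fade b) :=
  Measurable.mono (comap_measurable _) (sigma_le_sigmaOf hS) le_rfl

lemma measurable_stores {S : Set Source} {b : Station} (hS : b.1 ≠ 0 → Source.cache b.2 ∈ S)
    (n : ℕ) : Measurable[X.sigmaOf S] (X.stores n b) := by
  by_cases hb : b.1 = 0
  · have : X.stores n b = fun _ => true := by
      ext ω
      simp [stores, hb]
    rw [this]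
    exact measurable_const
  · have h : Measurable[X.sigma (.cache b.2), ⊤] (X.cache b.2) :=
      @comap_measurable _ _ ⊤ _
    have h2 : Measurable[X.sigma (.cache b.2)] fun ω =>
        (decide (b.1 = 0 ∨ n ∈ X.cache b.2 ω) : Bool) :=
      (measurable_from_top (f := fun s : Finset ℕ => decide (b.1 = 0 ∨ n ∈ s))).comp h
    exact h2.mono (sigma_le_sigmaOf (hS hb)) le_rfl

lemma measurable_transmits {S : Set Source} {b : Station}
    (hS : b.1 ≠ 0 → Source.active b.2 ∈ S) : Measurable[X.sigmaOf S] (X.transmits b) := by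
  by_cases hb : b.1 = 0
  · have : X.transmits b = fun _ => true := by
      ext ω
      simp [transmits, hb]
    rw [this]
    exact measurable_const
  · have h : Measurable[X.sigma (.active b.2), ⊤] (X.active b.2) :=
      @comap_measurable _ _ ⊤ _
    have h2 : Measurable[X.sigma (.active b.2)] fun ω =>
        (decide (b.1 = 0 ∨ X.active b.2 ω = true) : Bool) :=
      (measurable_from_top (f := fun s : Bool => decide (b.1 = 0 ∨ s = true))).comp h
    exact h2.mono (sigma_le_sigmaOf (hS hb)) le_rfl

lemma measurable_mark {S : Set Source} {b : Station} (n : ℕ) (hf : Source.fade b ∈ S)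
    (hc : b.1 ≠ 0 → Source.cache b.2 ∈ S) (ha : b.1 ≠ 0 → Source.active b.2 ∈ S) :
    Measurable[X.sigmaOf S] (X.mark n b) :=
  (measurable_stores hc n).prodMk ((measurable_transmits ha).prodMk (measurable_fade hf))

/-- The sources of randomness of the mark of a station. -/
def markSources (b : Station) : Set Source :=
  {s | s = .fade b ∨ (b.1 ≠ 0 ∧ (s = .cache b.2 ∨ s = .active b.2))}

/-- The labels of cache and activity carry only the index `j`. An MBS `(0, j)` must not claim those
of the helper `(1, j)`, hence the condition `b.1 ≠ 0` in `markSources`; fading labels already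
contain the tier. -/
lemma disjoint_markSources {b b' : Station} (h : b' ≠ b) :
    markSources b' ⊆ (markSources b)ᶜ := by
  obtain ⟨k, j⟩ := b
  obtain ⟨k', j'⟩ := b'
  intro s hs hs'
  simp only [markSources, Set.mem_ofPred_eq] at hs hs'
  have hk : ∀ a a' : Tier, a ≠ 0 → a' ≠ 0 → a = a' := by decide
  rcases hs with rfl | ⟨hb, rfl | rfl⟩
  · rcases hs' with h1 | ⟨_, h1 | h1⟩
    · exact h (Source.fade.inj h1)
    · cases h1
    · cases h1
  · rcases hs' with h1 | ⟨hb', h1 | h1⟩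
    · cases h1
    · exact h (Prod.ext (hk _ _ hb hb') (Source.cache.inj h1))
    · cases h1
  · rcases hs' with h1 | ⟨hb', h1 | h1⟩
    · cases h1
    · cases h1
    · exact h (Prod.ext (hk _ _ hb hb') (Source.active.inj h1))

variable [mΩ : MeasurableSpace Ω] {μ : Measure Ω}

namespace Law

lemma sigmaOf_le (hX : X.Law p μ) (S : Set Source) : X.sigmaOf S ≤ mΩ :=
  iSup₂_le fun s _ => hX.sigma_le s

lemma indep_sigmaOf (hX : X.Law p μ) {S T : Set Source} (h : Disjoint S T) :
    Indep (X.sigmaOf S) (X.sigmaOf T) μ :=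
  indep_iSup_of_disjoint hX.sigma_le hX.indep h

lemma indepFun_sigmaOf (hX : X.Law p μ) {S T : Set Source} (h : Disjoint S T) {β β' : Type*}
    [mβ : MeasurableSpace β] [mβ' : MeasurableSpace β'] {f : Ω → β} {g : Ω → β'}
    (hf : Measurable[X.sigmaOf S] f) (hg : Measurable[X.sigmaOf T] g) : IndepFun f g μ :=
  (IndepFun_iff_Indep f g μ).2 (indep_of_indep_of_le_left (indep_of_indep_of_le_right
    (hX.indep_sigmaOf h) hg.comap_le) hf.comap_le)

variable [IsProbabilityMeasure μ]

/-- Read off from the law of the activity, so the integral that defines `pa` never has to be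
evaluated. -/
lemma pa_nonneg (hX : X.Law p μ) : 0 ≤ p.pa := by
  rw [← hX.active_law 0]
  exact measureReal_nonneg

lemma pa_le_one (hX : X.Law p μ) : p.pa ≤ 1 := by
  rw [← hX.active_law 0]
  exact measureReal_le_one

lemma storeProb_eq (hX : X.Law p μ) (n j : ℕ) :
    μ.real {ω | n ∈ X.cache j ω} = storeProb p n := by
  unfold storeProb
  split_ifs with hn
  · exact hX.cache_law j n hn
  · have : {ω | n ∈ X.cache j ω} = ∅ := by
      ext ω
      simp only [Set.mem_ofPred_eq, Set.mem_empty_iff_false, iff_false]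
      exact fun h => hn (hX.cache_subset j ω h)
    rw [this, measureReal_empty]

lemma storeProb_nonneg (hX : X.Law p μ) (n : ℕ) : 0 ≤ storeProb p n := by
  rw [← hX.storeProb_eq n 0]
  exact measureReal_nonneg

lemma storeProb_le_one (hX : X.Law p μ) (n : ℕ) : storeProb p n ≤ 1 := by
  rw [← hX.storeProb_eq n 0]
  exact measureReal_le_one

lemma map_stores (hX : X.Law p μ) (n : ℕ) (b : Station) :
    μ.map (X.stores n b) = boolLaw (Params.candProb (storeProb p n) b.1) := by
  have hm : Measurable (X.stores n b) :=
    (measurable_stores (S := Set.univ) (fun _ => Set.mem_univ _) n).mono (hX.sigmaOf_le _) le_rfl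
  have := Measure.isProbabilityMeasure_map (μ := μ) hm.aemeasurable
  refine eq_boolLaw ?_
  rw [map_measureReal_apply hm (measurableSet_singleton _)]
  unfold Params.candProb
  split_ifs with hb
  · have : X.stores n b ⁻¹' {true} = Set.univ := by
      ext ω
      simp [stores, hb]
    rw [this, probReal_univ]
  · rw [← hX.storeProb_eq n b.2]
    congr 1
    ext ω
    simp [stores, hb]

lemma map_transmits (hX : X.Law p μ) (b : Station) :
    μ.map (X.transmits b) = boolLaw (p.actProb b.1) := by
  have hm : Measurable (X.transmits b) :=
    (measurable_transmits (S := Set.univ) (fun _ => Set.mem_univ _)).mono (hX.sigmaOf_le _) le_rfl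
  have := Measure.isProbabilityMeasure_map (μ := μ) hm.aemeasurable
  refine eq_boolLaw ?_
  rw [map_measureReal_apply hm (measurableSet_singleton _)]
  unfold Params.actProb
  split_ifs with hb
  · have : X.transmits b ⁻¹' {true} = Set.univ := by
      ext ω
      simp [transmits, hb]
    rw [this, probReal_univ]
  · rw [← hX.active_law b.2]
    congr 1
    ext ω
    simp [transmits, hb]

/-- Grouping of independent sources: everything outside the sources of the mark of `b` generates the
complementary σ-algebra. The product form of the mark law is the independence of cache, activity and
fading of one station. -/
lemma isMarkedPoisson (hX : X.Law p μ) (hp : p.Valid) (n : ℕ) :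
    IsMarkedPoisson X.pos (X.mark n) p.lam (p.markLaw (storeProb p n))
      (fun b => X.sigmaOf (markSources b)ᶜ) μ := by
  have hmark : ∀ b, Measurable[X.sigmaOf (markSources b)] (X.mark n b) := by
    intro b
    refine measurable_mark n (Or.inl rfl) (fun hb => Or.inr ⟨hb, Or.inl rfl⟩)
      (fun hb => Or.inr ⟨hb, Or.inr rfl⟩)
  have hle := hX.sigmaOf_le
  refine ⟨hX.pos_law, fun k => (hp.lam_pos k).le, ?_, fun b => (hmark b).mono (hle _) le_rfl, ?_,
    fun b => hle _, fun b k j => ?_, fun b b' hb => ?_, fun b => ?_⟩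
  · have := hX.indep.indep (i := .pos 0) (j := .pos 1) (by simp)
    exact this
  · intro b
    have h1 : Measurable[X.sigmaOf {.cache b.2}] (X.stores n b) :=
      measurable_stores (fun _ => Set.mem_singleton _) n
    have h2 : Measurable[X.sigmaOf {.active b.2}] (X.transmits b) :=
      measurable_transmits (fun _ => Set.mem_singleton _)
    have h3 : Measurable[X.sigmaOf {.fade b}] (X.fade b) := measurable_fade (Set.mem_singleton _)
    have h23 : Measurable[X.sigmaOf {.active b.2, .fade b}]
        fun ω => (X.transmits b ω, X.fade b ω) :=
      (h2.mono (sigmaOf_mono (by simp)) le_rfl).prodMk (h3.mono (sigmaOf_mono (by simp)) le_rfl)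
    have i23 := hX.indepFun_sigmaOf (S := {.active b.2}) (T := {.fade b}) (by simp)
      (f := X.transmits b) (g := X.fade b)
    have i123 := hX.indepFun_sigmaOf (S := {.cache b.2}) (T := {.active b.2, .fade b}) (by simp)
      (f := X.stores n b) (g := fun ω => (X.transmits b ω, X.fade b ω))
    replace i23 := i23 h2 h3
    replace i123 := i123 h1 h23
    have m1 := h1.mono (hle _) le_rfl
    have m2 := h2.mono (hle _) le_rfl
    have m3 := h3.mono (hle _) le_rfl
    have m23 := h23.mono (hle _) le_rfl
    rw [indepFun_iff_map_prod_eq_prod_map_map m1.aemeasurable m23.aemeasurable] at i123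
    rw [indepFun_iff_map_prod_eq_prod_map_map m2.aemeasurable m3.aemeasurable] at i23
    rw [i23, hX.map_stores, hX.map_transmits, hX.fade_law] at i123
    exact i123
  · exact measurable_pos (by simp [markSources]) j
  · exact (hmark b').mono (sigmaOf_mono (disjoint_markSources hb)) le_rfl
  · exact indep_of_indep_of_le_left (hX.indep_sigmaOf disjoint_compl_right) (hmark b).comap_le

end Law

end Elements

/-! ### The law of the load -/

lemma lintegral_rpow_mul_exp {a r : ℝ} (ha : 0 < a) (hr : 0 < r) :
    ∫⁻ t in Set.Ioi (0 : ℝ), ENNReal.ofReal (t ^ (a - 1) * Real.exp (-(r * t))) =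
      ENNReal.ofReal ((1 / r) ^ a * Real.Gamma a) := by
  have h := Real.integral_rpow_mul_exp_neg_mul_Ioi ha hr
  have hpos : 0 < (1 / r) ^ a * Real.Gamma a :=
    mul_pos (Real.rpow_pos_of_pos (by positivity) _) (Real.Gamma_pos_of_pos ha)
  rw [← h, ofReal_integral_eq_lintegral_ofReal]
  · exact Integrable.of_integral_ne_zero (h ▸ hpos.ne')
  · filter_upwards [ae_restrict_mem measurableSet_Ioi] with t ht
    have : (0 : ℝ) < t := ht
    positivity

namespace Params

variable {p : Params}

lemma q_nonneg (n : ℕ) : 0 ≤ p.q n := by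
  unfold q
  positivity

lemma pLp_nonneg : 0 ≤ p.pLp := by
  unfold pLp
  positivity

lemma lam'_nonneg (hp : p.Valid) (k : Tier) : 0 ≤ p.lam' k := by
  have h0 := hp.lam_pos 0
  have h1 := hp.lam_pos 1
  have := p.pLp_nonneg
  unfold lam'
  split_ifs <;> positivity

lemma ALp_nonneg (hp : p.Valid) (k : Tier) : 0 ≤ p.ALp k := by
  have h := p.lam'_nonneg hp
  have hP := hp.P_pos
  unfold ALp
  refine div_nonneg (mul_nonneg (h k) (Real.rpow_nonneg (hP k).le _)) (Finset.sum_nonneg ?_)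
  exact fun i _ => mul_nonneg (h i) (Real.rpow_nonneg (hP i).le _)

lemma A_nonneg (hp : p.Valid) (k : Tier) : 0 ≤ p.A k := by
  have h1 : 0 ≤ p.QMp := Finset.sum_nonneg fun n _ => q_nonneg n
  have h2 : 0 ≤ p.QLp := Finset.sum_nonneg fun n _ => q_nonneg n
  have h3 := p.ALp_nonneg hp
  unfold A
  split_ifs
  · exact add_nonneg h1 (mul_nonneg h2 (h3 0))
  · exact mul_nonneg h2 (h3 1)

lemma loadPMF_nonneg (hp : p.Valid) (k : Tier) (l : ℕ) : 0 ≤ p.loadPMF k l := by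
  have h1 := p.A_nonneg hp k
  have h2 := hp.lam_pos k
  have h3 := hp.lamU_pos
  have h4 : 0 < Real.Gamma ((l : ℝ) + 4.5) := Real.Gamma_pos_of_pos (by positivity)
  have h5 : 0 < Real.Gamma 3.5 := Real.Gamma_pos_of_pos (by norm_num)
  unfold loadPMF
  positivity

/-- The law is a Gamma mixture of Poisson laws: term `l` is the integral of the Poisson mass with
mean `a t` against a multiple of `t^{3.5} e^{-3.5 t}`. Summing over `l` first leaves a single Gamma
integral of order `4.5`, which cancels the constants. -/
lemma tsum_ofReal_loadPMF (hp : p.Valid) (k : Tier) :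
    ∑' l, ENNReal.ofReal (p.loadPMF k l) = 1 := by
  set a : ℝ := p.A k * p.lamU / p.lam k with ha
  have ha0 : 0 ≤ a := div_nonneg (mul_nonneg (p.A_nonneg hp k) hp.lamU_pos.le) (hp.lam_pos k).le
  set C : ℝ := (3.5 : ℝ) ^ (3.5 : ℝ) / Real.Gamma 3.5 with hC
  have hC0 : 0 ≤ C := by
    have h5 : 0 < Real.Gamma 3.5 := Real.Gamma_pos_of_pos (by norm_num)
    positivity
  let F : ℕ → ℝ → ℝ := fun l t =>
    (a * t) ^ l / (l.factorial : ℝ) * (t ^ (3.5 : ℝ) * Real.exp (-((3.5 + a) * t)))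
  have hF0 : ∀ l, ∀ t ∈ Set.Ioi (0 : ℝ), 0 ≤ F l t := by
    intro l t ht
    have : (0 : ℝ) < t := ht
    positivity
  have hterm : ∀ l, ENNReal.ofReal (p.loadPMF k l) =
      ENNReal.ofReal C * ∫⁻ t in Set.Ioi (0 : ℝ), ENNReal.ofReal (F l t) := by
    intro l
    have hl0 : (0 : ℝ) < (l : ℝ) + 4.5 := by positivity
    have h : ∀ t ∈ Set.Ioi (0 : ℝ), ENNReal.ofReal (F l t) =
        ENNReal.ofReal (a ^ l / (l.factorial : ℝ)) *
          ENNReal.ofReal (t ^ ((l : ℝ) + 4.5 - 1) * Real.exp (-((3.5 + a) * t))) := by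
      intro t ht
      have ht0 : (0 : ℝ) < t := ht
      rw [← ENNReal.ofReal_mul (by positivity)]
      congr 1
      have : t ^ ((l : ℝ) + 4.5 - 1) = t ^ l * t ^ (3.5 : ℝ) := by
        rw [← Real.rpow_natCast t l, ← Real.rpow_add ht0]
        norm_num
        ring_nf
      simp only [F]
      rw [this, mul_pow]
      ring
    rw [setLIntegral_congr_fun measurableSet_Ioi h, lintegral_const_mul _ (by fun_prop),
      lintegral_rpow_mul_exp hl0 (by positivity), ← ENNReal.ofReal_mul (by positivity),
      ← ENNReal.ofReal_mul hC0]
    congr 1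
    rw [loadPMF, ← ha, hC, one_div, Real.inv_rpow (by positivity), Real.rpow_neg (by positivity)]
    ring
  have hsum : ∀ t ∈ Set.Ioi (0 : ℝ), ∑' l, ENNReal.ofReal (F l t) =
      ENNReal.ofReal (t ^ ((4.5 : ℝ) - 1) * Real.exp (-(3.5 * t))) := by
    intro t ht
    have ht0 : (0 : ℝ) < t := ht
    have h1 := (NormedSpace.expSeries_div_hasSum_exp (a * t)).mul_right
      (t ^ (3.5 : ℝ) * Real.exp (-((3.5 + a) * t)))
    rw [← ENNReal.ofReal_tsum_of_nonneg (fun l => hF0 l t ht) h1.summable, h1.tsum_eq]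
    congr 1
    rw [← Real.exp_eq_exp_ℝ, mul_left_comm, ← Real.exp_add,
      show a * t + -((3.5 + a) * t) = -(3.5 * t) by ring, show (4.5 : ℝ) - 1 = 3.5 by norm_num]
  simp_rw [hterm]
  rw [ENNReal.tsum_mul_left, ← lintegral_tsum (fun l => by fun_prop),
    setLIntegral_congr_fun measurableSet_Ioi hsum, lintegral_rpow_mul_exp (by norm_num)
      (by norm_num), ← ENNReal.ofReal_mul hC0, ← ENNReal.ofReal_one]
  congr 1
  have hG : Real.Gamma 4.5 = 3.5 * Real.Gamma 3.5 := by
    rw [← Real.Gamma_add_one (by norm_num)]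
    norm_num
  have hG0 : Real.Gamma 3.5 ≠ 0 := (Real.Gamma_pos_of_pos (by norm_num)).ne'
  have hr : (3.5 : ℝ) ^ (4.5 : ℝ) = 3.5 * 3.5 ^ (3.5 : ℝ) := by
    rw [show (4.5 : ℝ) = 1 + 3.5 by norm_num, Real.rpow_add (by norm_num), Real.rpow_one]
  have hr0 : (3.5 : ℝ) ^ (3.5 : ℝ) ≠ 0 := (Real.rpow_pos_of_pos (by norm_num) _).ne'
  rw [one_div, Real.inv_rpow (by norm_num), hr, hG, hC]
  field_simp

lemma summable_loadPMF (hp : p.Valid) (k : Tier) : Summable (p.loadPMF k) := by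
  have h := tsum_ofReal_loadPMF hp k
  have h2 := ENNReal.summable_toReal (f := fun l => ENNReal.ofReal (p.loadPMF k l)) (by simp [h])
  simpa only [ENNReal.toReal_ofReal (loadPMF_nonneg hp k _)] using h2

end Params

namespace Elements

variable {Ω : Type*} {X : Elements Ω} {p : Params} [mΩ : MeasurableSpace Ω] {μ : Measure Ω}
  [IsProbabilityMeasure μ]

namespace Law

lemma measurable_load (hX : X.Law p μ) (k : Tier) : Measurable (X.load k) :=
  Measurable.mono (measurable_iff_comap_le.2 le_rfl) (hX.sigma_le (.load k)) le_top

lemma measurable_pos (hX : X.Law p μ) (k : Tier) (j : ℕ) : Measurable (X.pos k j) :=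
  (hX.pos_law k).measurable j

lemma measurable_fade (hX : X.Law p μ) (b : Station) : Measurable (X.fade b) :=
  Measurable.mono (comap_measurable _) (hX.sigma_le (.fade b)) le_rfl

lemma measure_load (hX : X.Law p μ) (k : Tier) (l : ℕ) :
    μ {ω | X.load k ω = l + 1} = ENNReal.ofReal (p.loadPMF k l) := by
  rw [← hX.load_law k l, ofReal_measureReal]

/-- The prescribed masses of the positive loads already add up to one. -/
lemma ae_load_pos (hX : X.Law p μ) (hp : p.Valid) (k : Tier) : ∀ᵐ ω ∂μ, X.load k ω ≠ 0 := by
  have hm := hX.measurable_load k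
  have h1 : μ (⋃ l : ℕ, {ω | X.load k ω = l + 1}) = 1 := by
    rw [measure_iUnion]
    · simp_rw [hX.measure_load]
      exact Params.tsum_ofReal_loadPMF hp k
    · intro l l' hl
      refine Set.disjoint_left.2 fun ω h h' => hl ?_
      have h1 : X.load k ω = l + 1 := h
      have h2 : X.load k ω = l' + 1 := h'
      omega
    · exact fun l => hm (measurableSet_singleton _)
  have h2 := (prob_compl_eq_zero_iff
    (MeasurableSet.iUnion fun l => hm (measurableSet_singleton (l + 1)))).2 h1
  rw [ae_iff]
  refine measure_mono_null ?_ h2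
  intro ω hω
  have hω' : X.load k ω = 0 := by simpa using hω
  simp [hω']

/-! ### Almost sure properties of the stations -/

/-- Campbell's formula for the indicator of the origin: the mean number of stations there is a
multiple of the area of a point. -/
lemma ae_dist_pos (hX : X.Law p μ) (hp : p.Valid) : ∀ᵐ ω ∂μ, ∀ b, 0 < X.dist b ω := by
  have h := hX.isMarkedPoisson hp 0
  have hk : ∀ k, ∀ᵐ ω ∂μ, ∀ j, 0 < X.dist (k, j) ω := by
    intro k
    have hφ : Measurable fun q : Plane × Mark => ({0} : Set Plane).indicator (1 : Plane → ℝ≥0∞) q.1 :=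
      (measurable_const.indicator (measurableSet_singleton 0)).comp measurable_fst
    have hc := h.campbell_formula k hφ
    have := h.isProbabilityMeasure k
    have h0 : ∫⁻ z, ∫⁻ _ : Mark, ({0} : Set Plane).indicator (1 : Plane → ℝ≥0∞) z
        ∂(p.markLaw (storeProb p 0) k) = 0 := by
      simp only [lintegral_const, measure_univ, mul_one]
      rw [lintegral_indicator_one (measurableSet_singleton 0)]
      simp
    rw [h0, mul_zero, lintegral_eq_zero_iff] at hc
    · filter_upwards [hc] with ω hω j
      have h1 := ENNReal.tsum_eq_zero.1 hω j
      refine norm_pos_iff.2 fun h2 => ?_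
      change X.pos k j ω = 0 at h2
      simp [h2] at h1
    · exact Measurable.tsum fun j => (measurable_const.indicator (measurableSet_singleton 0)).comp
        (hX.measurable_pos k j)
  filter_upwards [ae_all_iff.2 hk] with ω hω b
  exact hω b.1 b.2

lemma ae_fade_pos (hX : X.Law p μ) : ∀ᵐ ω ∂μ, ∀ b, 0 < X.fade b ω := by
  refine ae_all_iff.2 fun b => ?_
  have hm := hX.measurable_fade b
  have h0 : expMeasure 1 (Set.Iic 0) = 0 := by
    have h1 := lintegral_expMeasure_one
      (measurable_one.indicator (measurableSet_Iic (a := (0 : ℝ))) (f := fun _ => (1 : ℝ≥0∞)))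
    rw [lintegral_indicator_const measurableSet_Iic, one_mul] at h1
    rw [h1]
    refine (setLIntegral_congr_fun (g := fun _ => 0) measurableSet_Ioi fun t ht => ?_).trans
      (by simp)
    have : ¬ t ≤ 0 := not_le.2 ht
    simp [this]
  rw [← hX.fade_law b, Measure.map_apply hm measurableSet_Iic] at h0
  rw [ae_iff]
  refine measure_mono_null ?_ h0
  intro ω hω
  exact not_lt.1 hω

lemma ae_finite_ball (hX : X.Law p μ) (hp : p.Valid) :
    ∀ᵐ ω ∂μ, ∀ r : ℝ, {b | X.dist b ω ≤ r}.Finite := by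
  have hkr : ∀ k (m : ℕ), ∀ᵐ ω ∂μ,
      {j | X.pos k j ω ∈ Metric.closedBall (0 : Plane) m}.encard ≠ ⊤ := fun k m =>
    (hX.pos_law k).ae_encard_ne_top measurableSet_closedBall measure_closedBall_lt_top.ne
      (hp.lam_pos k).le
  filter_upwards [ae_all_iff.2 fun k => ae_all_iff.2 (hkr k)] with ω hω r
  obtain ⟨m, hm⟩ := exists_nat_ge r
  have hfin : ∀ k, {j | X.pos k j ω ∈ Metric.closedBall (0 : Plane) m}.Finite := fun k =>
    Set.encard_ne_top_iff.1 (hω k m)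
  refine (Set.Finite.subset (Set.finite_iUnion fun k : Tier => (hfin k).image (Prod.mk k)) ?_)
  intro b hb
  have hb' : X.dist b ω ≤ r := hb
  refine Set.mem_iUnion.2 ⟨b.1, b.2, ?_, rfl⟩
  exact mem_closedBall_zero_iff.2 (hb'.trans hm)

lemma received_nonneg (hp : p.Valid) {ω : Ω} {b : Station} (h : 0 ≤ X.fade b ω) :
    0 ≤ X.received p b ω :=
  mul_nonneg (mul_nonneg (hp.P_pos _).le h) (Real.rpow_nonneg (norm_nonneg _) _)

lemma received_pos (hp : p.Valid) {ω : Ω} {b : Station} (h : 0 < X.fade b ω)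
    (hd : 0 < X.dist b ω) : 0 < X.received p b ω :=
  mul_pos (mul_pos (hp.P_pos _) h) (Real.rpow_pos_of_pos hd _)

/-- Beyond distance one the mean received power is finite by Campbell's formula, because `α > 2`;
within distance one there are only finitely many stations. The split is unavoidable, as the mean
near the origin is infinite for the same reason. -/
lemma ae_tsum_received_ne_top (hX : X.Law p μ) (hp : p.Valid) :
    ∀ᵐ ω ∂μ, ∑' b, ENNReal.ofReal (X.received p b ω) ≠ ⊤ := by
  have h := hX.isMarkedPoisson hp 0
  have hα := hp.two_lt_α
  have hk : ∀ k, ∀ᵐ ω ∂μ, ∑' j, (if 1 < X.dist (k, j) ω then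
      ENNReal.ofReal (X.received p (k, j) ω) else 0) ≠ ⊤ := by
    intro k
    have hg : Measurable fun z : ℝ =>
        if 1 < z then ENNReal.ofReal (p.P k) * ENNReal.ofReal (z ^ (-p.α)) else 0 :=
      Measurable.ite measurableSet_Ioi (by fun_prop) measurable_const
    let φ : Plane × Mark → ℝ≥0∞ := fun q => (if 1 < ‖q.1‖ then
      ENNReal.ofReal (p.P k) * ENNReal.ofReal (‖q.1‖ ^ (-p.α)) else 0) * ENNReal.ofReal q.2.2.2
    have hφ : Measurable φ := (hg.comp measurable_fst.norm).mul (by fun_prop)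
    have hc := h.campbell_formula k hφ
    have hmark : ∫⁻ y : Mark, ENNReal.ofReal y.2.2 ∂(p.markLaw (storeProb p 0) k) ≠ ⊤ := by
      have hm : Measurable fun y : Mark => ENNReal.ofReal y.2.2 := by fun_prop
      rw [← h.mark_law (k, 0), lintegral_map hm (h.mark_measurable _)]
      change ∫⁻ ω, ENNReal.ofReal (X.fade (k, 0) ω) ∂μ ≠ ⊤
      rw [← lintegral_map (f := ENNReal.ofReal) ENNReal.measurable_ofReal (hX.measurable_fade _),
        hX.fade_law, lintegral_expMeasure_one ENNReal.measurable_ofReal]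
      have h2 := lintegral_rpow_mul_exp (a := 2) (r := 1) two_pos one_pos
      refine ne_of_eq_of_ne ?_ (h2 ▸ ENNReal.ofReal_ne_top)
      refine setLIntegral_congr_fun measurableSet_Ioi fun t ht => ?_
      have ht0 : (0 : ℝ) < t := ht
      rw [← ENNReal.ofReal_mul ht0.le]
      norm_num
    have hz : ∫⁻ z : Plane, (if 1 < ‖z‖ then
        ENNReal.ofReal (p.P k) * ENNReal.ofReal (‖z‖ ^ (-p.α)) else 0) ≠ ⊤ := by
      have h3 : ∫⁻ z : Plane, ENNReal.ofReal ((1 + ‖z‖) ^ (-p.α)) < ⊤ :=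
        finite_integral_one_add_norm (by simpa using hα)
      have hle : ∀ z : Plane, (if 1 < ‖z‖ then
          ENNReal.ofReal (p.P k) * ENNReal.ofReal (‖z‖ ^ (-p.α)) else 0) ≤
          ENNReal.ofReal (p.P k * 2 ^ p.α) * ENNReal.ofReal ((1 + ‖z‖) ^ (-p.α)) := by
        intro z
        split_ifs with hz1
        · have h0 : 0 < ‖z‖ := one_pos.trans hz1
          rw [← ENNReal.ofReal_mul (hp.P_pos k).le, ← ENNReal.ofReal_mul
            (mul_nonneg (hp.P_pos k).le (by positivity)), mul_assoc]
          refine ENNReal.ofReal_le_ofReal (mul_le_mul_of_nonneg_left ?_ (hp.P_pos k).le)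
          have h4 : ((1 + ‖z‖) / 2) ^ p.α ≤ ‖z‖ ^ p.α :=
            Real.rpow_le_rpow (by positivity) (by linarith) (by linarith)
          rw [Real.div_rpow (by positivity) two_pos.le] at h4
          have h5 : 0 < (1 + ‖z‖) ^ p.α := by positivity
          rw [Real.rpow_neg h0.le, Real.rpow_neg (by positivity), ← div_eq_mul_inv,
            inv_le_comm₀ (by positivity) (by positivity), inv_div]
          exact h4
        · exact zero_le
      refine ((lintegral_mono hle).trans_lt ?_).ne
      rw [lintegral_const_mul _ (by fun_prop)]
      exact ENNReal.mul_lt_top ENNReal.ofReal_lt_top h3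
    have hfin : ∫⁻ ω, ∑' j, φ (X.pos k j ω, X.mark 0 (k, j) ω) ∂μ ≠ ⊤ := by
      rw [hc]
      refine ENNReal.mul_ne_top ENNReal.ofReal_ne_top ?_
      have hm : Measurable fun y : Mark => ENNReal.ofReal y.2.2 := by fun_prop
      have hin : ∀ z : Plane, ∫⁻ y, φ (z, y) ∂(p.markLaw (storeProb p 0) k) = (if 1 < ‖z‖ then
          ENNReal.ofReal (p.P k) * ENNReal.ofReal (‖z‖ ^ (-p.α)) else 0) *
          ∫⁻ y : Mark, ENNReal.ofReal y.2.2 ∂(p.markLaw (storeProb p 0) k) :=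
        fun z => by rw [← lintegral_const_mul _ hm]
      simp_rw [hin]
      have hgn : Measurable fun z : Plane => if 1 < ‖z‖ then
          ENNReal.ofReal (p.P k) * ENNReal.ofReal (‖z‖ ^ (-p.α)) else 0 := hg.comp measurable_norm
      rw [lintegral_mul_const _ hgn]
      exact ENNReal.mul_ne_top hz hmark
    have hme : Measurable fun ω => ∑' j, φ (X.pos k j ω, X.mark 0 (k, j) ω) :=
      Measurable.tsum fun j => hφ.comp ((hX.measurable_pos k j).prodMk (h.mark_measurable (k, j)))
    filter_upwards [ae_lt_top hme hfin] with ω hω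
    refine (lt_of_le_of_lt (ENNReal.tsum_le_tsum fun j => ?_) hω).ne
    by_cases h1 : 1 < X.dist (k, j) ω
    · have h0 : 0 ≤ X.dist (k, j) ω ^ (-p.α) := Real.rpow_nonneg (norm_nonneg _) _
      have h2 : φ (X.pos k j ω, X.mark 0 (k, j) ω) =
          ENNReal.ofReal (p.P k) * ENNReal.ofReal (X.dist (k, j) ω ^ (-p.α)) *
            ENNReal.ofReal (X.fade (k, j) ω) := congrArg (· * _) (if_pos h1)
      rw [if_pos h1, h2, ← ENNReal.ofReal_mul (hp.P_pos k).le,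
        ← ENNReal.ofReal_mul (mul_nonneg (hp.P_pos k).le h0), mul_right_comm, received]
    · rw [if_neg h1]
      exact zero_le
  filter_upwards [ae_all_iff.2 hk, hX.ae_finite_ball hp] with ω hω hfin
  have hsplit : ∀ b, ENNReal.ofReal (X.received p b ω) =
      (if X.dist b ω ≤ 1 then ENNReal.ofReal (X.received p b ω) else 0) +
        if 1 < X.dist b ω then ENNReal.ofReal (X.received p b ω) else 0 := by
    intro b
    by_cases hb : X.dist b ω ≤ 1
    · simp [hb, not_lt.2 hb]
    · simp [hb, not_le.1 hb]
  rw [tsum_congr hsplit, ENNReal.tsum_add]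
  refine ENNReal.add_ne_top.2 ⟨?_, ?_⟩
  · rw [tsum_eq_sum (s := (hfin 1).toFinset)]
    · refine ENNReal.sum_ne_top.2 fun b _ => ?_
      split_ifs <;> simp
    · intro b hb
      rw [if_neg]
      simpa using hb
  · rw [ENNReal.tsum_prod', tsum_fintype]
    exact ENNReal.sum_ne_top.2 fun k _ => hω k

end Law

end Elements

namespace Elements

variable {Ω : Type*} {X : Elements Ω} {p : Params}

/-! ### The strongest candidate -/

/-- Total power received from the transmitting stations other than `b`. -/
def otherPower (X : Elements Ω) (p : Params) (b : Station) (ω : Ω) : ℝ≥0∞ :=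
  ∑' b' : Station, if b' ≠ b ∧ X.transmits b' ω = true then ENNReal.ofReal (X.received p b' ω) else 0

lemma mem_candidates_iff {n : ℕ} {b : Station} {ω : Ω} :
    b ∈ X.candidates n ω ↔ X.stores n b ω = true := by
  simp [candidates, stores]

lemma power_le_iff (hp : p.Valid) {ω : Ω} (hd : ∀ b, 0 < X.dist b ω) (b b' : Station) :
    p.P b'.1 * X.dist b' ω ^ (-p.α) ≤ p.P b.1 * X.dist b ω ^ (-p.α) ↔
      ¬ X.dist b' ω < p.ratio b.1 b'.1 * X.dist b ω := by
  have hα := Params.α_pos hp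
  have h1 := hp.P_pos b.1
  have h2 := hp.P_pos b'.1
  have hb := hd b
  have hb' := hd b'
  have hr := Params.ratio_pos hp b.1 b'.1
  rw [not_lt, ← Real.rpow_le_rpow_iff (by positivity) hb'.le hα,
    Real.mul_rpow hr.le hb.le, Params.ratio_rpow_α hp, Real.rpow_neg hb.le, Real.rpow_neg hb'.le,
    ← div_eq_mul_inv, ← div_eq_mul_inv, div_le_div_iff₀ (by positivity) (by positivity),
    div_mul_eq_mul_div, div_le_iff₀ h1, mul_comm (p.P b.1)]

/-- The comparison of `b` with itself is trivial and can be dropped; the condition is then on the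
other stations only, as the reduced Mecke formula requires. -/
lemma mem_strongest_iff (hp : p.Valid) {n : ℕ} {ω : Ω} (hd : ∀ b, 0 < X.dist b ω) {b : Station} :
    b ∈ X.strongest p n ω ↔ X.stores n b ω = true ∧
      ∀ b', b' ≠ b → ¬ (X.stores n b' ω = true ∧ X.dist b' ω < p.ratio b.1 b'.1 * X.dist b ω) := by
  constructor
  · rintro ⟨h1, h2⟩
    refine ⟨mem_candidates_iff.1 h1, fun b' _ h => ?_⟩
    exact (power_le_iff hp hd b b').1 (h2 b' (mem_candidates_iff.2 h.1)) h.2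
  · rintro ⟨h1, h2⟩
    refine ⟨mem_candidates_iff.2 h1, fun b' hb' => ?_⟩
    by_cases h : b' = b
    · rw [h]
    · exact (power_le_iff hp hd b b').2 fun h3 => h2 b' h ⟨mem_candidates_iff.1 hb', h3⟩

/-- The MBS `(0, 0)` is always a candidate. Stations at least as strong as it lie in a bounded disc,
so they are finitely many and the maximum is attained. -/
lemma strongest_nonempty (hp : p.Valid) (n : ℕ) {ω : Ω} (hd : ∀ b, 0 < X.dist b ω)
    (hfin : ∀ r : ℝ, {b | X.dist b ω ≤ r}.Finite) : (X.strongest p n ω).Nonempty := by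
  let r : ℝ := p.ratio 0 0 * X.dist (0, 0) ω + p.ratio 0 1 * X.dist (0, 0) ω
  let S : Set Station := {b | b ∈ X.candidates n ω ∧
    p.P 0 * X.dist (0, 0) ω ^ (-p.α) ≤ p.P b.1 * X.dist b ω ^ (-p.α)}
  have hS : S.Finite := by
    refine (hfin r).subset fun b hb => ?_
    have h0 := hd (0, 0)
    have hr : ∀ i, p.ratio 0 i * X.dist (0, 0) ω ≤ r := by
      have h1 := Params.ratio_pos hp 0 0
      have h2 := Params.ratio_pos hp 0 1
      rw [Fin.forall_fin_two]
      constructor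
      · have : 0 < p.ratio 0 1 * X.dist (0, 0) ω := by positivity
        simp only [r]; linarith
      · have : 0 < p.ratio 0 0 * X.dist (0, 0) ω := by positivity
        simp only [r]; linarith
    refine le_trans ?_ (hr b.1)
    by_contra hcon
    have h3 := (power_le_iff hp hd b (0, 0)).1 hb.2
    have hmul : p.ratio b.1 0 * p.ratio 0 b.1 = 1 := by
      unfold Params.ratio
      have h1 := hp.P_pos b.1
      have h2 := hp.P_pos 0
      rw [← Real.mul_rpow (by positivity) (by positivity), div_mul_div_comm, mul_comm (p.P 0),
        div_self (by positivity), Real.one_rpow]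
    refine h3 ?_
    have hrb := Params.ratio_pos hp b.1 0
    calc X.dist (0, 0) ω = p.ratio b.1 0 * (p.ratio 0 b.1 * X.dist (0, 0) ω) := by
          rw [← mul_assoc, hmul, one_mul]
      _ < p.ratio b.1 0 * X.dist b ω := mul_lt_mul_of_pos_left (not_le.1 hcon) hrb
  have h00 : ((0, 0) : Station) ∈ S := ⟨Or.inl rfl, le_rfl⟩
  obtain ⟨b, hb, hmax⟩ := S.exists_max_image (fun b => p.P b.1 * X.dist b ω ^ (-p.α)) hS ⟨_, h00⟩
  refine ⟨b, hb.1, fun b' hb' => ?_⟩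
  by_cases h : p.P 0 * X.dist (0, 0) ω ^ (-p.α) ≤ p.P b'.1 * X.dist b' ω ^ (-p.α)
  · exact hmax b' ⟨hb', h⟩
  · exact (not_le.1 h).le.trans hb.2

lemma serving_mem_strongest {n : ℕ} {ω : Ω} (h : (X.strongest p n ω).Nonempty) :
    X.serving p n ω ∈ X.strongest p n ω := by
  rw [serving, dif_pos h]
  exact Function.argminOn_mem _ _ _

/-- The exponential of the weights of the other stations. -/
lemma expNeg_tsum_weight (n : ℕ) (b : Station) (θ : ℝ) (ω : Ω) :
    expNeg (∑' b' : Station, if b' = b then 0 else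
      p.weight b.1 θ ‖X.pos b.1 b.2 ω‖₊ b'.1 (X.pos b'.1 b'.2 ω, X.mark n b' ω)) =
    {ω | ∀ b', b' ≠ b → ¬ (X.stores n b' ω = true ∧
      X.dist b' ω < p.ratio b.1 b'.1 * X.dist b ω)}.indicator
      (fun ω => expNeg (ENNReal.ofReal (θ * X.dist b ω ^ p.α) * X.otherPower p b ω)) ω := by
  classical
  have hsplit : ∀ b' : Station, (if b' = b then 0 else
      p.weight b.1 θ ‖X.pos b.1 b.2 ω‖₊ b'.1 (X.pos b'.1 b'.2 ω, X.mark n b' ω)) =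
      (if b' ≠ b ∧ (X.stores n b' ω = true ∧ X.dist b' ω < p.ratio b.1 b'.1 * X.dist b ω)
        then ⊤ else 0) +
      ENNReal.ofReal (θ * X.dist b ω ^ p.α) *
        (if b' ≠ b ∧ X.transmits b' ω = true then ENNReal.ofReal (X.received p b' ω) else 0) := by
    intro b'
    by_cases hb : b' = b
    · simp [hb]
    · rw [if_neg hb]
      simp only [ne_eq, hb, not_false_eq_true, true_and, mul_ite, mul_zero]
      rfl
  rw [tsum_congr hsplit, ENNReal.tsum_add, ENNReal.tsum_mul_left, expNeg_add]
  by_cases h : ω ∈ {ω | ∀ b', b' ≠ b → ¬ (X.stores n b' ω = true ∧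
      X.dist b' ω < p.ratio b.1 b'.1 * X.dist b ω)}
  · rw [Set.indicator_of_mem h]
    have h0 : ∀ b', (if b' ≠ b ∧ (X.stores n b' ω = true ∧
        X.dist b' ω < p.ratio b.1 b'.1 * X.dist b ω) then (⊤ : ℝ≥0∞) else 0) = 0 :=
      fun b' => if_neg fun hh => h b' hh.1 hh.2
    simp_rw [h0]
    simp [otherPower]
  · rw [Set.indicator_of_notMem h]
    have h1 : ∃ b', b' ≠ b ∧ (X.stores n b' ω = true ∧
        X.dist b' ω < p.ratio b.1 b'.1 * X.dist b ω) := by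
      simp only [Set.mem_ofPred_eq] at h
      push Not at h
      exact h
    obtain ⟨b', hb'⟩ := h1
    have htop : (∑' b', if b' ≠ b ∧ (X.stores n b' ω = true ∧
        X.dist b' ω < p.ratio b.1 b'.1 * X.dist b ω) then (⊤ : ℝ≥0∞) else 0) = ⊤ :=
      ENNReal.tsum_eq_top_of_eq_top ⟨b', if_pos hb'⟩
    rw [htop, expNeg_top, zero_mul]

/-! ### Measurability -/

section Measurability

variable {m : MeasurableSpace Ω}

/-- The σ-algebra is a parameter throughout this section: independence arguments need measurability
with respect to σ-algebras generated by only some of the sources. -/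
lemma measurable_dist (hpos : ∀ k j, Measurable (X.pos k j)) (b : Station) :
    Measurable (X.dist b) := (hpos b.1 b.2).norm

lemma measurableSet_strongest (hpos : ∀ k j, Measurable (X.pos k j)) {n : ℕ}
    (hst : ∀ b, Measurable (X.stores n b)) (b : Station) :
    MeasurableSet {ω | b ∈ X.strongest p n ω} := by
  have hc : ∀ b, MeasurableSet {ω | b ∈ X.candidates n ω} := by
    intro b
    have : {ω | b ∈ X.candidates n ω} = X.stores n b ⁻¹' {true} := by
      ext ω
      exact mem_candidates_iff
    rw [this]
    exact hst b (measurableSet_singleton _)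
  have hd := fun b => measurable_dist hpos b
  have : {ω | b ∈ X.strongest p n ω} = {ω | b ∈ X.candidates n ω} ∩ ⋂ b' : Station,
      ({ω | b' ∈ X.candidates n ω}ᶜ ∪
        {ω | p.P b'.1 * X.dist b' ω ^ (-p.α) ≤ p.P b.1 * X.dist b ω ^ (-p.α)}) := by
    ext ω
    simp only [strongest, Set.mem_ofPred_eq, Set.mem_inter_iff, Set.mem_iInter, Set.mem_union,
      Set.mem_compl_iff, imp_iff_not_or]
  rw [this]
  refine (hc b).inter (MeasurableSet.iInter fun b' => (hc b').compl.union ?_)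
  exact measurableSet_le (((hd b').pow_const _).const_mul _) (((hd b).pow_const _).const_mul _)

lemma measurable_serving (hpos : ∀ k j, Measurable (X.pos k j)) {n : ℕ}
    (hst : ∀ b, Measurable (X.stores n b)) : Measurable (X.serving p n) := by
  have hs := fun b => measurableSet_strongest (p := p) hpos hst b
  refine measurable_to_countable' fun b => ?_
  have hne : MeasurableSet {ω | (X.strongest p n ω).Nonempty} := by
    have : {ω | (X.strongest p n ω).Nonempty} = ⋃ b, {ω | b ∈ X.strongest p n ω} := by
      ext ω
      simp [Set.Nonempty]
    rw [this]
    exact MeasurableSet.iUnion hs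
  have : X.serving p n ⁻¹' {b} = ({ω | (X.strongest p n ω).Nonempty}ᶜ ∩ {_ω | b = (0, 0)}) ∪
      ({ω | b ∈ X.strongest p n ω} ∩ ⋂ b' : Station,
        ({ω | b' ∈ X.strongest p n ω}ᶜ ∪ {_ω | Encodable.encode b ≤ Encodable.encode b'})) := by
    ext ω
    simp only [Set.mem_preimage, Set.mem_singleton_iff, Set.mem_union, Set.mem_inter_iff,
      Set.mem_compl_iff, Set.mem_ofPred_eq, Set.mem_iInter]
    by_cases h : (X.strongest p n ω).Nonempty
    · rw [serving, dif_pos h]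
      simp only [h, not_true_eq_false, false_and, false_or]
      constructor
      · rintro rfl
        refine ⟨Function.argminOn_mem _ _ _, fun b' => ?_⟩
        by_cases hb' : b' ∈ X.strongest p n ω
        · exact Or.inr (Function.argminOn_le _ _ hb')
        · exact Or.inl hb'
      · rintro ⟨h1, h2⟩
        have h3 := Function.argminOn_le (Encodable.encode : Station → ℕ) _ h1
        have h4 := (h2 _).resolve_left
          (not_not.2 (Function.argminOn_mem (Encodable.encode : Station → ℕ) _ h))
        exact Encodable.encode_injective (le_antisymm h3 h4)
    · rw [serving, dif_neg h]
      have h' : b ∉ X.strongest p n ω := fun hb => h ⟨b, hb⟩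
      simp only [h, h', not_false_eq_true, true_and, false_and, or_false]
      exact eq_comm
  rw [this]
  refine (hne.compl.inter (MeasurableSet.const _)).union ((hs b).inter
    (MeasurableSet.iInter fun b' => (hs b').compl.union (MeasurableSet.const _)))

/-- The gain of `b` itself is not required, which is what allows it to be averaged independently of
the interference seen from `b`. -/
lemma measurable_otherPower (hpos : ∀ k j, Measurable (X.pos k j)) (b : Station)
    (hf : ∀ b', b' ≠ b → Measurable (X.fade b')) (ht : ∀ b', Measurable (X.transmits b')) :
    Measurable (X.otherPower p b) := by
  refine Measurable.tsum fun b' => ?_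
  by_cases hb : b' = b
  · simp [hb]
  · have h1 : Measurable (X.received p b') :=
      ((hf b' hb).const_mul _).mul ((measurable_dist hpos b').pow_const _)
    have h2 : MeasurableSet {ω | X.transmits b' ω = true} := ht b' (measurableSet_singleton _)
    have h3 : MeasurableSet {ω | b' ≠ b ∧ X.transmits b' ω = true} :=
      (MeasurableSet.const _).inter h2
    exact Measurable.ite h3 h1.ennreal_ofReal measurable_const

end Measurability

variable [mΩ : MeasurableSpace Ω] {μ : Measure Ω} [IsProbabilityMeasure μ]

namespace Law

lemma measurable_stores' (hX : X.Law p μ) (n : ℕ) (b : Station) : Measurable (X.stores n b) :=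
  (Elements.measurable_stores (S := Set.univ) (fun _ => Set.mem_univ _) n).mono
    (hX.sigmaOf_le _) le_rfl

lemma measurable_transmits (hX : X.Law p μ) (b : Station) : Measurable (X.transmits b) :=
  (Elements.measurable_transmits (S := Set.univ) (fun _ => Set.mem_univ _)).mono
    (hX.sigmaOf_le _) le_rfl

/-- The strongest stations of tier `k`, with their distance and the Laplace transform of the
interference and noise. -/
theorem lintegral_tsum_strongest (hX : X.Law p μ) (hp : p.Valid) (n : ℕ) (k : Tier) {δ s : ℝ}
    (hδ : 0 ≤ δ) (hs : 0 ≤ s) {f : ℝ → ℝ≥0∞} (hf : Measurable f) :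
    ∫⁻ ω, ∑' j, {ω | (k, j) ∈ X.strongest p n ω}.indicator (fun ω => f (X.dist (k, j) ω) *
        expNeg (ENNReal.ofReal (δ / p.P k * X.dist (k, j) ω ^ p.α) *
          (X.otherPower p (k, j) ω + ENNReal.ofReal s))) ω ∂μ =
      ENNReal.ofReal (p.lam k * Params.candProb (storeProb p n) k) *
        ∫⁻ u in Set.Ioi (0 : ℝ), f √(u / Real.pi) * ENNReal.ofReal
          (Real.exp (-(δ / p.P k * s * √(u / Real.pi) ^ p.α + p.rateK (storeProb p n) k δ * u))) := by
  have hθ : 0 ≤ δ / p.P k := div_nonneg hδ (hp.P_pos k).le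
  have hmain := Params.lintegral_tsum_assoc hp (hX.storeProb_nonneg n) (hX.storeProb_le_one n)
    hX.pa_nonneg hX.pa_le_one (hX.isMarkedPoisson hp n) k hδ
    (f := fun z => f z * ENNReal.ofReal (Real.exp (-(δ / p.P k * s * z ^ p.α)))) (by fun_prop)
  refine Eq.trans (lintegral_congr_ae ?_) (hmain.trans ?_)
  · filter_upwards [hX.ae_dist_pos hp] with ω hd
    refine tsum_congr fun j => ?_
    have hw := expNeg_tsum_weight (X := X) (p := p) n (k, j) (δ / p.P k) ω
    refine Eq.trans ?_ (congrArg (_ * ·) hw.symm)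
    have hmem : ω ∈ {ω | (k, j) ∈ X.strongest p n ω} ↔ X.stores n (k, j) ω = true ∧
        ∀ b', b' ≠ (k, j) → ¬ (X.stores n b' ω = true ∧
          X.dist b' ω < p.ratio k b'.1 * X.dist (k, j) ω) := mem_strongest_iff hp hd
    by_cases h1 : (X.stores n (k, j) ω = true)
    · by_cases h2 : ∀ b', b' ≠ (k, j) → ¬ (X.stores n b' ω = true ∧
          X.dist b' ω < p.ratio k b'.1 * X.dist (k, j) ω)
      · rw [Set.indicator_of_mem (hmem.2 ⟨h1, h2⟩), Set.indicator_of_mem (by exact h2)]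
        have hd0 : (0 : ℝ) ≤ X.dist (k, j) ω ^ p.α := Real.rpow_nonneg (hd _).le _
        have h3 : ENNReal.ofReal (δ / p.P k * X.dist (k, j) ω ^ p.α) * ENNReal.ofReal s =
            ENNReal.ofReal (δ / p.P k * s * X.dist (k, j) ω ^ p.α) := by
          rw [← ENNReal.ofReal_mul (mul_nonneg hθ hd0), mul_right_comm]
        rw [mul_add, expNeg_add, h3, expNeg_ofReal (mul_nonneg (mul_nonneg hθ hs) hd0)]
        have h4 : (X.mark n (k, j) ω).1 = true := h1
        rw [if_pos h4, mul_comm (expNeg _), ← mul_assoc]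
        rfl
      · rw [Set.indicator_of_notMem (fun h => h2 (hmem.1 h).2), Set.indicator_of_notMem
          (by exact h2), mul_zero]
    · have h4 : ¬ (X.mark n (k, j) ω).1 = true := h1
      rw [Set.indicator_of_notMem (fun h => h1 (hmem.1 h).1), if_neg h4, zero_mul]
  · congr 1
    refine setLIntegral_congr_fun measurableSet_Ioi fun u hu => ?_
    rw [mul_assoc, ← ENNReal.ofReal_mul (Real.exp_pos _).le, ← Real.exp_add, neg_add]

end Law

end Elements

/-! ### Association probabilities and rate thresholds. -/

namespace Params

variable {p : Params}

/-- Probability of association with tier `k`, if a helper stores the content with probability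
`c`. -/
def share (p : Params) (c : ℝ) (k : Tier) : ℝ := p.lam k * candProb c k / p.rateK c k 0

lemma rateK_zero_mul (hp : p.Valid) (c : ℝ) (k : Tier) : p.rateK c k 0 * p.P k ^ (2 / p.α) =
    ∑ i : Tier, p.lam i * candProb c i * p.P i ^ (2 / p.α) := by
  rw [rateK_zero hp, Finset.sum_mul]
  refine Finset.sum_congr rfl fun i _ => ?_
  have hk := Real.rpow_pos_of_pos (hp.P_pos k) (2 / p.α)
  rw [Real.div_rpow (hp.P_pos i).le (hp.P_pos k).le]
  field_simp

lemma share_eq (hp : p.Valid) (c : ℝ) (k : Tier) : p.share c k =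
    p.lam k * candProb c k * p.P k ^ (2 / p.α) /
      ∑ i : Tier, p.lam i * candProb c i * p.P i ^ (2 / p.α) := by
  have hk := Real.rpow_pos_of_pos (hp.P_pos k) (2 / p.α)
  rw [← rateK_zero_mul hp c k, share, mul_div_mul_right _ _ hk.ne']

lemma share_nonneg (hp : p.Valid) {c : ℝ} (hc0 : 0 ≤ c) (k : Tier) : 0 ≤ p.share c k :=
  div_nonneg (mul_nonneg (hp.lam_pos k).le (candProb_nonneg hc0 k)) (rateK_zero_pos hp hc0 k).le

lemma sum_share (hp : p.Valid) {c : ℝ} (hc0 : 0 ≤ c) : ∑ k : Tier, p.share c k = 1 := by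
  simp_rw [share_eq hp]
  rw [← Finset.sum_div, div_self]
  rw [← rateK_zero_mul hp c 0]
  exact (mul_pos (rateK_zero_pos hp hc0 0) (Real.rpow_pos_of_pos (hp.P_pos 0) _)).ne'

lemma δ_nonneg (hp : p.Valid) {r : ℝ} (hr : 0 ≤ r) (l : ℕ) : 0 ≤ p.δ r l := by
  have := hp.W_pos
  have : (1 : ℝ) ≤ 2 ^ (((l : ℝ) + 1) * r / p.W) :=
    Real.one_le_rpow one_le_two (by positivity)
  unfold δ
  linarith

end Params

namespace Elements

variable {Ω : Type*} {X : Elements Ω} {p : Params} [mΩ : MeasurableSpace Ω] {μ : Measure Ω}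
  [IsProbabilityMeasure μ]

/-- If the strongest station is unique, at most one term survives. This translates sums over the
point process, which the Mecke formula computes, into quantities of the serving station. -/
lemma tsum_indicator_strongest {n : ℕ} {ω : Ω}
    (hω : ∀ b, b ∈ X.strongest p n ω ↔ b = X.serving p n ω) (k : Tier) {Q : Station → Ω → Prop}
    (g : Station → Ω → ℝ≥0∞) :
    ∑' j, {ω | (k, j) ∈ X.strongest p n ω ∧ Q (k, j) ω}.indicator (g (k, j)) ω =
      {ω | X.servingTier p n ω = k ∧ Q (X.serving p n ω) ω}.indicator
        (fun ω => g (X.serving p n ω) ω) ω := by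
  by_cases hk : X.servingTier p n ω = k
  · have hs : X.serving p n ω = (k, (X.serving p n ω).2) := Prod.ext hk rfl
    rw [tsum_eq_single (X.serving p n ω).2]
    · rw [← hs]
      have hmem := (hω _).2 rfl
      by_cases hQ : Q (X.serving p n ω) ω
      · rw [Set.indicator_of_mem (by exact ⟨hmem, hQ⟩), Set.indicator_of_mem (by exact ⟨hk, hQ⟩)]
      · rw [Set.indicator_of_notMem (fun h => hQ h.2), Set.indicator_of_notMem (fun h => hQ h.2)]
    · intro j hj
      refine Set.indicator_of_notMem (fun h => hj ?_) _
      exact congrArg Prod.snd ((hω _).1 h.1)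
  · rw [Set.indicator_of_notMem (fun h => hk h.1), ENNReal.tsum_eq_zero]
    intro j
    refine Set.indicator_of_notMem (fun h => hk ?_) _
    exact (congrArg Prod.fst ((hω _).1 h.1)).symm

namespace Law

/-- The number of strongest stations is almost surely at least one, while its mean is the sum of the
shares of the tiers, hence one. So it equals one almost surely, and ties need no separate treatment.
-/
lemma ae_mem_strongest_iff (hX : X.Law p μ) (hp : p.Valid) (n : ℕ) :
    ∀ᵐ ω ∂μ, ∀ b, b ∈ X.strongest p n ω ↔ b = X.serving p n ω := by
  have hne : ∀ᵐ ω ∂μ, (X.strongest p n ω).Nonempty := by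
    filter_upwards [hX.ae_dist_pos hp, hX.ae_finite_ball hp] with ω h1 h2
    exact strongest_nonempty hp n h1 h2
  let N : Ω → ℝ≥0∞ := fun ω => ∑' b : Station, {ω | b ∈ X.strongest p n ω}.indicator 1 ω
  have hset := fun b => measurableSet_strongest (X := X) (p := p) (n := n) hX.measurable_pos
    (hX.measurable_stores' n) b
  have hN : Measurable N := Measurable.tsum fun b => measurable_one.indicator (hset b)
  have hint : ∫⁻ ω, N ω ∂μ = 1 := by
    have h1 : ∀ ω, N ω = ∑ k : Tier, ∑' j, {ω | (k, j) ∈ X.strongest p n ω}.indicator 1 ω := by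
      intro ω
      simp only [N]
      rw [ENNReal.tsum_prod', tsum_fintype]
    simp_rw [h1]
    rw [lintegral_finsetSum _ fun k _ => Measurable.tsum fun j =>
      measurable_one.indicator (hset (k, j))]
    have h2 : ∀ k, ∫⁻ ω, ∑' j, {ω | (k, j) ∈ X.strongest p n ω}.indicator 1 ω ∂μ =
        ENNReal.ofReal (p.share (storeProb p n) k) := by
      intro k
      have h := hX.lintegral_tsum_strongest hp n k (δ := 0) (s := 0) le_rfl le_rfl
        (f := fun _ => 1) measurable_const
      simp only [zero_div, zero_mul, ENNReal.ofReal_zero, expNeg_zero, mul_one, zero_add,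
        one_mul] at h
      rw [lintegral_exp_neg_Ioi (Params.rateK_zero_pos hp (hX.storeProb_nonneg n) k),
        ← ENNReal.ofReal_mul (mul_nonneg (hp.lam_pos k).le
          (Params.candProb_nonneg (hX.storeProb_nonneg n) k)), ← div_eq_mul_inv] at h
      exact h
    simp_rw [h2]
    rw [← ENNReal.ofReal_sum_of_nonneg fun k _ => Params.share_nonneg hp (hX.storeProb_nonneg n) k,
      Params.sum_share hp (hX.storeProb_nonneg n), ENNReal.ofReal_one]
  have hle : (fun _ => (1 : ℝ≥0∞)) ≤ᵐ[μ] N := by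
    filter_upwards [hne] with ω ⟨b, hb⟩
    refine le_trans ?_ (ENNReal.le_tsum b)
    rw [Set.indicator_of_mem (by exact hb)]
    exact le_rfl
  have heq := ae_eq_of_ae_le_of_lintegral_le hle (by simp) hN.aemeasurable (by simp [hint])
  filter_upwards [heq, hne] with ω h1 h2 b
  have hs := serving_mem_strongest h2
  refine ⟨fun hb => ?_, fun hb => hb ▸ hs⟩
  by_contra hcon
  have h3 : ∑ b' ∈ {b, X.serving p n ω}, {ω | b' ∈ X.strongest p n ω}.indicator 1 ω ≤ N ω :=
    ENNReal.sum_le_tsum _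
  rw [Finset.sum_pair hcon, ← h1, Set.indicator_of_mem (by exact hb),
    Set.indicator_of_mem (by exact hs)] at h3
  norm_num at h3

end Law

/-! ### The success event -/

/-- The success event for the threshold `δ`, seen from the station `b`. -/
def exceeds (X : Elements Ω) (p : Params) (δ s : ℝ) (b : Station) (ω : Ω) : Prop :=
  ENNReal.ofReal (δ / p.P b.1 * X.dist b ω ^ p.α) * (X.otherPower p b ω + ENNReal.ofReal s) ≤
    ENNReal.ofReal (X.fade b ω)

/-- Positive gains make the terms nonnegative. Convergence is not needed: a divergent real sum and
the real part of `⊤` are both zero by convention. -/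
lemma interference_eq (hp : p.Valid) {n : ℕ} {ω : Ω} (hf : ∀ b, 0 < X.fade b ω) :
    X.interference p n ω = (X.otherPower p (X.serving p n ω) ω).toReal := by
  rw [otherPower, ENNReal.tsum_toReal_eq]
  · refine tsum_congr fun b => ?_
    have h : X.transmits b ω = true ↔ (b.1 = 0 ∨ X.active b.2 ω = true) := by simp [transmits]
    simp only [h]
    split_ifs
    · rw [ENNReal.toReal_ofReal (Law.received_nonneg hp (hf b).le)]
    · rfl
  · intro b
    split_ifs <;> simp

/-- There is always another MBS, and MBSs always transmit. Without noise this keeps the denominator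
of the ratio away from zero. -/
lemma otherPower_pos (hp : p.Valid) (b : Station) {ω : Ω} (hf : ∀ b, 0 < X.fade b ω)
    (hd : ∀ b, 0 < X.dist b ω) : 0 < X.otherPower p b ω := by
  obtain ⟨b', hb', h0⟩ : ∃ b' : Station, b' ≠ b ∧ b'.1 = 0 :=
    ⟨(0, b.2 + 1), fun h => by simpa using congrArg Prod.snd h, rfl⟩
  refine lt_of_lt_of_le ?_ (ENNReal.le_tsum b')
  have ht : X.transmits b' ω = true := by simp [transmits, h0]
  rw [if_pos ⟨hb', ht⟩]
  exact ENNReal.ofReal_pos.2 (Law.received_pos hp (hf b') (hd b'))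

lemma otherPower_ne_top {b : Station} {ω : Ω}
    (h : ∑' b, ENNReal.ofReal (X.received p b ω) ≠ ⊤) : X.otherPower p b ω ≠ ⊤ := by
  refine ne_top_of_le_ne_top h (ENNReal.tsum_le_tsum fun b' => ?_)
  split_ifs
  · exact le_rfl
  · exact zero_le

/-- The rate is at least `r` iff the ratio is at least `δ = 2^{(l+1) r / W} - 1`, and this is solved
for the gain of the serving station. The interference has to be positive and finite, since otherwise
the default values of division and of `toReal` would interfere. -/
lemma le_rate_iff (hp : p.Valid) {n : ℕ} {ω : Ω} (hf : ∀ b, 0 < X.fade b ω)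
    (hd : ∀ b, 0 < X.dist b ω) (hI : ∑' b, ENNReal.ofReal (X.received p b ω) ≠ ⊤) {r s : ℝ}
    (hr : 0 ≤ r) (hs : 0 ≤ s) {l : ℕ} (hl : X.servingLoad p n ω = l + 1) :
    r ≤ X.rate p s n ω ↔ X.exceeds p (p.δ r l) s (X.serving p n ω) ω := by
  set b := X.serving p n ω with hb
  set I := (X.otherPower p b ω).toReal with hIdef
  have hI0 : 0 < I := ENNReal.toReal_pos (otherPower_pos hp b hf hd).ne' (otherPower_ne_top hI)
  have hW := hp.W_pos
  have hP := hp.P_pos b.1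
  have hdb := hd b
  have hfb := hf b
  have hδ := p.δ_nonneg hp hr l
  have hsinr : X.sinr p s n ω = X.received p b ω / (I + s) := by
    rw [sinr, interference_eq hp hf]
  have hrec : 0 < X.received p b ω := Law.received_pos hp hfb hdb
  have hIs : 0 < I + s := by linarith
  have hex : X.exceeds p (p.δ r l) s b ω ↔
      p.δ r l / p.P b.1 * X.dist b ω ^ p.α * (I + s) ≤ X.fade b ω := by
    have h1 : X.otherPower p b ω = ENNReal.ofReal I :=
      (ENNReal.ofReal_toReal (otherPower_ne_top hI)).symm
    rw [exceeds, h1, ← ENNReal.ofReal_add hI0.le hs, ← ENNReal.ofReal_mul (by positivity),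
      ENNReal.ofReal_le_ofReal_iff hfb.le]
  rw [hex, rate, hl, hsinr]
  have hpow : r ≤ p.W / ((l + 1 : ℕ) : ℝ) * Real.logb 2 (1 + X.received p b ω / (I + s)) ↔
      ((l : ℝ) + 1) * r / p.W ≤ Real.logb 2 (1 + X.received p b ω / (I + s)) := by
    have hl0 : (0 : ℝ) < (l : ℝ) + 1 := by positivity
    push_cast
    rw [div_mul_eq_mul_div, le_div_iff₀ hl0, div_le_iff₀ hW, mul_comm r, mul_comm p.W]
  rw [hpow, Real.le_logb_iff_rpow_le one_lt_two (by positivity), ← sub_le_iff_le_add',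
    le_div_iff₀ hIs]
  change p.δ r l * (I + s) ≤ p.P b.1 * X.fade b ω * X.dist b ω ^ (-p.α) ↔ _
  have hda : 0 < X.dist b ω ^ p.α := Real.rpow_pos_of_pos hdb _
  rw [Real.rpow_neg hdb.le, ← div_eq_mul_inv, le_div_iff₀ hda, div_mul_eq_mul_div,
    div_mul_eq_mul_div, div_le_iff₀ hP]
  constructor <;> intro h <;> linarith

namespace Law

/-- Association with tier `k`, load `l + 1` and success for the threshold `δ`. -/
theorem lintegral_tsum_exceeds (hX : X.Law p μ) (hp : p.Valid) (n : ℕ) (k : Tier) (l : ℕ) {δ s : ℝ}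
    (hδ : 0 ≤ δ) (hs : 0 ≤ s) {f : ℝ → ℝ≥0∞} (hf : Measurable f) :
    ∫⁻ ω, ∑' j, {ω | (k, j) ∈ X.strongest p n ω ∧ X.load k ω = l + 1 ∧
        X.exceeds p δ s (k, j) ω}.indicator (fun ω => f (X.dist (k, j) ω)) ω ∂μ =
      ENNReal.ofReal (p.loadPMF k l) *
        (ENNReal.ofReal (p.lam k * Params.candProb (storeProb p n) k) *
          ∫⁻ u in Set.Ioi (0 : ℝ), f √(u / Real.pi) * ENNReal.ofReal (Real.exp
            (-(δ / p.P k * s * √(u / Real.pi) ^ p.α + p.rateK (storeProb p n) k δ * u)))) := by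
  -- The level that the gain of `(k, j)` has to reach. It involves only the gains of other stations,
  -- so averaging over the gain of `(k, j)` turns the event into `expNeg (T j)`.
  let T : ℕ → Ω → ℝ≥0∞ := fun j ω => ENNReal.ofReal (δ / p.P k * X.dist (k, j) ω ^ p.α) *
    (X.otherPower p (k, j) ω + ENNReal.ofReal s)
  let g : ℕ → Ω → ℝ≥0∞ := fun j =>
    {ω | (k, j) ∈ X.strongest p n ω}.indicator fun ω => f (X.dist (k, j) ω)
  have hpos : ∀ S : Set Source, (∀ k, Source.pos k ∈ S) →
      ∀ k j, Measurable[X.sigmaOf S] (X.pos k j) := fun S hS k j =>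
    Elements.measurable_pos (hS k) j
  have hdm : ∀ S : Set Source, (∀ k, Source.pos k ∈ S) → ∀ j,
      Measurable[X.sigmaOf S] (X.dist (k, j)) := fun S hS j =>
    measurable_dist (m := X.sigmaOf S) (hpos S hS) (k, j)
  have hgm : ∀ S : Set Source, (∀ k, Source.pos k ∈ S) → (∀ j, Source.cache j ∈ S) → ∀ j,
      Measurable[X.sigmaOf S] (g j) := fun S hS hc j =>
    Measurable.indicator (m := X.sigmaOf S) (hf.comp (hdm S hS j))
      (measurableSet_strongest (m := X.sigmaOf S) (hpos S hS)
        (fun b => Elements.measurable_stores (fun _ => hc _) n) (k, j))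
  have hTm : ∀ S : Set Source, (∀ k, Source.pos k ∈ S) → (∀ j, Source.active j ∈ S) → ∀ j,
      (∀ b, b ≠ (k, j) → Source.fade b ∈ S) → Measurable[X.sigmaOf S] (T j) := fun S hS ha j hfa =>
    Measurable.mul (m := X.sigmaOf S)
      (Measurable.ennreal_ofReal (((hdm S hS j).pow_const _).const_mul _))
      (Measurable.add_const (m := X.sigmaOf S) (measurable_otherPower (m := X.sigmaOf S) (hpos S hS)
        (k, j) (fun b hb => Elements.measurable_fade (hfa b hb))
        (fun b => Elements.measurable_transmits (fun _ => ha _))) _)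
  have hset : MeasurableSet {q : (ℝ≥0∞ × ℝ≥0∞) × ℝ | q.1.2 ≤ ENNReal.ofReal q.2} :=
    measurableSet_le (by fun_prop) (by fun_prop)
  -- the fading gain of the station
  have hfade : ∀ j, ∫⁻ ω, g j ω * {ω | T j ω ≤ ENNReal.ofReal (X.fade (k, j) ω)}.indicator 1 ω ∂μ =
      ∫⁻ ω, g j ω * expNeg (T j ω) ∂μ := by
    intro j
    have hG : Measurable fun q : (ℝ≥0∞ × ℝ≥0∞) × ℝ =>
        q.1.1 * {q : (ℝ≥0∞ × ℝ≥0∞) × ℝ | q.1.2 ≤ ENNReal.ofReal q.2}.indicator 1 q :=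
      (by fun_prop : Measurable fun q : (ℝ≥0∞ × ℝ≥0∞) × ℝ => q.1.1).mul
        (measurable_one.indicator hset)
    have hind : Indep (MeasurableSpace.comap (X.fade (k, j)) inferInstance)
        (X.sigmaOf {Source.fade (k, j)}ᶜ) μ :=
      indep_of_indep_of_le_left (hX.indep_sigmaOf disjoint_compl_right)
        (sigma_le_sigmaOf (X := X) (Set.mem_singleton (Source.fade (k, j))))
    have hη : Measurable[X.sigmaOf {Source.fade (k, j)}ᶜ] fun ω => (g j ω, T j ω) :=
      Measurable.prodMk (m := X.sigmaOf {Source.fade (k, j)}ᶜ) (hgm _ (by simp) (by simp) j)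
        (hTm _ (by simp) (by simp) j (by simp))
    have h := lintegral_indep_subst (hX.sigmaOf_le _) hη (hX.measurable_fade (k, j)) hind hG
    refine h.trans (lintegral_congr fun ω => ?_)
    rw [hX.fade_law]
    have hm : MeasurableSet {y : ℝ | T j ω ≤ ENNReal.ofReal y} :=
      measurableSet_le measurable_const ENNReal.measurable_ofReal
    have h1 : Measurable ({y : ℝ | T j ω ≤ ENNReal.ofReal y}.indicator (1 : ℝ → ℝ≥0∞)) :=
      measurable_one.indicator hm
    refine (lintegral_const_mul (g j ω) h1).trans ?_
    rw [lintegral_indicator_one hm, expMeasure_le_ofReal]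
  -- the load
  have hload : ∀ j, ∫⁻ ω, {ω | (k, j) ∈ X.strongest p n ω ∧ X.load k ω = l + 1 ∧
        X.exceeds p δ s (k, j) ω}.indicator (fun ω => f (X.dist (k, j) ω)) ω ∂μ =
      ENNReal.ofReal (p.loadPMF k l) * ∫⁻ ω, g j ω * expNeg (T j ω) ∂μ := by
    intro j
    have hms : MeasurableSet[X.sigmaOf {Source.load k}] {ω | X.load k ω = l + 1} :=
      sigma_le_sigmaOf (X := X) (Set.mem_singleton (Source.load k)) _
        ⟨{l + 1}, trivial, rfl⟩
    have hgT : Measurable[X.sigmaOf {Source.load k}ᶜ] fun ω =>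
        g j ω * {ω | T j ω ≤ ENNReal.ofReal (X.fade (k, j) ω)}.indicator 1 ω :=
      Measurable.mul (m := X.sigmaOf {Source.load k}ᶜ) (hgm _ (by simp) (by simp) j)
        (Measurable.indicator (m := X.sigmaOf {Source.load k}ᶜ) measurable_const
          (measurableSet_le (mδ := X.sigmaOf {Source.load k}ᶜ)
            (hTm _ (by simp) (by simp) j (by simp))
            (Measurable.ennreal_ofReal (Elements.measurable_fade (by simp)))))
    have h := lintegral_mul_eq_lintegral_mul_lintegral_of_independent_measurableSpace
      (hX.sigmaOf_le {Source.load k}) (hX.sigmaOf_le {Source.load k}ᶜ)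
      (hX.indep_sigmaOf disjoint_compl_right)
      (Measurable.indicator (m := X.sigmaOf {Source.load k}) (f := (1 : Ω → ℝ≥0∞))
        measurable_const hms) hgT
    rw [hfade, lintegral_indicator_one (hX.sigmaOf_le _ _ hms), hX.measure_load] at h
    rw [← h]
    refine lintegral_congr fun ω => ?_
    by_cases h1 : (k, j) ∈ X.strongest p n ω
    · by_cases h2 : X.load k ω = l + 1
      · by_cases h3 : X.exceeds p δ s (k, j) ω
        · have h3' : T j ω ≤ ENNReal.ofReal (X.fade (k, j) ω) := h3
          simp [g, Set.indicator, h1, h2, h3, h3']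
        · have h3' : ¬ T j ω ≤ ENNReal.ofReal (X.fade (k, j) ω) := h3
          simp [g, Set.indicator, h3, h3']
      · simp [Set.indicator, h2]
    · simp [g, Set.indicator, h1]
  have hgm' : ∀ j, Measurable (g j) := fun j =>
    (hgm Set.univ (fun _ => trivial) (fun _ => trivial) j).mono (hX.sigmaOf_le _) le_rfl
  have hTm' : ∀ j, Measurable (T j) := fun j =>
    (hTm Set.univ (fun _ => trivial) (fun _ => trivial) j (fun _ _ => trivial)).mono
      (hX.sigmaOf_le _) le_rfl
  rw [lintegral_tsum, tsum_congr hload, ENNReal.tsum_mul_left, ← lintegral_tsum,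
    ← hX.lintegral_tsum_strongest hp n k hδ hs hf]
  · congr 1
    refine lintegral_congr fun ω => tsum_congr fun j => ?_
    by_cases h1 : (k, j) ∈ X.strongest p n ω
    · simp [g, T, Set.indicator, h1]
    · simp [g, Set.indicator, h1]
  · exact fun j => ((hgm' j).mul (measurable_expNeg.comp (hTm' j))).aemeasurable
  · intro j
    have h1 : MeasurableSet {ω | (k, j) ∈ X.strongest p n ω} :=
      measurableSet_strongest hX.measurable_pos (hX.measurable_stores' n) (k, j)
    have h2 : MeasurableSet {ω | X.load k ω = l + 1} :=
      hX.measurable_load k (measurableSet_singleton _)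
    have h3 : MeasurableSet {ω | X.exceeds p δ s (k, j) ω} :=
      measurableSet_le (hTm' j) (hX.measurable_fade _).ennreal_ofReal
    exact ((hf.comp (measurable_dist hX.measurable_pos _)).indicator
      (h1.inter (h2.inter h3))).aemeasurable

end Law

end Elements

/-! ### The exponent of the conditional probability of a rate. -/

namespace Params

variable {p : Params}

lemma measurable_δ {β : Type*} [MeasurableSpace β] {f : β → ℝ} {g : β → ℕ} (hf : Measurable f)
    (hg : Measurable g) : Measurable fun x => p.δ (f x) (g x) := by
  have h : Measurable fun x => ((g x : ℕ) : ℝ) := measurable_from_top.comp hg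
  unfold δ
  exact (((h.add_const 1).mul hf).div_const _).const_pow _ |>.sub_const _

lemma measurable_rateK_comp {β : Type*} [MeasurableSpace β] (c : ℝ) {k : β → Tier} {x : β → ℝ}
    (hk : Measurable k) (hx : Measurable x) : Measurable fun y => p.rateK c (k y) (x y) := by
  have h : Measurable fun q : Tier × ℝ => p.rateK c q.1 q.2 :=
    measurable_from_prod_countable_right fun k => measurable_rateK c k
  have h2 := h.comp (hk.prodMk hx)
  simpa only [Function.comp_def] using h2

/-- Exponent of the conditional probability of the rate `r`, given the serving tier, the serving
distance and the load. -/
def successExponent (p : Params) (c s r : ℝ) (q : Tier × ℝ × ℕ) : ℝ :=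
  p.δ r (q.2.2 - 1) / p.P q.1 * s * q.2.1 ^ p.α +
    (p.rateK c q.1 (p.δ r (q.2.2 - 1)) - p.rateK c q.1 0) * (Real.pi * q.2.1 ^ 2)

lemma measurable_successExponent {β : Type*} [MeasurableSpace β] (c s : ℝ) {r : β → ℝ}
    {T : β → Tier × ℝ × ℕ} (hr : Measurable r) (hT : Measurable T) :
    Measurable fun x => p.successExponent c s (r x) (T x) := by
  have hk : Measurable fun x => (T x).1 := hT.fst
  have hz : Measurable fun x => (T x).2.1 := hT.snd.fst
  have hl : Measurable fun x => (T x).2.2 := hT.snd.snd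
  have hl1 : Measurable fun x => (T x).2.2 - 1 := hl.sub_const 1
  have hδ : Measurable fun x => p.δ (r x) ((T x).2.2 - 1) := measurable_δ hr hl1
  have hP : Measurable fun x => p.P (T x).1 := (Measurable.of_discrete (f := p.P)).comp hk
  have hK : Measurable fun x => p.rateK c (T x).1 (p.δ (r x) ((T x).2.2 - 1)) :=
    measurable_rateK_comp c hk hδ
  have hK0 : Measurable fun x => p.rateK c (T x).1 0 :=
    measurable_rateK_comp c hk measurable_const
  unfold successExponent
  exact (((hδ.div hP).mul_const s).mul (hz.pow_const _)).add
    ((hK.sub hK0).mul ((hz.pow_const 2).const_mul _))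

end Params

/-! ### Joint law of serving tier, serving distance, load and rate. -/

namespace Elements

variable {Ω : Type*} {X : Elements Ω} {p : Params}

/-- Serving tier, serving distance and load. -/
def observed (X : Elements Ω) (p : Params) (n : ℕ) (ω : Ω) : Tier × ℝ × ℕ :=
  (X.servingTier p n ω, X.servingDist p n ω, X.servingLoad p n ω)

variable [mΩ : MeasurableSpace Ω] {μ : Measure Ω} [IsProbabilityMeasure μ]

namespace Law

lemma measurable_serving (hX : X.Law p μ) (n : ℕ) : Measurable (X.serving p n) :=
  Elements.measurable_serving hX.measurable_pos (hX.measurable_stores' n)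

lemma measurable_servingTier (hX : X.Law p μ) (n : ℕ) : Measurable (X.servingTier p n) :=
  measurable_fst.comp (hX.measurable_serving n)

/-- A quantity of the serving station is measurable. -/
lemma measurable_apply_serving (hX : X.Law p μ) (n : ℕ) {β : Type*} [MeasurableSpace β]
    {F : Station → Ω → β} (hF : ∀ b, Measurable (F b)) :
    Measurable fun ω => F (X.serving p n ω) ω := by
  have h : Measurable fun q : Station × Ω => F q.1 q.2 := measurable_from_prod_countable_right hF
  exact h.comp ((hX.measurable_serving n).prodMk measurable_id)

lemma measurable_observed (hX : X.Law p μ) (n : ℕ) : Measurable (X.observed p n) := by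
  have h1 : Measurable (X.servingDist p n) :=
    hX.measurable_apply_serving n fun b => measurable_dist hX.measurable_pos b
  have h2 : Measurable (X.servingLoad p n) :=
    hX.measurable_apply_serving (F := fun b => X.load b.1) n fun b => hX.measurable_load b.1
  exact (hX.measurable_servingTier n).prodMk (h1.prodMk h2)

lemma info_le (hX : X.Law p μ) (n : ℕ) : X.info p n ≤ mΩ := (hX.measurable_observed n).comap_le

/-- Only almost everywhere: the real sum of the interference is replaced by the extended one, with
which it agrees when all gains are positive. -/
lemma aemeasurable_rate (hX : X.Law p μ) (hp : p.Valid) (s : ℝ) (n : ℕ) :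
    AEMeasurable (X.rate p s n) μ := by
  have hrec : Measurable fun ω => X.received p (X.serving p n ω) ω :=
    hX.measurable_apply_serving n fun b => ((hX.measurable_fade b).const_mul _).mul
      ((measurable_dist hX.measurable_pos b).pow_const _)
  have hI : Measurable fun ω => (X.otherPower p (X.serving p n ω) ω).toReal :=
    (hX.measurable_apply_serving n fun b => measurable_otherPower hX.measurable_pos b
      (fun b' _ => hX.measurable_fade b') hX.measurable_transmits).ennreal_toReal
  have hL : Measurable fun ω => ((X.servingLoad p n ω : ℕ) : ℝ) :=
    measurable_from_top.comp (measurable_snd.comp (measurable_snd.comp (hX.measurable_observed n)))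
  refine ⟨fun ω => p.W / (X.servingLoad p n ω : ℝ) * Real.logb 2 (1 +
    X.received p (X.serving p n ω) ω / ((X.otherPower p (X.serving p n ω) ω).toReal + s)), ?_, ?_⟩
  · exact (hL.const_div _).mul
      ((Real.measurable_log.comp ((hrec.div (hI.add_const s)).const_add 1)).div_const _)
  · filter_upwards [hX.ae_fade_pos] with ω hf
    rw [rate, sinr, interference_eq hp hf]

lemma measurableSet_tier_load (hX : X.Law p μ) (n : ℕ) (k : Tier) (l : ℕ) :
    MeasurableSet {ω | X.servingTier p n ω = k ∧ X.load k ω = l + 1} :=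
  (hX.measurable_servingTier n (measurableSet_singleton k)).inter
    (hX.measurable_load k (measurableSet_singleton (l + 1)))

/-- Integration over the values of the serving tier and the load. -/
lemma lintegral_eq_tsum_tier_load (hX : X.Law p μ) (hp : p.Valid) (n : ℕ) {h : Ω → ℝ≥0∞}
    (hh : AEMeasurable h μ) : ∫⁻ ω, h ω ∂μ = ∑ k : Tier, ∑' l : ℕ,
      ∫⁻ ω, {ω | X.servingTier p n ω = k ∧ X.load k ω = l + 1}.indicator h ω ∂μ := by
  have hprod : ∀ F : Tier → ℕ → ℝ≥0∞, ∑ k, ∑' l, F k l = ∑' a : Tier × ℕ, F a.1 a.2 :=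
    fun F => by rw [ENNReal.tsum_prod (f := F), tsum_fintype]
  rw [hprod, ← lintegral_tsum]
  · refine lintegral_congr_ae ?_
    filter_upwards [ae_all_iff.2 (hX.ae_load_pos hp)] with ω hl
    rw [tsum_eq_single (X.servingTier p n ω, X.load (X.servingTier p n ω) ω - 1)]
    · rw [Set.indicator_of_mem]
      exact ⟨rfl, (Nat.succ_pred_eq_of_ne_zero (hl (X.servingTier p n ω))).symm⟩
    · rintro ⟨k, l⟩ hkl
      refine Set.indicator_of_notMem (fun hmem => hkl ?_) _
      obtain ⟨h1, h2⟩ := hmem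
      simp only at h1 h2
      rw [h1, h2]
      rfl
  · exact fun a => hh.indicator (hX.measurableSet_tier_load n a.1 a.2)

lemma lintegral_tier_load_exceeds (hX : X.Law p μ) (hp : p.Valid) (n : ℕ) (k : Tier) (l : ℕ)
    {δ s : ℝ} (hδ : 0 ≤ δ) (hs : 0 ≤ s) {f : ℝ → ℝ≥0∞} (hf : Measurable f) :
    ∫⁻ ω, {ω | X.servingTier p n ω = k ∧ X.load k ω = l + 1 ∧
        X.exceeds p δ s (X.serving p n ω) ω}.indicator (fun ω => f (X.servingDist p n ω)) ω ∂μ =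
      ENNReal.ofReal (p.loadPMF k l) *
        (ENNReal.ofReal (p.lam k * Params.candProb (storeProb p n) k) *
          ∫⁻ u in Set.Ioi (0 : ℝ), f √(u / Real.pi) * ENNReal.ofReal (Real.exp
            (-(δ / p.P k * s * √(u / Real.pi) ^ p.α + p.rateK (storeProb p n) k δ * u)))) := by
  rw [← hX.lintegral_tsum_exceeds hp n k l hδ hs hf]
  refine lintegral_congr_ae ?_
  filter_upwards [hX.ae_mem_strongest_iff hp n] with ω hω
  exact (tsum_indicator_strongest hω k (Q := fun b ω => X.load k ω = l + 1 ∧ X.exceeds p δ s b ω)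
    fun b ω => f (X.dist b ω)).symm

/-- The joint law of serving tier, serving distance and load. -/
theorem lintegral_tier_load (hX : X.Law p μ) (hp : p.Valid) (n : ℕ) (k : Tier) (l : ℕ)
    {f : ℝ → ℝ≥0∞} (hf : Measurable f) :
    ∫⁻ ω, {ω | X.servingTier p n ω = k ∧ X.load k ω = l + 1}.indicator
        (fun ω => f (X.servingDist p n ω)) ω ∂μ =
      ENNReal.ofReal (p.loadPMF k l) *
        (ENNReal.ofReal (p.lam k * Params.candProb (storeProb p n) k) *
          ∫⁻ u in Set.Ioi (0 : ℝ), f √(u / Real.pi) * ENNReal.ofReal (Real.exp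
            (-(p.rateK (storeProb p n) k 0 * u)))) := by
  -- With threshold zero and no noise the success event is everything, so the formula specialises to
  -- the law of the observed data.
  have h := hX.lintegral_tier_load_exceeds hp n k l (δ := 0) (s := 0) le_rfl le_rfl hf
  have h0 : ∀ b ω, X.exceeds p 0 0 b ω := fun b ω => by simp [exceeds]
  simpa only [h0, and_true, zero_div, zero_mul, zero_add] using h

/-- The conditional probability of the rate `r`. -/
theorem lintegral_rate (hX : X.Law p μ) (hp : p.Valid) (n : ℕ) {r s : ℝ} (hr : 0 ≤ r)
    (hs : 0 ≤ s) {g : Tier × ℝ × ℕ → ℝ≥0∞} (hg : Measurable g) :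
    ∫⁻ ω, {ω | r ≤ X.rate p s n ω}.indicator (fun ω => g (X.observed p n ω)) ω ∂μ =
      ∫⁻ ω, g (X.observed p n ω) * ENNReal.ofReal
        (Real.exp (-p.successExponent (storeProb p n) s r (X.observed p n ω))) ∂μ := by
  have hT := hX.measurable_observed n
  have hE : Measurable fun q : Tier × ℝ × ℕ => g q * ENNReal.ofReal
      (Real.exp (-p.successExponent (storeProb p n) s r q)) := by
    have := Params.measurable_successExponent (p := p) (storeProb p n) s
      (measurable_const (a := r)) (measurable_id (α := Tier × ℝ × ℕ))
    exact hg.mul this.neg.exp.ennreal_ofReal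
  have hR : NullMeasurableSet {ω | r ≤ X.rate p s n ω} μ :=
    nullMeasurableSet_le aemeasurable_const (hX.aemeasurable_rate hp s n)
  have hgT : Measurable fun ω => g (X.observed p n ω) := hg.comp hT
  have hET : Measurable fun ω => g (X.observed p n ω) * ENNReal.ofReal
      (Real.exp (-p.successExponent (storeProb p n) s r (X.observed p n ω))) := hE.comp hT
  rw [hX.lintegral_eq_tsum_tier_load hp n (hgT.aemeasurable.indicator₀ hR),
    hX.lintegral_eq_tsum_tier_load hp n hET.aemeasurable]
  refine Finset.sum_congr rfl fun k _ => tsum_congr fun l => ?_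
  have hδ := p.δ_nonneg hp hr l
  have hgk : Measurable fun z : ℝ => g (k, z, l + 1) := hg.comp (by fun_prop)
  have hEk : Measurable fun z : ℝ => g (k, z, l + 1) * ENNReal.ofReal
      (Real.exp (-p.successExponent (storeProb p n) s r (k, z, l + 1))) := hE.comp
        (by fun_prop : Measurable fun z : ℝ => ((k, z, l + 1) : Tier × ℝ × ℕ))
  have h1 := hX.lintegral_tier_load_exceeds hp n k l hδ hs hgk
  have h2 := hX.lintegral_tier_load hp n k l hEk
  -- Both sides are brought to the same integral over the area `u`: the success weight, noise term
  -- plus `K(δ) u` in the exponent, factors into `exp(-successExponent)` and the density factor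
  -- `exp(-K(0) u)` of association.
  refine Eq.trans (lintegral_congr_ae ?_) (h1.trans (Eq.trans ?_ (h2.symm.trans ?_)))
  · filter_upwards [hX.ae_fade_pos, hX.ae_dist_pos hp, hX.ae_tsum_received_ne_top hp]
      with ω hf hd hI
    by_cases hkl : X.servingTier p n ω = k ∧ X.load k ω = l + 1
    · have hL : X.servingLoad p n ω = l + 1 := by rw [servingLoad, hkl.1, hkl.2]
      have hiff := le_rate_iff (X := X) (n := n) hp hf hd hI hr hs hL
      rw [Set.indicator_of_mem (by exact hkl)]
      by_cases hrr : r ≤ X.rate p s n ω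
      · rw [Set.indicator_of_mem (by exact hrr), Set.indicator_of_mem
          (by exact ⟨hkl.1, hkl.2, hiff.1 hrr⟩), observed, hkl.1, hL]
      · rw [Set.indicator_of_notMem (by exact hrr), Set.indicator_of_notMem
          (fun h => hrr (hiff.2 h.2.2))]
    · rw [Set.indicator_of_notMem (by exact hkl), Set.indicator_of_notMem
        (fun h => hkl ⟨h.1, h.2.1⟩)]
  · congr 2
    refine setLIntegral_congr_fun measurableSet_Ioi fun u hu => ?_
    have hu0 : (0 : ℝ) < u := hu
    have hpi : Real.pi * √(u / Real.pi) ^ 2 = u := by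
      rw [Real.sq_sqrt (by positivity)]
      field_simp
    rw [mul_assoc (g _), ← ENNReal.ofReal_mul (Real.exp_pos _).le, ← Real.exp_add]
    simp only [Params.successExponent, Nat.add_sub_cancel, hpi]
    congr 3
    ring
  · refine lintegral_congr fun ω => ?_
    by_cases hkl : X.servingTier p n ω = k ∧ X.load k ω = l + 1
    · have hL : X.servingLoad p n ω = l + 1 := by rw [servingLoad, hkl.1, hkl.2]
      rw [Set.indicator_of_mem (by exact hkl), Set.indicator_of_mem (by exact hkl), observed,
        hkl.1, hL]
    · rw [Set.indicator_of_notMem (by exact hkl), Set.indicator_of_notMem (by exact hkl)]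

end Law

end Elements

/-! ### Integrable bounds for the noiseless rate. -/

namespace Params

variable {p : Params}

lemma δ_mono (hp : p.Valid) {r r' : ℝ} (h : r ≤ r') (l : ℕ) : p.δ r l ≤ p.δ r' l := by
  have hW := hp.W_pos
  have : (2 : ℝ) ^ (((l : ℝ) + 1) * r / p.W) ≤ 2 ^ (((l : ℝ) + 1) * r' / p.W) :=
    Real.rpow_le_rpow_of_exponent_le one_le_two (by gcongr)
  unfold δ
  linarith

/-- Raising the rate by the bandwidth adds at least one to the binary exponent, whatever the load;
hence a bound uniform in `l`. -/
lemma two_mul_δ_le (hp : p.Valid) {r r' : ℝ} (h : r + p.W ≤ r') (l : ℕ) :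
    2 * p.δ r l ≤ p.δ r' l := by
  have hW := hp.W_pos
  have h1 : (2 : ℝ) ^ (1 + ((l : ℝ) + 1) * r / p.W) ≤ 2 ^ (((l : ℝ) + 1) * r' / p.W) := by
    refine Real.rpow_le_rpow_of_exponent_le one_le_two ?_
    have h0 : 1 + ((l : ℝ) + 1) * r / p.W = (p.W + ((l : ℝ) + 1) * r) / p.W := by field_simp
    have : 0 ≤ (l : ℝ) * (r' - r) := mul_nonneg (Nat.cast_nonneg l) (by linarith)
    rw [h0]
    refine div_le_div_of_nonneg_right ?_ hW.le
    linarith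
  rw [Real.rpow_add two_pos, Real.rpow_one] at h1
  unfold δ
  linarith

lemma δ_ge (hp : p.Valid) {r : ℝ} (h : p.W ≤ r) (l : ℕ) :
    (2 : ℝ) ^ (r / p.W) / 2 ≤ p.δ r l := by
  have hW := hp.W_pos
  have hr : 0 ≤ r := hW.le.trans h
  have h1 : (2 : ℝ) ^ (r / p.W) ≤ 2 ^ (((l : ℝ) + 1) * r / p.W) := by
    refine Real.rpow_le_rpow_of_exponent_le one_le_two ?_
    gcongr
    have : 0 ≤ (l : ℝ) * r := by positivity
    linarith
  have h2 : (2 : ℝ) ^ (1 : ℝ) ≤ 2 ^ (r / p.W) :=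
    Real.rpow_le_rpow_of_exponent_le one_le_two ((one_le_div hW).2 h)
  rw [Real.rpow_one] at h2
  unfold δ
  linarith

/-- Contribution of the load `l + 1` to the conditional mean of the excess rate. -/
def rateTerm (p : Params) (c : ℝ) (k : Tier) (r : ℝ) (l : ℕ) : ℝ :=
  p.lam k * candProb c k *
    (p.rateK c k (p.δ r l) - p.rateK c k (p.δ p.R₀ l) + p.rateK c k 0)⁻¹ * p.loadPMF k l

/-- All summands of `rateK` are monotone, so the contribution of the MBSs alone bounds the increment
from below. It is present for every `c` and `pa`. -/
lemma rateK_sub_ge (hp : p.Valid) {c : ℝ} (hc0 : 0 ≤ c) (hc1 : c ≤ 1) (hpa : 0 ≤ p.pa) (k : Tier)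
    {x y : ℝ} (hy : 0 ≤ y) (hyx : y ≤ x) :
    p.lam 0 * (p.P 0 / p.P k) ^ (2 / p.α) * (G x p.α - G y p.α) ≤
      p.rateK c k x - p.rateK c k y := by
  have hα := hp.two_lt_α
  have hG := sub_nonneg.2 (G_mono hα hy hyx)
  have hH := sub_nonneg.2 (H_mono hα hy hyx)
  have h1 := hp.lam_pos 1
  have hρ : 0 ≤ (p.P 1 / p.P k) ^ (2 / p.α) :=
    Real.rpow_nonneg (div_nonneg (hp.P_pos 1).le (hp.P_pos k).le) _
  have hc : 0 ≤ 1 - c := sub_nonneg.2 hc1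
  have h2 : 0 ≤ p.lam 1 * (p.P 1 / p.P k) ^ (2 / p.α) *
      (c * (p.pa * (G x p.α - G y p.α)) + (1 - c) * p.pa * (H x p.α - H y p.α)) := by positivity
  simp only [rateK, Fin.sum_univ_two, candProb, actProb, if_true, one_ne_zero, if_false]
  linarith

lemma rateTerm_den_pos (hp : p.Valid) {c : ℝ} (hc0 : 0 ≤ c) (hc1 : c ≤ 1) (hpa : 0 ≤ p.pa)
    (k : Tier) {r : ℝ} (hr : p.R₀ ≤ r) (l : ℕ) :
    p.rateK c k 0 ≤ p.rateK c k (p.δ r l) - p.rateK c k (p.δ p.R₀ l) + p.rateK c k 0 := by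
  have := rateK_mono hp hc0 hc1 hpa k (p.δ_nonneg hp hp.R₀_pos.le l) (p.δ_mono hp hr l)
  linarith

lemma rateTerm_nonneg (hp : p.Valid) {c : ℝ} (hc0 : 0 ≤ c) (hc1 : c ≤ 1) (hpa : 0 ≤ p.pa)
    (k : Tier) {r : ℝ} (hr : p.R₀ ≤ r) (l : ℕ) : 0 ≤ p.rateTerm c k r l := by
  have h1 := rateTerm_den_pos hp hc0 hc1 hpa k hr l
  have h2 := rateK_zero_pos hp hc0 k
  have h3 := candProb_nonneg hc0 k
  have h4 := hp.lam_pos k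
  have h5 := loadPMF_nonneg hp k l
  have h6 : 0 < p.rateK c k (p.δ r l) - p.rateK c k (p.δ p.R₀ l) + p.rateK c k 0 := h2.trans_le h1
  unfold rateTerm
  positivity

lemma measurable_rateTerm (c : ℝ) (k : Tier) (l : ℕ) :
    Measurable fun r => p.rateTerm c k r l := by
  have h1 : Measurable fun r => p.rateK c k (p.δ r l) :=
    (measurable_rateK c k).comp (measurable_δ measurable_id measurable_const)
  unfold rateTerm
  exact (((h1.sub_const _).add_const _).inv.const_mul _).mul_const _

/-- An integrable bound, uniform in the load. -/
lemma exists_rateTerm_le (hp : p.Valid) {c : ℝ} (hc0 : 0 ≤ c) (hc1 : c ≤ 1) (hpa : 0 ≤ p.pa)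
    (k : Tier) : ∃ b : ℝ → ℝ, Measurable b ∧ (∀ r, 0 ≤ b r) ∧
      ∫⁻ r in Set.Ioi p.R₀, ENNReal.ofReal (b r) ≠ ⊤ ∧
      ∀ r, p.R₀ ≤ r → ∀ l, p.rateTerm c k r l ≤ b r * p.loadPMF k l := by
  have hW := hp.W_pos
  have hα := hp.two_lt_α
  have hα0 : 0 < p.α := α_pos hp
  have hK := rateK_zero_pos hp hc0 k
  have hcand := candProb_nonneg hc0 k
  have hlam := hp.lam_pos k
  set a : ℝ := p.lam 0 * (p.P 0 / p.P k) ^ (2 / p.α) with ha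
  have ha0 : 0 < a := mul_pos (hp.lam_pos 0)
    (Real.rpow_pos_of_pos (div_pos (hp.P_pos 0) (hp.P_pos k)) _)
  -- Chosen so that `(2^{r/W})^{2/α} = e^{κ r}`.
  set κ : ℝ := 2 / (p.α * p.W) * Real.log 2 with hκ
  have hκ0 : 0 < κ := mul_pos (by positivity) (Real.log_pos one_lt_two)
  -- From `G_sub_ge` with `1 - y/x ≥ 1/2` and `x ≥ 2^{r/W} / 2`, multiplied by the coefficient `a`
  -- of the MBSs.
  set C : ℝ := a / (4 * p.α) * (1 / 2) ^ (2 / p.α) with hC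
  have hC0 : 0 < C := by positivity
  -- Close to `R₀` the increment of `rateK` can be arbitrarily small, so there only `K(0)` bounds
  -- the denominator. That range has length `W`; beyond it the threshold has at least doubled.
  let b₁ : ℝ → ℝ := (Set.Iio (p.R₀ + p.W)).indicator fun _ => (p.rateK c k 0)⁻¹
  let b₂ : ℝ → ℝ := fun r => C⁻¹ * Real.exp (-(κ * r))
  have hb₁ : ∀ r, 0 ≤ b₁ r := fun r => Set.indicator_nonneg (fun _ _ => by positivity) r
  have hb₂ : ∀ r, 0 ≤ b₂ r := fun r => by positivity
  have hm₁ : Measurable b₁ := measurable_const.indicator measurableSet_Iio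
  have hm₂ : Measurable b₂ := by fun_prop
  have hden : ∀ r, p.R₀ ≤ r → ∀ l,
      (p.rateK c k (p.δ r l) - p.rateK c k (p.δ p.R₀ l) + p.rateK c k 0)⁻¹ ≤ b₁ r + b₂ r := by
    intro r hr l
    have h1 := rateTerm_den_pos hp hc0 hc1 hpa k hr l
    by_cases hrW : r < p.R₀ + p.W
    · have : b₁ r = (p.rateK c k 0)⁻¹ := Set.indicator_of_mem (Set.mem_Iio.2 hrW) _
      rw [this]
      exact (inv_anti₀ hK h1).trans (le_add_of_nonneg_right (hb₂ r))
    · have hrW' : p.R₀ + p.W ≤ r := not_lt.1 hrW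
      refine le_trans ?_ (le_add_of_nonneg_left (hb₁ r))
      have hy := p.δ_nonneg hp hp.R₀_pos.le l
      have hx := p.δ_ge hp (by linarith [hp.R₀_pos] : p.W ≤ r) l
      have h2 := p.two_mul_δ_le hp hrW' l
      have h21 : (2 : ℝ) ^ (1 : ℝ) ≤ 2 ^ (r / p.W) := Real.rpow_le_rpow_of_exponent_le one_le_two
        ((one_le_div hW).2 (by linarith [hp.R₀_pos]))
      rw [Real.rpow_one] at h21
      have hx1 : 1 ≤ p.δ r l := by linarith
      have h3 := G_sub_ge hα hx1 hy (by linarith)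
      have h4 := rateK_sub_ge hp hc0 hc1 hpa k hy (p.δ_mono hp hr l)
      have h5 : 1 / 2 ≤ 1 - p.δ p.R₀ l / p.δ r l := by
        have : p.δ p.R₀ l / p.δ r l ≤ 1 / 2 := by
          rw [div_le_div_iff₀ (by linarith) two_pos]
          linarith
        linarith
      have h6 : ((2 : ℝ) ^ (r / p.W) / 2) ^ (2 / p.α) ≤ p.δ r l ^ (2 / p.α) :=
        Real.rpow_le_rpow (by positivity) hx (by positivity)
      have h7 : ((2 : ℝ) ^ (r / p.W) / 2) ^ (2 / p.α) =
          (1 / 2) ^ (2 / p.α) * Real.exp (κ * r) := by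
        rw [div_eq_mul_one_div, Real.mul_rpow (by positivity) (by norm_num), ← Real.rpow_mul
          two_pos.le, Real.rpow_def_of_pos two_pos, mul_comm]
        congr 2
        rw [hκ]
        field_simp
      have h8 : 1 / 2 * ((1 / 2) ^ (2 / p.α) * Real.exp (κ * r)) / (2 * p.α) ≤
          G (p.δ r l) p.α - G (p.δ p.R₀ l) p.α := by
        refine le_trans ?_ h3
        rw [← h7]
        gcongr
      have h9 : C * Real.exp (κ * r) ≤
          p.rateK c k (p.δ r l) - p.rateK c k (p.δ p.R₀ l) + p.rateK c k 0 := by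
        have h10 := mul_le_mul_of_nonneg_left h8 ha0.le
        have h11 : a * (1 / 2 * ((1 / 2) ^ (2 / p.α) * Real.exp (κ * r)) / (2 * p.α)) =
            C * Real.exp (κ * r) := by
          rw [hC]
          ring
        linarith
      refine (inv_anti₀ (by positivity) h9).trans (le_of_eq ?_)
      simp only [b₂]
      rw [mul_inv, Real.exp_neg]
  refine ⟨fun r => p.lam k * candProb c k * (b₁ r + b₂ r), (hm₁.add hm₂).const_mul _,
    fun r => mul_nonneg (by positivity) (add_nonneg (hb₁ r) (hb₂ r)), ?_, fun r hr l => ?_⟩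
  · simp_rw [ENNReal.ofReal_mul (mul_nonneg hlam.le hcand), ENNReal.ofReal_add (hb₁ _) (hb₂ _)]
    rw [lintegral_const_mul _ (by fun_prop), lintegral_add_left hm₁.ennreal_ofReal]
    refine ENNReal.mul_ne_top ENNReal.ofReal_ne_top (ENNReal.add_ne_top.2 ⟨?_, ?_⟩)
    · have h1 : ∀ r, ENNReal.ofReal (b₁ r) = (Set.Iio (p.R₀ + p.W)).indicator
          (fun _ => ENNReal.ofReal (p.rateK c k 0)⁻¹) r := by
        intro r
        by_cases hr : r ∈ Set.Iio (p.R₀ + p.W)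
        · simp only [b₁]
          rw [Set.indicator_of_mem hr, Set.indicator_of_mem hr]
        · simp only [b₁]
          rw [Set.indicator_of_notMem hr, Set.indicator_of_notMem hr, ENNReal.ofReal_zero]
      simp_rw [h1]
      rw [lintegral_indicator_const measurableSet_Iio, Measure.restrict_apply measurableSet_Iio]
      refine ENNReal.mul_ne_top ENNReal.ofReal_ne_top ?_
      rw [Set.inter_comm, Set.Ioi_inter_Iio]
      simp
    · simp only [b₂]
      simp_rw [ENNReal.ofReal_mul (inv_pos.2 hC0).le]
      rw [lintegral_const_mul _ (by fun_prop)]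
      refine ENNReal.mul_ne_top ENNReal.ofReal_ne_top (ne_top_of_le_ne_top
        (b := ∫⁻ r in Set.Ioi (0 : ℝ), ENNReal.ofReal (Real.exp (-(κ * r)))) ?_
        (lintegral_mono_set (Set.Ioi_subset_Ioi hp.R₀_pos.le)))
      rw [lintegral_exp_neg_Ioi hκ0]
      exact ENNReal.ofReal_ne_top
  · unfold rateTerm
    refine mul_le_mul_of_nonneg_right ?_ (loadPMF_nonneg hp k l)
    exact mul_le_mul_of_nonneg_left (hden r hr l) (by positivity)

lemma summable_rateTerm (hp : p.Valid) {c : ℝ} (hc0 : 0 ≤ c) (hc1 : c ≤ 1) (hpa : 0 ≤ p.pa)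
    (k : Tier) {r : ℝ} (hr : p.R₀ ≤ r) : Summable (p.rateTerm c k r) := by
  obtain ⟨b, -, -, -, hb⟩ := exists_rateTerm_le hp hc0 hc1 hpa k
  exact Summable.of_nonneg_of_le (rateTerm_nonneg hp hc0 hc1 hpa k hr) (hb r hr)
    ((summable_loadPMF hp k).mul_left _)

lemma lintegral_tsum_rateTerm_ne_top (hp : p.Valid) {c : ℝ} (hc0 : 0 ≤ c) (hc1 : c ≤ 1)
    (hpa : 0 ≤ p.pa) (k : Tier) :
    ∫⁻ r in Set.Ioi p.R₀, ∑' l, ENNReal.ofReal (p.rateTerm c k r l) ≠ ⊤ := by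
  obtain ⟨b, -, hb0, hbi, hb⟩ := exists_rateTerm_le hp hc0 hc1 hpa k
  refine ne_top_of_le_ne_top hbi (setLIntegral_mono' measurableSet_Ioi fun r hr => ?_)
  calc ∑' l, ENNReal.ofReal (p.rateTerm c k r l)
      ≤ ∑' l, ENNReal.ofReal (b r) * ENNReal.ofReal (p.loadPMF k l) := by
        refine ENNReal.tsum_le_tsum fun l => ?_
        rw [← ENNReal.ofReal_mul (hb0 r)]
        exact ENNReal.ofReal_le_ofReal (hb r (le_of_lt hr) l)
    _ = ENNReal.ofReal (b r) := by
        rw [ENNReal.tsum_mul_left, tsum_ofReal_loadPMF hp, mul_one]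

lemma lintegral_tsum_rateTerm (hp : p.Valid) {c : ℝ} (hc0 : 0 ≤ c) (hc1 : c ≤ 1)
    (hpa : 0 ≤ p.pa) (k : Tier) :
    IntegrableOn (fun r => ∑' l, p.rateTerm c k r l) (Set.Ioi p.R₀) ∧
    (∫⁻ r in Set.Ioi p.R₀, ∑' l, ENNReal.ofReal (p.rateTerm c k r l)).toReal =
      ∫ r in Set.Ioi p.R₀, ∑' l, p.rateTerm c k r l := by
  have hfin := lintegral_tsum_rateTerm_ne_top hp hc0 hc1 hpa k
  have hm : Measurable fun r => ∑' l, ENNReal.ofReal (p.rateTerm c k r l) :=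
    Measurable.tsum fun l => (measurable_rateTerm c k l).ennreal_ofReal
  have heq : ∀ r ∈ Set.Ioi p.R₀, (∑' l, ENNReal.ofReal (p.rateTerm c k r l)).toReal =
      ∑' l, p.rateTerm c k r l := by
    intro r hr
    have hr' : p.R₀ ≤ r := le_of_lt hr
    rw [← ENNReal.ofReal_tsum_of_nonneg (rateTerm_nonneg hp hc0 hc1 hpa k hr')
      (summable_rateTerm hp hc0 hc1 hpa k hr'), ENNReal.toReal_ofReal
      (tsum_nonneg (rateTerm_nonneg hp hc0 hc1 hpa k hr'))]
  refine ⟨(integrableOn_congr_fun heq measurableSet_Ioi).1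
    (integrable_toReal_of_lintegral_ne_top hm.aemeasurable hfin), ?_⟩
  rw [← setIntegral_congr_fun measurableSet_Ioi heq, integral_toReal hm.aemeasurable
    (ae_lt_top hm hfin)]

/-- Contribution of the load `l + 1` to the success probability. -/
def accessTerm (p : Params) (c : ℝ) (k : Tier) (l : ℕ) : ℝ :=
  p.lam k * candProb c k * (p.rateK c k (p.δ p.R₀ l))⁻¹ * p.loadPMF k l

lemma accessTerm_nonneg (hp : p.Valid) {c : ℝ} (hc0 : 0 ≤ c) (hc1 : c ≤ 1) (hpa : 0 ≤ p.pa)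
    (k : Tier) (l : ℕ) : 0 ≤ p.accessTerm c k l := by
  have h2 := rateK_pos hp hc0 hc1 hpa k (p.δ_nonneg hp hp.R₀_pos.le l)
  have h3 := candProb_nonneg hc0 k
  have h4 := hp.lam_pos k
  have h5 := loadPMF_nonneg hp k l
  unfold accessTerm
  positivity

lemma summable_accessTerm (hp : p.Valid) {c : ℝ} (hc0 : 0 ≤ c) (hc1 : c ≤ 1) (hpa : 0 ≤ p.pa)
    (k : Tier) : Summable (p.accessTerm c k) := by
  refine Summable.of_nonneg_of_le (accessTerm_nonneg hp hc0 hc1 hpa k) (fun l => ?_)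
    ((summable_loadPMF hp k).mul_left (p.lam k * candProb c k * (p.rateK c k 0)⁻¹))
  have h1 := rateK_zero_pos hp hc0 k
  have h2 := rateK_mono hp hc0 hc1 hpa k le_rfl (p.δ_nonneg hp hp.R₀_pos.le l)
  have h3 := candProb_nonneg hc0 k
  have h4 := hp.lam_pos k
  have h5 := loadPMF_nonneg hp k l
  unfold accessTerm
  gcongr

/-! ### The closed expressions in terms of `rateK` -/

lemma lam'_eq (k : Tier) : p.lam' k = p.lam k * candProb p.pLp k := by
  fin_cases k
  · simp [lam', candProb]
  · simp [lam', candProb, mul_comm]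

lemma ALp_eq_share (hp : p.Valid) (k : Tier) : p.ALp k = p.share p.pLp k := by
  rw [ALp, share_eq hp]
  simp_rw [lam'_eq]

lemma card_Lp : p.Lp.card = p.N - p.N₁ := by
  rw [Lp, Nat.card_Icc]
  omega

lemma pLp_pos (hp : p.Valid) : 0 < p.pLp := by
  have h1 := hp.N₂_pos
  have h2 := hp.N₂_le
  rw [pLp, card_Lp]
  have : 0 < p.N - p.N₁ := by omega
  positivity

lemma pLp_le_one (hp : p.Valid) : p.pLp ≤ 1 := by
  rw [pLp, card_Lp]
  exact div_le_one_of_le₀ (by exact_mod_cast hp.N₂_le) (by positivity)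

lemma lam'_pos (hp : p.Valid) (k : Tier) : 0 < p.lam' k := by
  have h0 := hp.lam_pos 0
  have h1 := hp.lam_pos 1
  have := pLp_pos hp
  unfold lam'
  split_ifs <;> positivity

/-- `ξ`, `ς` and `ζ` are the coefficients of `G`, of `H` and of the constant, normalised by the
equivalent density of the serving tier. -/
lemma rateK_pLp (hp : p.Valid) (k : Tier) (x : ℝ) :
    p.rateK p.pLp k x = p.lam' k * (p.ξ k * G x p.α + p.vs k * H x p.α + p.ζ k) := by
  have hl := (lam'_pos hp k).ne'
  have hk := (Real.rpow_pos_of_pos (hp.P_pos k) (2 / p.α)).ne'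
  simp only [rateK, Fin.sum_univ_two, candProb, actProb, if_true, one_ne_zero, if_false, ξ, vs, ζ,
    Real.div_rpow (hp.P_pos _).le (hp.P_pos k).le]
  field_simp
  ring

lemma termLp_eq (hp : p.Valid) (r : ℝ) (l : ℕ) : p.termLp r l = p.rateTerm p.pLp 1 r l := by
  have hl := (lam'_pos hp 1).ne'
  have hα := hp.two_lt_α
  rw [rateTerm, rateK_pLp hp, rateK_pLp hp, rateK_pLp hp, G_zero, H_zero hα, ← lam'_eq, termLp]
  congr 1
  rw [← mul_sub, ← mul_add, mul_inv, ← mul_assoc, mul_inv_cancel₀ hl, one_mul, GStar, HStar]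
  congr 1
  ring

lemma termAccess_eq (hp : p.Valid) (l : ℕ) : p.termAccess l = p.accessTerm p.pLp 0 l := by
  have hl := (lam'_pos hp 0).ne'
  rw [accessTerm, rateK_pLp hp, ← lam'_eq, termAccess]
  congr 1
  rw [mul_inv, ← mul_assoc, mul_inv_cancel₀ hl, one_mul]

/-- The case `c = 0`: only MBSs are candidates, so every active helper interferes from the whole
plane, through `H`. -/
lemma termMp_eq (hp : p.Valid) (r : ℝ) (l : ℕ) : p.termMp r l = p.rateTerm 0 0 r l := by
  have hl := (hp.lam_pos 0).ne'
  have hα := hp.two_lt_α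
  have hP : (p.P 0 / p.P 0) ^ (2 / p.α) = 1 := by
    rw [div_self (hp.P_pos 0).ne', Real.one_rpow]
  have hK : ∀ x, p.rateK 0 0 x = p.lam 0 * (G x p.α +
      p.pa * (p.lam 1 / p.lam 0) * (p.P 1 / p.P 0) ^ (2 / p.α) * H x p.α + 1) := by
    intro x
    simp only [rateK, Fin.sum_univ_two, candProb, actProb, if_true, one_ne_zero, if_false, hP]
    field_simp
    ring
  rw [rateTerm, hK, hK, hK, G_zero, H_zero hα, termMp, candProb, if_pos rfl, mul_one]
  congr 1
  rw [← mul_sub, ← mul_add, mul_inv, ← mul_assoc, mul_inv_cancel₀ hl, one_mul, GStar, HStar]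
  congr 1
  ring

end Params

/-- A nonnegative function is determined by its lower integrals as a conditional expectation. -/
lemma toReal_ae_eq_condExp {Ω : Type*} {m mΩ : MeasurableSpace Ω} {μ : Measure Ω}
    [IsFiniteMeasure μ] (hm : m ≤ mΩ) {f : Ω → ℝ} (hf : AEMeasurable f μ) (hf0 : 0 ≤ f)
    {g : Ω → ℝ≥0∞} (hg : Measurable[m] g) (hfin : ∫⁻ ω, g ω ∂μ ≠ ⊤)
    (h : ∀ B, MeasurableSet[m] B → ∫⁻ ω in B, ENNReal.ofReal (f ω) ∂μ = ∫⁻ ω in B, g ω ∂μ) :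
    (fun ω => (g ω).toReal) =ᵐ[μ] μ[f | m] := by
  have hg' : Measurable g := hg.mono hm le_rfl
  have hfi : Integrable f μ := by
    refine ⟨hf.aestronglyMeasurable, ?_⟩
    rw [hasFiniteIntegral_iff_ofReal (Eventually.of_forall hf0)]
    have := h Set.univ MeasurableSet.univ
    rw [setLIntegral_univ, setLIntegral_univ] at this
    rw [this]
    exact hfin.lt_top
  have hgi : Integrable (fun ω => (g ω).toReal) μ :=
    integrable_toReal_of_lintegral_ne_top hg'.aemeasurable hfin
  refine ae_eq_condExp_of_forall_setIntegral_eq hm hfi (fun B _ _ => hgi.integrableOn)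
    (fun B hB _ => ?_) (Measurable.ennreal_toReal hg).aestronglyMeasurable
  rw [integral_toReal hg'.aemeasurable (ae_restrict_of_ae (ae_lt_top hg' hfin)), ← h B hB,
    integral_eq_lintegral_of_nonneg_ae (Eventually.of_forall hf0)
      hf.aestronglyMeasurable.restrict]

/-! ### Mean excess of the rate over the demand, and its dependence on the noise. -/

namespace Params

variable {p : Params}

lemma measurable_successExponent_left (c s r : ℝ) :
    Measurable fun q : Tier × ℝ × ℕ => p.successExponent c s r q :=
  measurable_successExponent c s measurable_const measurable_id

/-- The noise enters linearly, with a nonnegative coefficient if `r ≥ r'`. Hence the noiseless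
integrand dominates all noisy ones. -/
lemma successExponent_sub (c s r r' : ℝ) (q : Tier × ℝ × ℕ) :
    p.successExponent c s r q - p.successExponent c s r' q =
      (p.δ r (q.2.2 - 1) - p.δ r' (q.2.2 - 1)) / p.P q.1 * q.2.1 ^ p.α * s +
        (p.successExponent c 0 r q - p.successExponent c 0 r' q) := by
  unfold successExponent
  ring

lemma successExponent_nonneg (hp : p.Valid) {c : ℝ} (hc0 : 0 ≤ c) (hc1 : c ≤ 1) (hpa : 0 ≤ p.pa)
    {s r : ℝ} (hs : 0 ≤ s) (hr : 0 ≤ r) {q : Tier × ℝ × ℕ} (hq : 0 ≤ q.2.1) :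
    0 ≤ p.successExponent c s r q := by
  have h1 := p.δ_nonneg hp hr (q.2.2 - 1)
  have h2 := sub_nonneg.2 (rateK_mono hp hc0 hc1 hpa q.1 le_rfl h1)
  have h3 := hp.P_pos q.1
  have h4 := Real.pi_pos
  unfold successExponent
  positivity

/-- Mean excess of the rate over the demand, given success. -/
def excess (p : Params) (c s : ℝ) (q : Tier × ℝ × ℕ) : ℝ≥0∞ :=
  ∫⁻ r in Set.Ioi p.R₀, ENNReal.ofReal
    (Real.exp (-(p.successExponent c s r q - p.successExponent c s p.R₀ q)))

lemma measurable_excess (c s : ℝ) : Measurable (p.excess c s) := by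
  have h1 : Measurable fun x : (Tier × ℝ × ℕ) × ℝ => p.successExponent c s x.2 x.1 :=
    measurable_successExponent c s measurable_snd measurable_fst
  have h2 : Measurable fun x : (Tier × ℝ × ℕ) × ℝ => p.successExponent c s p.R₀ x.1 :=
    measurable_successExponent c s measurable_const measurable_fst
  have h3 : Measurable fun x : (Tier × ℝ × ℕ) × ℝ => ENNReal.ofReal
    (Real.exp (-(p.successExponent c s x.2 x.1 - p.successExponent c s p.R₀ x.1))) :=
    (h1.sub h2).neg.exp.ennreal_ofReal
  exact h3.lintegral_prod_right'

lemma excess_integrand_le (hp : p.Valid) (c : ℝ) {s r : ℝ} (hs : 0 ≤ s) (hr : p.R₀ ≤ r)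
    {q : Tier × ℝ × ℕ} (hq : 0 ≤ q.2.1) :
    ENNReal.ofReal (Real.exp (-(p.successExponent c s r q - p.successExponent c s p.R₀ q))) ≤
      ENNReal.ofReal
        (Real.exp (-(p.successExponent c 0 r q - p.successExponent c 0 p.R₀ q))) := by
  refine ENNReal.ofReal_le_ofReal (Real.exp_le_exp.2 (neg_le_neg ?_))
  rw [successExponent_sub c s]
  have h1 := sub_nonneg.2 (p.δ_mono hp hr (q.2.2 - 1))
  have h3 := hp.P_pos q.1
  have : 0 ≤ (p.δ r (q.2.2 - 1) - p.δ p.R₀ (q.2.2 - 1)) / p.P q.1 * q.2.1 ^ p.α * s := by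
    positivity
  linarith

lemma excess_le (hp : p.Valid) (c : ℝ) {s : ℝ} (hs : 0 ≤ s) {q : Tier × ℝ × ℕ}
    (hq : 0 ≤ q.2.1) : p.excess c s q ≤ p.excess c 0 q :=
  setLIntegral_mono' measurableSet_Ioi fun _ hr => excess_integrand_le hp c hs (le_of_lt hr) hq

lemma tendsto_excess (hp : p.Valid) (c : ℝ) {q : Tier × ℝ × ℕ} (hq : 0 ≤ q.2.1)
    (hfin : p.excess c 0 q ≠ ⊤) :
    Tendsto (fun s => p.excess c s q) (𝓝[>] 0) (𝓝 (p.excess c 0 q)) := by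
  have hm : ∀ s, Measurable fun r => ENNReal.ofReal
      (Real.exp (-(p.successExponent c s r q - p.successExponent c s p.R₀ q))) := fun s =>
    ((measurable_successExponent (p := p) c s measurable_id
      (measurable_const (a := q))).sub_const _).neg.exp.ennreal_ofReal
  refine tendsto_lintegral_filter_of_dominated_convergence _ (Eventually.of_forall hm)
    ?_ hfin (Eventually.of_forall fun r => ?_)
  · filter_upwards [self_mem_nhdsWithin] with s hs
    filter_upwards [ae_restrict_mem measurableSet_Ioi] with r hr
    exact excess_integrand_le hp c (le_of_lt hs) (le_of_lt hr) hq
  · refine Tendsto.mono_left ?_ nhdsWithin_le_nhds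
    have hc : Continuous fun s => ENNReal.ofReal
        (Real.exp (-(p.successExponent c s r q - p.successExponent c s p.R₀ q))) := by
      refine ENNReal.continuous_ofReal.comp ?_
      unfold successExponent
      fun_prop
    exact hc.tendsto 0

end Params

/-! ### Conditional expectations, delivery rates and vanishing noise. -/

namespace Elements

variable {Ω : Type*} {X : Elements Ω} {p : Params} [mΩ : MeasurableSpace Ω] {μ : Measure Ω}
  [IsProbabilityMeasure μ]

namespace Law

lemma measurableSet_tier (hX : X.Law p μ) (n : ℕ) (k : Tier) :
    MeasurableSet {ω | X.servingTier p n ω = k} :=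
  hX.measurable_servingTier n (measurableSet_singleton k)

/-- The law of the serving distance and the load on the event of association with tier `k`. -/
lemma setLIntegral_tier (hX : X.Law p μ) (hp : p.Valid) (n : ℕ) (k : Tier)
    {g : Tier × ℝ × ℕ → ℝ≥0∞} (hg : Measurable g) :
    ∫⁻ ω in {ω | X.servingTier p n ω = k}, g (X.observed p n ω) ∂μ =
      ∑' l, ENNReal.ofReal (p.loadPMF k l) *
        (ENNReal.ofReal (p.lam k * Params.candProb (storeProb p n) k) *
          ∫⁻ u in Set.Ioi (0 : ℝ), g (k, √(u / Real.pi), l + 1) * ENNReal.ofReal (Real.exp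
            (-(p.rateK (storeProb p n) k 0 * u)))) := by
  have hk := hX.measurableSet_tier n k
  have hgT : Measurable fun ω => g (X.observed p n ω) := hg.comp (hX.measurable_observed n)
  rw [← lintegral_indicator hk, hX.lintegral_eq_tsum_tier_load hp n
    (hgT.indicator hk).aemeasurable, Finset.sum_eq_single k]
  · refine tsum_congr fun l => ?_
    rw [← hX.lintegral_tier_load hp n k l (f := fun z => g (k, z, l + 1))
      (hg.comp (measurable_const.prodMk (measurable_id.prodMk measurable_const)))]
    refine lintegral_congr fun ω => ?_
    by_cases hkl : X.servingTier p n ω = k ∧ X.load k ω = l + 1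
    · have hL : X.servingLoad p n ω = l + 1 := by rw [servingLoad, hkl.1, hkl.2]
      rw [Set.indicator_of_mem (by exact hkl), Set.indicator_of_mem (by exact hkl.1),
        Set.indicator_of_mem (by exact hkl), observed, hkl.1, hL]
    · rw [Set.indicator_of_notMem (by exact hkl), Set.indicator_of_notMem (by exact hkl)]
  · intro k' _ hk'
    refine ENNReal.tsum_eq_zero.2 fun l => ?_
    rw [lintegral_eq_zero_iff' ((hgT.indicator hk).indicator
      (hX.measurableSet_tier_load n k' l)).aemeasurable]
    refine Eventually.of_forall fun ω => ?_
    by_cases h : X.servingTier p n ω = k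
    · exact Set.indicator_of_notMem (fun hmem => hk' (hmem.1.symm.trans h)) _
    · refine Set.indicator_apply_eq_zero.2 fun _ => Set.indicator_of_notMem (by exact h) _
  · simp

lemma measure_tier (hX : X.Law p μ) (hp : p.Valid) (n : ℕ) (k : Tier) :
    μ {ω | X.servingTier p n ω = k} = ENNReal.ofReal (p.share (storeProb p n) k) := by
  have h := hX.setLIntegral_tier hp n k (g := fun _ => 1) measurable_const
  simp only [one_mul] at h
  rw [lintegral_exp_neg_Ioi (Params.rateK_zero_pos hp (hX.storeProb_nonneg n) k),
    ← ENNReal.ofReal_mul (mul_nonneg (hp.lam_pos k).le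
      (Params.candProb_nonneg (hX.storeProb_nonneg n) k)), ← div_eq_mul_inv,
    ENNReal.tsum_mul_right, Params.tsum_ofReal_loadPMF hp, one_mul, setLIntegral_one] at h
  exact h

lemma assocProb_eq_share (hX : X.Law p μ) (hp : p.Valid) (n : ℕ) (k : Tier) :
    X.assocProb p μ n k = p.share (storeProb p n) k := by
  rw [assocProb, Measure.real, hX.measure_tier hp,
    ENNReal.toReal_ofReal (Params.share_nonneg hp (hX.storeProb_nonneg n) k)]

/-- Without noise, the exponent is linear in the area of the disc of the serving distance. -/
lemma setLIntegral_exp_sub (hX : X.Law p μ) (hp : p.Valid) (n : ℕ) (k : Tier) {a : ℕ → ℝ}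
    (ha : ∀ l, 0 < a l) {g : Tier × ℝ × ℕ → ℝ≥0∞} (hg : Measurable g)
    (hga : ∀ u : ℝ, 0 < u → ∀ l, g (k, √(u / Real.pi), l + 1) =
      ENNReal.ofReal (Real.exp (-((a l - p.rateK (storeProb p n) k 0) * u)))) :
    ∫⁻ ω in {ω | X.servingTier p n ω = k}, g (X.observed p n ω) ∂μ =
      ∑' l, ENNReal.ofReal
        (p.lam k * Params.candProb (storeProb p n) k * (a l)⁻¹ * p.loadPMF k l) := by
  have hc : 0 ≤ p.lam k * Params.candProb (storeProb p n) k :=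
    mul_nonneg (hp.lam_pos k).le (Params.candProb_nonneg (hX.storeProb_nonneg n) k)
  rw [hX.setLIntegral_tier hp n k hg]
  refine tsum_congr fun l => ?_
  have h1 : ∀ u ∈ Set.Ioi (0 : ℝ), g (k, √(u / Real.pi), l + 1) * ENNReal.ofReal
      (Real.exp (-(p.rateK (storeProb p n) k 0 * u))) =
      ENNReal.ofReal (Real.exp (-(a l * u))) := by
    intro u hu
    rw [hga u hu, ← ENNReal.ofReal_mul (Real.exp_pos _).le, ← Real.exp_add]
    congr 2
    ring
  rw [setLIntegral_congr_fun measurableSet_Ioi h1, lintegral_exp_neg_Ioi (ha l),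
    ← ENNReal.ofReal_mul hc, ← ENNReal.ofReal_mul (Params.loadPMF_nonneg hp k l), mul_comm]

lemma pi_mul_sq_sqrt {u : ℝ} (hu : 0 < u) : Real.pi * √(u / Real.pi) ^ 2 = u := by
  rw [Real.sq_sqrt (by positivity)]
  field_simp

/-- Tonelli moves `r` outside. For fixed `r` the integrand is an exponential in the area `u`, which
combines with the density factor `e^{-K(0) u}` into `1 / (K(δ_r) - K(δ_{R₀}) + K(0))`. -/
lemma setLIntegral_excess (hX : X.Law p μ) (hp : p.Valid) (n : ℕ) (k : Tier) :
    ∫⁻ ω in {ω | X.servingTier p n ω = k}, p.excess (storeProb p n) 0 (X.observed p n ω) ∂μ =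
      ∫⁻ r in Set.Ioi p.R₀, ∑' l, ENNReal.ofReal (p.rateTerm (storeProb p n) k r l) := by
  set c := storeProb p n with hc
  have hc0 := hX.storeProb_nonneg n
  have hc1 := hX.storeProb_le_one n
  have hT := hX.measurable_observed n
  have hj : Measurable fun x : Ω × ℝ => ENNReal.ofReal (Real.exp
      (-(p.successExponent c 0 x.2 (X.observed p n x.1) -
        p.successExponent c 0 p.R₀ (X.observed p n x.1)))) := by
    have h1 : Measurable fun x : Ω × ℝ => p.successExponent c 0 x.2 (X.observed p n x.1) :=
      Params.measurable_successExponent c 0 measurable_snd (hT.comp measurable_fst)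
    have h2 : Measurable fun x : Ω × ℝ => p.successExponent c 0 p.R₀ (X.observed p n x.1) :=
      Params.measurable_successExponent c 0 measurable_const (hT.comp measurable_fst)
    exact (h1.sub h2).neg.exp.ennreal_ofReal
  unfold Params.excess
  rw [lintegral_lintegral_swap (f := fun ω r => ENNReal.ofReal (Real.exp
      (-(p.successExponent c 0 r (X.observed p n ω) -
        p.successExponent c 0 p.R₀ (X.observed p n ω))))) hj.aemeasurable]
  refine setLIntegral_congr_fun measurableSet_Ioi fun r hr => ?_
  have hr' : p.R₀ ≤ r := le_of_lt hr
  refine hX.setLIntegral_exp_sub hp n k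
    (a := fun l => p.rateK c k (p.δ r l) - p.rateK c k (p.δ p.R₀ l) + p.rateK c k 0)
    (fun l => (Params.rateK_zero_pos hp hc0 k).trans_le
      (Params.rateTerm_den_pos hp hc0 hc1 hX.pa_nonneg k hr' l))
    (g := fun q => ENNReal.ofReal (Real.exp
      (-(p.successExponent c 0 r q - p.successExponent c 0 p.R₀ q))))
    ((Params.measurable_successExponent_left c 0 r).sub
      (Params.measurable_successExponent_left c 0 p.R₀)).neg.exp.ennreal_ofReal ?_
  intro u hu l
  simp only [Params.successExponent, Nat.add_sub_cancel, pi_mul_sq_sqrt hu]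
  congr 3
  ring

lemma lintegral_excess_ne_top (hX : X.Law p μ) (hp : p.Valid) (n : ℕ) :
    ∫⁻ ω, p.excess (storeProb p n) 0 (X.observed p n ω) ∂μ ≠ ⊤ := by
  have hk : ∀ k, ∫⁻ ω in {ω | X.servingTier p n ω = k},
      p.excess (storeProb p n) 0 (X.observed p n ω) ∂μ ≠ ⊤ := fun k => by
    rw [hX.setLIntegral_excess hp n k]
    exact Params.lintegral_tsum_rateTerm_ne_top hp (hX.storeProb_nonneg n) (hX.storeProb_le_one n)
      hX.pa_nonneg k
  have hU : (Set.univ : Set Ω) =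
      {ω | X.servingTier p n ω = 0} ∪ {ω | X.servingTier p n ω = 1} := by
    ext ω
    have : ∀ a : Tier, a = 0 ∨ a = 1 := by decide
    simpa using this (X.servingTier p n ω)
  rw [← setLIntegral_univ, hU]
  exact ne_top_of_le_ne_top (ENNReal.add_ne_top.2 ⟨hk 0, hk 1⟩) (lintegral_union_le _ _ _)

lemma observed_dist_nonneg (n : ℕ) (ω : Ω) : 0 ≤ (X.observed p n ω).2.1 := norm_nonneg _

lemma ae_excess_ne_top (hX : X.Law p μ) (hp : p.Valid) (n : ℕ) :
    ∀ᵐ ω ∂μ, p.excess (storeProb p n) 0 (X.observed p n ω) ≠ ⊤ := by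
  have hm : Measurable fun ω => p.excess (storeProb p n) 0 (X.observed p n ω) :=
    (Params.measurable_excess _ 0).comp (hX.measurable_observed n)
  filter_upwards [ae_lt_top hm (hX.lintegral_excess_ne_top hp n)] with ω hω using hω.ne

/-- The conditional success probability. -/
lemma condExp_success (hX : X.Law p μ) (hp : p.Valid) (n : ℕ) {s : ℝ} (hs : 0 ≤ s) :
    (fun ω => Real.exp (-p.successExponent (storeProb p n) s p.R₀ (X.observed p n ω))) =ᵐ[μ]
      μ[(X.success p s n).indicator (fun _ => (1 : ℝ)) | X.info p n] := by
  set c := storeProb p n with hc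
  have hc0 := hX.storeProb_nonneg n
  have hc1 := hX.storeProb_le_one n
  have hS : NullMeasurableSet (X.success p s n) μ :=
    nullMeasurableSet_le aemeasurable_const (hX.aemeasurable_rate hp s n)
  have hE : Measurable fun q : Tier × ℝ × ℕ =>
      ENNReal.ofReal (Real.exp (-p.successExponent c s p.R₀ q)) :=
    (Params.measurable_successExponent_left c s p.R₀).neg.exp.ennreal_ofReal
  have hg : Measurable[X.info p n] fun ω => ENNReal.ofReal
      (Real.exp (-p.successExponent c s p.R₀ (X.observed p n ω))) :=
    hE.comp (comap_measurable (X.observed p n))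
  have h := toReal_ae_eq_condExp (hX.info_le n) (μ := μ)
    (f := (X.success p s n).indicator (fun _ => (1 : ℝ)))
    (aemeasurable_const.indicator₀ hS) (Set.indicator_nonneg fun _ _ => zero_le_one) hg ?_ ?_
  · refine EventuallyEq.trans (Eventually.of_forall fun ω => ?_) h
    exact (ENNReal.toReal_ofReal (Real.exp_pos _).le).symm
  · refine ne_top_of_le_ne_top (b := ∫⁻ _, 1 ∂μ) (by simp) (lintegral_mono fun ω => ?_)
    rw [← ENNReal.ofReal_one]
    refine ENNReal.ofReal_le_ofReal (Real.exp_le_one_iff.2 (neg_nonpos.2 ?_))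
    exact Params.successExponent_nonneg hp hc0 hc1 hX.pa_nonneg hs hp.R₀_pos.le
      (observed_dist_nonneg n ω)
  · rintro B ⟨B', hB', rfl⟩
    have hB : MeasurableSet (X.observed p n ⁻¹' B') := hX.measurable_observed n hB'
    have h1 := hX.lintegral_rate hp n hp.R₀_pos.le hs (measurable_one.indicator hB')
    change ∫⁻ ω in X.observed p n ⁻¹' B', _ ∂μ = ∫⁻ ω in X.observed p n ⁻¹' B', _ ∂μ
    rw [← lintegral_indicator hB, ← lintegral_indicator hB]
    refine Eq.trans (lintegral_congr fun ω => ?_) (h1.trans (lintegral_congr fun ω => ?_))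
    · by_cases hωB : X.observed p n ω ∈ B' <;> by_cases hω : p.R₀ ≤ X.rate p s n ω <;>
        simp [Set.indicator, success, hωB, hω]
    · by_cases hωB : X.observed p n ω ∈ B' <;> simp [Set.indicator, hωB, hc]

/-- The conditional mean of the rate on the success event. -/
lemma condExp_rate (hX : X.Law p μ) (hp : p.Valid) (n : ℕ) {s : ℝ} (hs : 0 ≤ s) :
    (fun ω => Real.exp (-p.successExponent (storeProb p n) s p.R₀ (X.observed p n ω)) *
      (p.R₀ + (p.excess (storeProb p n) s (X.observed p n ω)).toReal)) =ᵐ[μ]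
      μ[(X.success p s n).indicator (X.rate p s n) | X.info p n] := by
  set c := storeProb p n with hc
  have hc0 := hX.storeProb_nonneg n
  have hc1 := hX.storeProb_le_one n
  have hT := hX.measurable_observed n
  have hR := hX.aemeasurable_rate hp s n
  have hS : NullMeasurableSet (X.success p s n) μ := nullMeasurableSet_le aemeasurable_const hR
  have hR0 := hp.R₀_pos
  set f := (X.success p s n).indicator (X.rate p s n) with hf
  have hf0 : 0 ≤ f := Set.indicator_nonneg fun ω hω => hR0.le.trans hω
  have hfm : AEMeasurable f μ := hR.indicator₀ hS
  have hG : Measurable fun q : Tier × ℝ × ℕ =>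
      ENNReal.ofReal (Real.exp (-p.successExponent c s p.R₀ q)) *
        (ENNReal.ofReal p.R₀ + p.excess c s q) :=
    (Params.measurable_successExponent_left c s p.R₀).neg.exp.ennreal_ofReal.mul
      ((Params.measurable_excess c s).const_add _)
  have hg : Measurable[X.info p n] fun ω =>
      ENNReal.ofReal (Real.exp (-p.successExponent c s p.R₀ (X.observed p n ω))) *
        (ENNReal.ofReal p.R₀ + p.excess c s (X.observed p n ω)) :=
    hG.comp (comap_measurable (X.observed p n))
  have h := toReal_ae_eq_condExp (hX.info_le n) hfm hf0 hg ?_ ?_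
  · refine EventuallyEq.trans ?_ h
    filter_upwards [hX.ae_excess_ne_top hp n] with ω hω
    have hω' := ne_top_of_le_ne_top hω
      (Params.excess_le hp c hs (observed_dist_nonneg (X := X) n ω))
    rw [ENNReal.toReal_mul, ENNReal.toReal_ofReal (Real.exp_pos _).le,
      ENNReal.toReal_add ENNReal.ofReal_ne_top hω', ENNReal.toReal_ofReal hR0.le]
  · have hle : ∀ ω, ENNReal.ofReal
        (Real.exp (-p.successExponent c s p.R₀ (X.observed p n ω))) *
        (ENNReal.ofReal p.R₀ + p.excess c s (X.observed p n ω)) ≤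
        ENNReal.ofReal p.R₀ + p.excess c 0 (X.observed p n ω) := by
      intro ω
      refine (mul_le_of_le_one_left zero_le ?_).trans (add_le_add le_rfl
        (Params.excess_le hp c hs (observed_dist_nonneg (X := X) n ω)))
      rw [← ENNReal.ofReal_one]
      refine ENNReal.ofReal_le_ofReal (Real.exp_le_one_iff.2 (neg_nonpos.2 ?_))
      exact Params.successExponent_nonneg hp hc0 hc1 hX.pa_nonneg hs hR0.le
        (observed_dist_nonneg n ω)
    refine ne_top_of_le_ne_top ?_ (lintegral_mono hle)
    rw [lintegral_add_left measurable_const]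
    exact ENNReal.add_ne_top.2 ⟨by simp, hX.lintegral_excess_ne_top hp n⟩
  · rintro B ⟨B', hB', rfl⟩
    have hB : MeasurableSet (X.observed p n ⁻¹' B') := hT hB'
    change ∫⁻ ω in X.observed p n ⁻¹' B', _ ∂μ = ∫⁻ ω in X.observed p n ⁻¹' B', _ ∂μ
    rw [lintegral_eq_lintegral_meas_le _ (Eventually.of_forall hf0) hfm.restrict]
    have hmeas : ∀ t ∈ Set.Ioi (0 : ℝ), μ.restrict (X.observed p n ⁻¹' B') {ω | t ≤ f ω} =
        ∫⁻ ω in X.observed p n ⁻¹' B', ENNReal.ofReal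
          (Real.exp (-p.successExponent c s (max t p.R₀) (X.observed p n ω))) ∂μ := by
      intro t ht
      have ht0 : (0 : ℝ) < t := ht
      -- `f` is either zero or at least `R₀`, so a positive level `t` is reached exactly when the
      -- rate reaches `max t R₀`.
      have hset : {ω | t ≤ f ω} = {ω | max t p.R₀ ≤ X.rate p s n ω} := by
        ext ω
        by_cases hω : ω ∈ X.success p s n
        · have hω' : p.R₀ ≤ X.rate p s n ω := hω
          have : f ω = X.rate p s n ω := Set.indicator_of_mem hω _
          simp [this, hω']
        · have hω' : ¬ p.R₀ ≤ X.rate p s n ω := hω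
          have : f ω = 0 := Set.indicator_of_notMem hω _
          simp [this, hω', ht0]
      have hset0 : NullMeasurableSet {ω | max t p.R₀ ≤ X.rate p s n ω}
          (μ.restrict (X.observed p n ⁻¹' B')) :=
        nullMeasurableSet_le aemeasurable_const hR.restrict
      have h1 := hX.lintegral_rate hp n (ht0.le.trans (le_max_left t p.R₀)) hs
        (measurable_one.indicator hB')
      rw [hset, ← lintegral_indicator_one₀ hset0, ← lintegral_indicator hB, ← lintegral_indicator hB]
      refine Eq.trans (lintegral_congr fun ω => ?_) (h1.trans (lintegral_congr fun ω => ?_))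
      · by_cases hωB : X.observed p n ω ∈ B' <;>
          by_cases hω : max t p.R₀ ≤ X.rate p s n ω <;>
          simp only [Set.indicator, Set.mem_preimage, Set.mem_ofPred_eq, hωB, hω, if_true,
            if_false] <;> rfl
      · by_cases hωB : X.observed p n ω ∈ B' <;> simp [Set.indicator, hωB, hc]
    have hj : Measurable fun x : ℝ × Ω => ENNReal.ofReal (Real.exp
        (-p.successExponent c s (max x.1 p.R₀) (X.observed p n x.2))) := by
      have h1 : Measurable fun x : ℝ × Ω =>
          p.successExponent c s (max x.1 p.R₀) (X.observed p n x.2) :=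
        Params.measurable_successExponent c s (measurable_fst.max measurable_const)
          (hT.comp measurable_snd)
      exact h1.neg.exp.ennreal_ofReal
    rw [setLIntegral_congr_fun measurableSet_Ioi hmeas, lintegral_lintegral_swap
      (f := fun t ω => ENNReal.ofReal (Real.exp
        (-p.successExponent c s (max t p.R₀) (X.observed p n ω)))) hj.aemeasurable]
    refine lintegral_congr fun ω => ?_
    set q := X.observed p n ω
    -- Levels up to `R₀` all carry the success probability and give the term `R₀`; the levels above
    -- give the excess, once the success probability is factored out.
    have hsplit : Set.Ioi (0 : ℝ) = Set.Ioc 0 p.R₀ ∪ Set.Ioi p.R₀ :=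
      (Set.Ioc_union_Ioi_eq_Ioi hR0.le).symm
    have h1 : ∀ t ∈ Set.Ioc 0 p.R₀, ENNReal.ofReal
        (Real.exp (-p.successExponent c s (max t p.R₀) q)) =
        ENNReal.ofReal (Real.exp (-p.successExponent c s p.R₀ q)) := by
      intro t ht
      rw [max_eq_right ht.2]
    have h2 : ∀ t ∈ Set.Ioi p.R₀, ENNReal.ofReal
        (Real.exp (-p.successExponent c s (max t p.R₀) q)) =
        ENNReal.ofReal (Real.exp (-p.successExponent c s p.R₀ q)) * ENNReal.ofReal
          (Real.exp (-(p.successExponent c s t q - p.successExponent c s p.R₀ q))) := by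
      intro t ht
      rw [max_eq_left (le_of_lt ht), ← ENNReal.ofReal_mul (Real.exp_pos _).le, ← Real.exp_add]
      congr 2
      ring
    rw [hsplit, lintegral_union measurableSet_Ioi (Set.Ioc_disjoint_Ioi le_rfl),
      setLIntegral_congr_fun measurableSet_Ioc h1, setLIntegral_congr_fun measurableSet_Ioi h2,
      lintegral_const_mul' _ _ ENNReal.ofReal_ne_top, setLIntegral_const, Real.volume_Ioc, sub_zero,
      mul_add]
    rfl

/-- The conditional success probability is positive and cancels in the quotient, leaving `R₀` plus
the mean excess; only the association event remains to be averaged over. -/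
theorem sucRate_eq (hX : X.Law p μ) (hp : p.Valid) (n : ℕ) (k : Tier) {s : ℝ} (hs : 0 ≤ s) :
    X.sucRate p μ s n k = p.share (storeProb p n) k * p.R₀ +
      (∫⁻ ω in {ω | X.servingTier p n ω = k},
        p.excess (storeProb p n) s (X.observed p n ω) ∂μ).toReal := by
  have hm : ∀ s, Measurable fun ω => p.excess (storeProb p n) s (X.observed p n ω) :=
    fun s => (Params.measurable_excess _ s).comp (hX.measurable_observed n)
  have hle := fun ω => Params.excess_le hp (storeProb p n) hs
    (observed_dist_nonneg (X := X) (p := p) n ω)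
  have hfin : ∫⁻ ω in {ω | X.servingTier p n ω = k},
      p.excess (storeProb p n) s (X.observed p n ω) ∂μ ≠ ⊤ :=
    ne_top_of_le_ne_top (hX.lintegral_excess_ne_top hp n)
      ((setLIntegral_le_lintegral _ _).trans (lintegral_mono hle))
  rw [sucRate]
  have hae : ∀ᵐ ω ∂(μ.restrict {ω | X.servingTier p n ω = k}),
      (μ[(X.success p s n).indicator (X.rate p s n) | X.info p n]) ω /
        (μ[(X.success p s n).indicator (fun _ => (1 : ℝ)) | X.info p n]) ω =
      p.R₀ + (p.excess (storeProb p n) s (X.observed p n ω)).toReal := by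
    refine ae_restrict_of_ae ?_
    filter_upwards [hX.condExp_success hp n hs, hX.condExp_rate hp n hs] with ω h1 h2
    rw [← h1, ← h2, mul_div_cancel_left₀ _ (Real.exp_pos _).ne']
  rw [integral_congr_ae hae, integral_add (integrable_const _)
    (integrable_toReal_of_lintegral_ne_top (hm s).aemeasurable hfin),
    integral_toReal (hm s).aemeasurable (ae_lt_top (hm s) hfin), setIntegral_const, smul_eq_mul]
  congr 2
  exact hX.assocProb_eq_share hp n k

theorem sucRate_zero (hX : X.Law p μ) (hp : p.Valid) (n : ℕ) (k : Tier) :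
    X.sucRate p μ 0 n k = p.share (storeProb p n) k * p.R₀ +
      ∫ r in Set.Ioi p.R₀, ∑' l, p.rateTerm (storeProb p n) k r l := by
  rw [hX.sucRate_eq hp n k le_rfl, hX.setLIntegral_excess hp n k,
    (Params.lintegral_tsum_rateTerm hp (hX.storeProb_nonneg n) (hX.storeProb_le_one n)
      hX.pa_nonneg k).2]

/-- The excess under noise is dominated by the noiseless one, which is integrable. Dominated
convergence is applied twice, over `r` inside `tendsto_excess` and over the sample space here. -/
theorem tendsto_sucRate (hX : X.Law p μ) (hp : p.Valid) (n : ℕ) (k : Tier) :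
    Tendsto (fun s => X.sucRate p μ s n k) (𝓝[>] 0) (𝓝 (X.sucRate p μ 0 n k)) := by
  have hm : ∀ s, Measurable fun ω => p.excess (storeProb p n) s (X.observed p n ω) :=
    fun s => (Params.measurable_excess _ s).comp (hX.measurable_observed n)
  have hfin : ∫⁻ ω in {ω | X.servingTier p n ω = k},
      p.excess (storeProb p n) 0 (X.observed p n ω) ∂μ ≠ ⊤ :=
    ne_top_of_le_ne_top (hX.lintegral_excess_ne_top hp n) (setLIntegral_le_lintegral _ _)
  have hlim : Tendsto (fun s => ∫⁻ ω in {ω | X.servingTier p n ω = k},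
      p.excess (storeProb p n) s (X.observed p n ω) ∂μ) (𝓝[>] 0)
      (𝓝 (∫⁻ ω in {ω | X.servingTier p n ω = k},
        p.excess (storeProb p n) 0 (X.observed p n ω) ∂μ)) := by
    refine tendsto_lintegral_filter_of_dominated_convergence _ (Eventually.of_forall hm) ?_ hfin ?_
    · filter_upwards [self_mem_nhdsWithin] with s hs
      exact Eventually.of_forall fun ω => Params.excess_le hp _ (le_of_lt hs)
        (observed_dist_nonneg n ω)
    · refine ae_restrict_of_ae ?_
      filter_upwards [hX.ae_excess_ne_top hp n] with ω hω
      exact Params.tendsto_excess hp _ (observed_dist_nonneg n ω) hω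
  rw [hX.sucRate_eq hp n k le_rfl]
  refine Tendsto.congr' ?_ (((ENNReal.tendsto_toReal hfin).comp hlim).const_add _)
  filter_upwards [self_mem_nhdsWithin] with s hs
  exact (hX.sucRate_eq hp n k (le_of_lt hs)).symm

lemma accessProb_eq (hX : X.Law p μ) (hp : p.Valid) (n : ℕ) (k : Tier) {s : ℝ} (hs : 0 ≤ s) :
    X.accessProb p μ s n k = (∫⁻ ω in {ω | X.servingTier p n ω = k}, ENNReal.ofReal
      (Real.exp (-p.successExponent (storeProb p n) s p.R₀ (X.observed p n ω))) ∂μ).toReal := by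
  have hB : MeasurableSet {q : Tier × ℝ × ℕ | q.1 = k} :=
    measurable_fst (measurableSet_singleton k)
  have h1 := hX.lintegral_rate hp n hp.R₀_pos.le hs
    (measurable_one.indicator hB (f := fun _ => (1 : ℝ≥0∞)))
  have hset : NullMeasurableSet {ω | p.R₀ ≤ X.rate p s n ω ∧ X.servingTier p n ω = k} μ :=
    (nullMeasurableSet_le aemeasurable_const (hX.aemeasurable_rate hp s n)).inter
      (hX.measurableSet_tier n k).nullMeasurableSet
  rw [accessProb, Measure.real]
  congr 1
  rw [← lintegral_indicator_one₀ hset, ← lintegral_indicator (hX.measurableSet_tier n k)]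
  refine Eq.trans (lintegral_congr fun ω => ?_) (h1.trans (lintegral_congr fun ω => ?_))
  · by_cases hωB : X.servingTier p n ω = k <;> by_cases hω : p.R₀ ≤ X.rate p s n ω <;>
      simp [Set.indicator, observed, hωB, hω]
  · by_cases hωB : X.servingTier p n ω = k <;> simp [Set.indicator, observed, hωB]

theorem accessProb_zero (hX : X.Law p μ) (hp : p.Valid) (n : ℕ) (k : Tier) :
    X.accessProb p μ 0 n k = ∑' l, p.accessTerm (storeProb p n) k l := by
  have hc0 := hX.storeProb_nonneg n
  have hc1 := hX.storeProb_le_one n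
  rw [hX.accessProb_eq hp n k le_rfl, hX.setLIntegral_exp_sub hp n k
    (a := fun l => p.rateK (storeProb p n) k (p.δ p.R₀ l))
    (fun l => Params.rateK_pos hp hc0 hc1 hX.pa_nonneg k (p.δ_nonneg hp hp.R₀_pos.le l))
    (g := fun q => ENNReal.ofReal (Real.exp (-p.successExponent (storeProb p n) 0 p.R₀ q)))
    (Params.measurable_successExponent_left _ 0 p.R₀).neg.exp.ennreal_ofReal]
  · have h0 := Params.accessTerm_nonneg hp hc0 hc1 hX.pa_nonneg k
    change (∑' l, ENNReal.ofReal (p.accessTerm (storeProb p n) k l)).toReal = _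
    rw [← ENNReal.ofReal_tsum_of_nonneg h0
      (Params.summable_accessTerm hp hc0 hc1 hX.pa_nonneg k),
      ENNReal.toReal_ofReal (tsum_nonneg h0)]
  · intro u hu l
    simp only [Params.successExponent, Nat.add_sub_cancel, pi_mul_sq_sqrt hu]
    congr 3
    ring

theorem tendsto_accessProb (hX : X.Law p μ) (hp : p.Valid) (n : ℕ) (k : Tier) :
    Tendsto (fun s => X.accessProb p μ s n k) (𝓝[>] 0) (𝓝 (X.accessProb p μ 0 n k)) := by
  have hm : ∀ s, Measurable fun ω => ENNReal.ofReal
      (Real.exp (-p.successExponent (storeProb p n) s p.R₀ (X.observed p n ω))) :=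
    fun s => (Params.measurable_successExponent _ s measurable_const
      (hX.measurable_observed n)).neg.exp.ennreal_ofReal
  have hle : ∀ s, 0 ≤ s → ∀ ω, ENNReal.ofReal
      (Real.exp (-p.successExponent (storeProb p n) s p.R₀ (X.observed p n ω))) ≤ 1 := by
    intro s hs ω
    rw [← ENNReal.ofReal_one]
    refine ENNReal.ofReal_le_ofReal (Real.exp_le_one_iff.2 (neg_nonpos.2 ?_))
    exact Params.successExponent_nonneg hp (hX.storeProb_nonneg n) (hX.storeProb_le_one n)
      hX.pa_nonneg hs hp.R₀_pos.le (observed_dist_nonneg n ω)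
  have hone : ∫⁻ _ in {ω | X.servingTier p n ω = k}, (1 : ℝ≥0∞) ∂μ ≠ ⊤ := by simp
  have hlim : Tendsto (fun s => ∫⁻ ω in {ω | X.servingTier p n ω = k}, ENNReal.ofReal
      (Real.exp (-p.successExponent (storeProb p n) s p.R₀ (X.observed p n ω))) ∂μ) (𝓝[>] 0)
      (𝓝 (∫⁻ ω in {ω | X.servingTier p n ω = k}, ENNReal.ofReal
        (Real.exp (-p.successExponent (storeProb p n) 0 p.R₀ (X.observed p n ω))) ∂μ)) := by
    refine tendsto_lintegral_filter_of_dominated_convergence _ (Eventually.of_forall hm) ?_ hone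
      (Eventually.of_forall fun ω => ?_)
    · filter_upwards [self_mem_nhdsWithin] with s hs
      exact Eventually.of_forall (hle s (le_of_lt hs))
    · refine Tendsto.mono_left ?_ nhdsWithin_le_nhds
      have hc : Continuous fun s => ENNReal.ofReal
          (Real.exp (-p.successExponent (storeProb p n) s p.R₀ (X.observed p n ω))) := by
        refine ENNReal.continuous_ofReal.comp ?_
        unfold Params.successExponent
        fun_prop
      exact hc.tendsto 0
  rw [hX.accessProb_eq hp n k le_rfl]
  have hfin := ne_top_of_le_ne_top hone (lintegral_mono (μ := μ.restrict
    {ω | X.servingTier p n ω = k}) (hle 0 le_rfl))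
  refine Tendsto.congr' ?_ ((ENNReal.tendsto_toReal hfin).comp hlim)
  filter_upwards [self_mem_nhdsWithin] with s hs
  exact (hX.accessProb_eq hp n k (le_of_lt hs)).symm

end Law

end Elements

namespace Elements

variable {Ω : Type*} {X : Elements Ω} {p : Params} [mΩ : MeasurableSpace Ω] {μ : Measure Ω}

/-! ### The backhaul link -/

/-- The other users among `0, …, l - 1` that need the backhaul link. -/
def missSet (X : Elements Ω) (l : ℕ) (ω : Ω) : Finset ℕ :=
  (Finset.range l).filter fun i => X.miss i ω = true

/-- The tagged user is picked, in competition with the first `l` other users. -/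
def pickedEvent (X : Elements Ω) (l : ℕ) : Set Ω := {ω | 0 ∈ X.pick (X.missSet l ω).card ω}

/-- The load `l + 1` counts the tagged user, so `l` others may compete. Since `R₀ > 0`, the zero
rate is a failure. -/
lemma le_backhaulRate_iff (hp : p.Valid) {ω : Ω} {l : ℕ} (hl : X.load 0 ω = l + 1) :
    p.R₀ ≤ X.backhaulRate p ω ↔ ω ∈ X.pickedEvent l := by
  have hm : X.missCount ω = (X.missSet l ω).card := by rw [missCount, hl, missSet, Nat.add_sub_cancel]
  rw [backhaulRate, hm]
  change _ ↔ 0 ∈ X.pick (X.missSet l ω).card ω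
  split_ifs with h
  · simp [h]
  · simp [h, hp.R₀_pos]

lemma measurableSet_missSet {S : Set Source} (hS : ∀ i, Source.miss i ∈ S) (l : ℕ)
    (T : Finset ℕ) : MeasurableSet[X.sigmaOf S] {ω | X.missSet l ω = T} := by
  have h1 : ∀ i, MeasurableSet[X.sigmaOf S] {ω | X.miss i ω = true} := fun i =>
    sigma_le_sigmaOf (X := X) (hS i) _ ⟨{true}, trivial, rfl⟩
  have : {ω | X.missSet l ω = T} = ⋂ i : ℕ, {ω | (i < l ∧ X.miss i ω = true) ↔ i ∈ T} := by
    ext ω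
    simp [missSet, Finset.ext_iff]
  rw [this]
  refine MeasurableSet.iInter fun i => ?_
  by_cases hi : i < l <;> by_cases hT : i ∈ T <;> simp only [hi, hT, true_and, false_and, iff_true,
    iff_false]
  · exact h1 i
  · exact (h1 i).compl
  · exact MeasurableSet.const _
  · exact MeasurableSet.const _

lemma measurableSet_mem_pick {S : Set Source} {m : ℕ} (hS : Source.pick m ∈ S) :
    MeasurableSet[X.sigmaOf S] {ω | 0 ∈ X.pick m ω} :=
  sigma_le_sigmaOf (X := X) hS _ ⟨{A | 0 ∈ A}, trivial, rfl⟩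

/-- Splitting by the set of competitors, rather than by their number only, makes each piece an
intersection of two events from independent sources. -/
lemma pickedEvent_eq_biUnion (l : ℕ) : X.pickedEvent l =
    ⋃ T ∈ (Finset.range l).powerset, ({ω | X.missSet l ω = T} ∩ {ω | 0 ∈ X.pick T.card ω}) := by
  ext ω
  simp only [pickedEvent, Set.mem_ofPred_eq, Set.mem_iUnion, Set.mem_inter_iff, exists_prop,
    Finset.mem_powerset]
  constructor
  · exact fun h => ⟨X.missSet l ω, Finset.filter_subset _ _, rfl, h⟩
  · rintro ⟨T, -, rfl, h⟩
    exact h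

lemma measurableSet_pickedEvent {S : Set Source} (h1 : ∀ i, Source.miss i ∈ S)
    (h2 : ∀ m, Source.pick m ∈ S) (l : ℕ) : MeasurableSet[X.sigmaOf S] (X.pickedEvent l) := by
  rw [pickedEvent_eq_biUnion]
  exact Finset.measurableSet_biUnion _ fun T _ =>
    (measurableSet_missSet h1 l T).inter (measurableSet_mem_pick (h2 _))

lemma measurableSet_load {S : Set Source} {k : Tier} (hS : Source.load k ∈ S) (l : ℕ) :
    MeasurableSet[X.sigmaOf S] {ω | X.load k ω = l} :=
  sigma_le_sigmaOf (X := X) hS _ ⟨{l}, trivial, rfl⟩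

lemma measurableSet_tier_sigmaOf {S : Set Source} (h1 : ∀ k, Source.pos k ∈ S)
    (h2 : ∀ j, Source.cache j ∈ S) (n : ℕ) (k : Tier) :
    MeasurableSet[X.sigmaOf S] {ω | X.servingTier p n ω = k} := by
  have h : Measurable[X.sigmaOf S] (X.serving p n) :=
    Elements.measurable_serving (m := X.sigmaOf S)
      (fun k j => Elements.measurable_pos (h1 k) j)
      (fun b => Elements.measurable_stores (fun _ => h2 _) n)
  exact h (measurable_fst (measurableSet_singleton k))

variable [IsProbabilityMeasure μ]

lemma cond_real_apply {A : Set Ω} (hA : MeasurableSet A) (B : Set Ω) :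
    (cond μ A).real B = (μ.real A)⁻¹ * μ.real (A ∩ B) := by
  rw [Measure.real, cond_apply hA, ENNReal.toReal_mul, ENNReal.toReal_inv]
  rfl

namespace Law

lemma measureReal_inter (hX : X.Law p μ) {S T : Set Source} (h : Disjoint S T) {A B : Set Ω}
    (hA : MeasurableSet[X.sigmaOf S] A) (hB : MeasurableSet[X.sigmaOf T] B) :
    μ.real (A ∩ B) = μ.real A * μ.real B := by
  rw [Measure.real, (Indep_iff _ _ μ).1 (hX.indep_sigmaOf h) A B hA hB, ENNReal.toReal_mul]
  rfl

lemma measureReal_missSet (hX : X.Law p μ) (l : ℕ) {T : Finset ℕ} (hT : T ⊆ Finset.range l) :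
    μ.real {ω | X.missSet l ω = T} = (1 - p.pb) ^ (l - T.card) * p.pb ^ T.card := by
  classical
  have hm : ∀ i, MeasurableSet {ω | X.miss i ω = true} := fun i =>
    hX.sigma_le (.miss i) _ ⟨{true}, trivial, rfl⟩
  let A : Source → Set Ω := fun s => match s with
    | .miss i => if i ∈ T then {ω | X.miss i ω = true} else {ω | X.miss i ω = true}ᶜ
    | _ => Set.univ
  have hinj : Function.Injective Source.miss := fun i j h => Source.miss.inj h
  have hset : {ω | X.missSet l ω = T} =
      ⋂ s ∈ (Finset.range l).map ⟨Source.miss, hinj⟩, A s := by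
    ext ω
    simp only [Set.mem_ofPred_eq, missSet, Set.mem_iInter, Finset.mem_map,
      Function.Embedding.coeFn_mk, forall_exists_index, and_imp, forall_apply_eq_imp_iff₂,
      Finset.mem_range]
    constructor
    · rintro rfl i hi
      by_cases h : X.miss i ω = true
      · simp [A, h, hi]
      · simp [A, h]
    · intro h
      ext i
      rw [Finset.mem_filter, Finset.mem_range]
      by_cases hi : i < l
      · have := h i hi
        by_cases hiT : i ∈ T
        · simp only [A, hiT, if_true] at this
          simp only [hi, hiT, true_and, iff_true]
          exact this
        · simp only [A, hiT, if_false] at this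
          simp only [hi, hiT, true_and, iff_false]
          exact this
      · have : i ∉ T := fun hiT => hi (Finset.mem_range.1 (hT hiT))
        simp [hi, this]
  have hA : ∀ s ∈ (Finset.range l).map ⟨Source.miss, hinj⟩, MeasurableSet[X.sigma s] (A s) := by
    intro s hs
    obtain ⟨i, -, rfl⟩ := Finset.mem_map.1 hs
    have h1 : MeasurableSet[X.sigma (.miss i)] {ω | X.miss i ω = true} := ⟨{true}, trivial, rfl⟩
    change MeasurableSet[X.sigma (.miss i)]
      (if i ∈ T then {ω | X.miss i ω = true} else {ω | X.miss i ω = true}ᶜ)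
    split_ifs
    · exact h1
    · exact h1.compl
  rw [hset, Measure.real, hX.indep.meas_biInter hA, ENNReal.toReal_prod, Finset.prod_map]
  have hval : ∀ i ∈ Finset.range l, (μ (A (.miss i))).toReal =
      if i ∈ T then p.pb else 1 - p.pb := by
    intro i _
    simp only [A]
    split_ifs
    · exact hX.miss_law i
    · change μ.real _ = _
      rw [probReal_compl_eq_one_sub (hm i), hX.miss_law i]
  refine (Finset.prod_congr rfl hval).trans ?_
  rw [Finset.prod_ite, Finset.prod_const, Finset.prod_const, mul_comm]
  have h1 : (Finset.range l).filter (fun i => i ∈ T) = T := by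
    ext i
    simp only [Finset.mem_filter, and_iff_right_iff_imp]
    exact fun h => hT h
  have h2 : ((Finset.range l).filter fun i => i ∉ T).card = l - T.card := by
    rw [Finset.filter_notMem_eq_sdiff, Finset.card_sdiff_of_subset hT, Finset.card_range]
  rw [h1, h2]

/-- Among the subsets of size `N` of `m + 1` labels, the fraction containing `0` is `N / (m + 1)`,
by `(m + 1) C(m, N - 1) = N C(m + 1, N)`. -/
lemma measureReal_mem_pick (hX : X.Law p μ) (m : ℕ) :
    μ.real {ω | 0 ∈ X.pick m ω} = min 1 ((p.Nb : ℝ) / ((m : ℝ) + 1)) := by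
  classical
  set N := min p.Nb (m + 1) with hN
  set P := Finset.powersetCard N (Finset.range (m + 1)) with hP
  have hms : ∀ A : Finset ℕ, MeasurableSet {ω | X.pick m ω = A} := fun A =>
    hX.sigma_le (.pick m) _ ⟨{A}, trivial, rfl⟩
  have hsum : ∀ Q ⊆ P, μ.real (⋃ A ∈ Q, {ω | X.pick m ω = A}) =
      Q.card / ((m + 1).choose N : ℝ) := by
    intro Q hQ
    rw [measureReal_biUnion_finset]
    · rw [Finset.sum_congr rfl fun A hA => hX.pick_law m A (hQ hA), Finset.sum_const, nsmul_eq_mul,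
        mul_one_div]
    · intro A _ B _ hAB
      exact Set.disjoint_left.2 fun ω h1 h2 => hAB (h1.symm.trans h2)
    · exact fun A _ => hms A
  have hpos : (0 : ℝ) < (m + 1).choose N := by
    exact_mod_cast Nat.choose_pos (min_le_right _ _)
  have hone : μ.real (⋃ A ∈ P, {ω | X.pick m ω = A}) = 1 := by
    rw [hsum P subset_rfl, hP, Finset.card_powersetCard, Finset.card_range, div_self hpos.ne']
  -- Only the masses of sets of the right size are prescribed; they add up to one, so all other sets
  -- are null.
  have hfull : ∀ᵐ ω ∂μ, ω ∈ ⋃ A ∈ P, {ω | X.pick m ω = A} := by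
    refine mem_ae_iff_prob_eq_one (Finset.measurableSet_biUnion _ fun A _ => hms A) |>.2 ?_
    rw [← ENNReal.toReal_eq_one_iff]
    exact hone
  have hae : {ω | 0 ∈ X.pick m ω} =ᵐ[μ] ⋃ A ∈ P.filter (fun A => 0 ∈ A), {ω | X.pick m ω = A} := by
    filter_upwards [hfull] with ω hω
    refine propext ?_
    change 0 ∈ X.pick m ω ↔ ω ∈ ⋃ A ∈ P.filter (fun A => 0 ∈ A), {ω | X.pick m ω = A}
    simp only [Set.mem_iUnion, Set.mem_ofPred_eq, exists_prop, exists_eq_right',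
      Finset.mem_filter] at hω ⊢
    exact ⟨fun h => ⟨hω, h⟩, fun h => h.2⟩
  rw [measureReal_congr hae, hsum _ (Finset.filter_subset _ _)]
  have hcount : ((P.filter fun A => 0 ∈ A).card : ℝ) * (m + 1) = (m + 1).choose N * N := by
    -- `N = 0` occurs when the backhaul capacity is below the rate demand.
    rcases Nat.eq_zero_or_pos N with h0 | h0
    · have : P.filter (fun A => 0 ∈ A) = ∅ := by
        rw [hP, h0, Finset.powersetCard_zero]
        rfl
      rw [this, h0]
      simp
    · obtain ⟨N', hN'⟩ : ∃ N', N = N' + 1 := ⟨N - 1, by omega⟩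
      -- Counted through the complement: the sets avoiding `0`, subtracted by means of Pascal's
      -- rule.
      have hcard : (P.filter fun A => 0 ∈ A).card = m.choose N' := by
        have h1 : (P.filter fun A => ¬ 0 ∈ A).card = m.choose N := by
          have : P.filter (fun A => ¬ 0 ∈ A) =
              Finset.powersetCard N ((Finset.range (m + 1)).erase 0) := by
            ext A
            simp only [hP, Finset.mem_filter, Finset.mem_powersetCard, Finset.subset_erase]
            tauto
          rw [this, Finset.card_powersetCard, Finset.card_erase_of_mem (by simp),
            Finset.card_range, Nat.add_sub_cancel]
        have h2 := Finset.card_filter_add_card_filter_not (s := P) (fun A => 0 ∈ A)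
        rw [h1, hP, Finset.card_powersetCard, Finset.card_range, hN', Nat.choose_succ_succ'] at h2
        rw [hP, hN']
        omega
      rw [hcard, hN']
      have := Nat.add_one_mul_choose_eq m N'
      have h3 : ((m : ℝ) + 1) * m.choose N' = (m + 1).choose (N' + 1) * ((N' : ℝ) + 1) := by
        exact_mod_cast this
      push_cast
      linarith
  have hm1 : (0 : ℝ) < (m : ℝ) + 1 := by positivity
  have hNr : (N : ℝ) / ((m : ℝ) + 1) = min 1 ((p.Nb : ℝ) / ((m : ℝ) + 1)) := by
    rw [hN, Nat.cast_min, Nat.cast_add_one, ← min_div_div_right hm1.le, div_self hm1.ne', min_comm]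
  rw [← hNr, div_eq_div_iff hpos.ne' hm1.ne', hcount, mul_comm]

/-- The probabilities depend on the set of competitors only through its cardinality; grouping by
cardinality produces the binomial coefficients. -/
lemma measureReal_pickedEvent (hX : X.Law p μ) (l : ℕ) :
    μ.real (X.pickedEvent l) = p.backhaulAt l := by
  have hdisj : Disjoint {s | ∃ i, s = Source.miss i} {s | ∃ m, s = Source.pick m} := by
    refine Set.disjoint_left.2 ?_
    rintro s ⟨i, rfl⟩ ⟨m, h⟩
    cases h
  have hS1 : ∀ i, Source.miss i ∈ {s | ∃ i, s = Source.miss i} := fun i => ⟨i, rfl⟩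
  have hS2 : ∀ m, Source.pick m ∈ {s | ∃ m, s = Source.pick m} := fun m => ⟨m, rfl⟩
  rw [pickedEvent_eq_biUnion, measureReal_biUnion_finset]
  · have h : ∀ T ∈ (Finset.range l).powerset,
        μ.real ({ω | X.missSet l ω = T} ∩ {ω | 0 ∈ X.pick T.card ω}) =
        (1 - p.pb) ^ (l - T.card) * p.pb ^ T.card *
          min 1 ((p.Nb : ℝ) / ((T.card : ℝ) + 1)) := by
      intro T hT
      rw [hX.measureReal_inter hdisj (measurableSet_missSet hS1 l T)
        (measurableSet_mem_pick (hS2 _)), hX.measureReal_missSet l (Finset.mem_powerset.1 hT),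
        hX.measureReal_mem_pick]
    rw [Finset.sum_congr rfl h, Finset.sum_powerset_apply_card
      (fun m => (1 - p.pb) ^ (l - m) * p.pb ^ m * min 1 ((p.Nb : ℝ) / ((m : ℝ) + 1))),
      Finset.card_range, Params.backhaulAt]
    refine Finset.sum_congr rfl fun m _ => ?_
    rw [nsmul_eq_mul]
    ring
  · intro T _ T' _ hTT
    exact Set.disjoint_left.2 fun ω h1 h2 => hTT (h1.1.symm.trans h2.1)
  · exact fun T _ => (hX.sigmaOf_le _ _ (measurableSet_missSet hS1 l T)).inter
      (hX.sigmaOf_le _ _ (measurableSet_mem_pick (hS2 _)))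

lemma share_zero_pos (hp : p.Valid) (hX : X.Law p μ) (n : ℕ) :
    0 < p.share (storeProb p n) 0 := by
  refine div_pos (mul_pos (hp.lam_pos 0) ?_) (Params.rateK_zero_pos hp (hX.storeProb_nonneg n) 0)
  simp [Params.candProb]

lemma loadPMF_pos (hp : p.Valid) {k : Tier} (hA : 0 < p.A k) (l : ℕ) : 0 < p.loadPMF k l := by
  have h2 := hp.lam_pos k
  have h3 := hp.lamU_pos
  have h4 : 0 < Real.Gamma ((l : ℝ) + 4.5) := Real.Gamma_pos_of_pos (by positivity)
  have h5 : 0 < Real.Gamma 3.5 := Real.Gamma_pos_of_pos (by norm_num)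
  unfold Params.loadPMF
  positivity

lemma QLp_pos (hp : p.Valid) : 0 < p.QLp := by
  have hN := hp.N₁_lt
  refine Finset.sum_pos' (fun n _ => Params.q_nonneg n)
    ⟨p.N, Finset.mem_Icc.2 ⟨by omega, le_rfl⟩, ?_⟩
  have hN0 : (0 : ℝ) < (p.N : ℝ) := by
    have : 0 < p.N := by omega
    exact_mod_cast this
  unfold Params.q
  refine div_pos (Real.rpow_pos_of_pos hN0 _) (Finset.sum_pos' (fun i _ => by positivity)
    ⟨p.N, Finset.mem_Icc.2 ⟨by omega, le_rfl⟩, Real.rpow_pos_of_pos hN0 _⟩)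

/-- Gives the load masses of the MBS tier positive values, so that conditioning on the load is not
degenerate. -/
lemma A_zero_pos (hp : p.Valid) : 0 < p.A 0 := by
  have h1 : 0 ≤ p.QMp := Finset.sum_nonneg fun n _ => Params.q_nonneg n
  have h2 : 0 < p.ALp 0 := by
    rw [Params.ALp]
    have h := fun k => mul_pos (Params.lam'_pos hp k)
      (Real.rpow_pos_of_pos (hp.P_pos k) (2 / p.α))
    exact div_pos (h 0) (Finset.sum_pos (fun k _ => h k) Finset.univ_nonempty)
  rw [Params.A, if_pos rfl]
  exact add_pos_of_nonneg_of_pos h1 (mul_pos (QLp_pos hp) h2)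

/-- The sources of randomness of the association. -/
def assocSources : Set Source := {s | (∃ k, s = .pos k) ∨ ∃ j, s = .cache j}

lemma measurableSet_tier_assoc (n : ℕ) (k : Tier) :
    MeasurableSet[X.sigmaOf assocSources] {ω | X.servingTier p n ω = k} :=
  measurableSet_tier_sigmaOf (fun k => Or.inl ⟨k, rfl⟩) (fun j => Or.inr ⟨j, rfl⟩) n k

lemma load_notMem : Source.load 0 ∈ assocSourcesᶜ := by
  rintro (⟨k, h⟩ | ⟨j, h⟩) <;> cases h

lemma measurableSet_pickedEvent_compl (l : ℕ) :
    MeasurableSet[X.sigmaOf assocSourcesᶜ] (X.pickedEvent l) := by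
  refine measurableSet_pickedEvent (fun i => ?_) (fun m => ?_) l <;>
    rintro (⟨k, h⟩ | ⟨j, h⟩) <;> cases h

lemma measureReal_load_inter_pickedEvent (hX : X.Law p μ) (l : ℕ) :
    μ.real ({ω | X.load 0 ω = l + 1} ∩ X.pickedEvent l) = p.loadPMF 0 l * p.backhaulAt l := by
  rw [hX.measureReal_inter (S := {Source.load 0}) (T := {Source.load 0}ᶜ) disjoint_compl_right
    (measurableSet_load (Set.mem_singleton _) (l + 1))
    (measurableSet_pickedEvent (fun i => by simp) (fun m => by simp) l),
    hX.measureReal_pickedEvent, hX.load_law]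

/-- The association depends on positions and caches alone, while load, misses and picks come from
other sources. The probabilities of tier and load therefore cancel in the conditional probability.
-/
theorem backhaulProbAt_eq (hX : X.Law p μ) (hp : p.Valid) (n l : ℕ) :
    X.backhaulProbAt p μ n l = p.backhaulAt l := by
  have hD := hX.measurableSet_tier_load n 0 l
  have hload := measurableSet_load (X := X) load_notMem (l + 1)
  have hset : {ω | X.servingTier p n ω = 0 ∧ X.load 0 ω = l + 1} ∩
      {ω | p.R₀ ≤ X.backhaulRate p ω} =
      {ω | X.servingTier p n ω = 0} ∩ ({ω | X.load 0 ω = l + 1} ∩ X.pickedEvent l) := by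
    ext ω
    constructor
    · rintro ⟨⟨h1, h2⟩, h3⟩
      exact ⟨h1, h2, (le_backhaulRate_iff hp h2).1 h3⟩
    · rintro ⟨h1, h2, h3⟩
      exact ⟨⟨h1, h2⟩, (le_backhaulRate_iff hp h2).2 h3⟩
  have htier : μ.real {ω | X.servingTier p n ω = 0} = p.share (storeProb p n) 0 :=
    hX.assocProb_eq_share hp n 0
  have hs := (share_zero_pos hp hX n).ne'
  have hl := (loadPMF_pos hp (A_zero_pos hp) l).ne'
  have hD' : μ.real {ω | X.servingTier p n ω = 0 ∧ X.load 0 ω = l + 1} =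
      p.share (storeProb p n) 0 * p.loadPMF 0 l := by
    rw [← htier, ← hX.load_law 0 l]
    exact hX.measureReal_inter disjoint_compl_right (measurableSet_tier_assoc n 0) hload
  rw [backhaulProbAt, cond_real_apply hD, hset, hD', hX.measureReal_inter disjoint_compl_right
    (measurableSet_tier_assoc n 0) (MeasurableSet.inter hload (measurableSet_pickedEvent_compl l)),
    htier, hX.measureReal_load_inter_pickedEvent]
  field_simp

lemma backhaulAt_nonneg (hX : X.Law p μ) (l : ℕ) : 0 ≤ p.backhaulAt l := by
  rw [← hX.measureReal_pickedEvent l]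
  exact measureReal_nonneg

lemma backhaulAt_le_one (hX : X.Law p μ) (l : ℕ) : p.backhaulAt l ≤ 1 := by
  rw [← hX.measureReal_pickedEvent l]
  exact measureReal_le_one

lemma summable_backhaul (hX : X.Law p μ) (hp : p.Valid) :
    Summable fun l => p.backhaulAt l * p.loadPMF 0 l :=
  Summable.of_nonneg_of_le
    (fun l => mul_nonneg (hX.backhaulAt_nonneg l) (Params.loadPMF_nonneg hp 0 l))
    (fun l => mul_le_of_le_one_left (Params.loadPMF_nonneg hp 0 l) (hX.backhaulAt_le_one l))
    (Params.summable_loadPMF hp 0)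

/-- Up to a null set the event splits over the load into pieces, all independent of the association;
so conditioning on the tier changes nothing, and the pieces add up to the average over the load. -/
theorem backhaulProb_eq (hX : X.Law p μ) (hp : p.Valid) (n : ℕ) :
    X.backhaulProb p μ n = p.backhaul := by
  have hD := hX.measurableSet_tier n 0
  let E : Set Ω := ⋃ l : ℕ, ({ω | X.load 0 ω = l + 1} ∩ X.pickedEvent l)
  have hEl : ∀ l, MeasurableSet[X.sigmaOf assocSourcesᶜ]
      ({ω | X.load 0 ω = l + 1} ∩ X.pickedEvent l) := fun l =>
    MeasurableSet.inter (measurableSet_load (X := X) load_notMem (l + 1))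
      (measurableSet_pickedEvent_compl l)
  have hE : MeasurableSet[X.sigmaOf assocSourcesᶜ] E := MeasurableSet.iUnion hEl
  have hEae : {ω | p.R₀ ≤ X.backhaulRate p ω} =ᵐ[μ] E := by
    filter_upwards [hX.ae_load_pos hp 0] with ω hω
    refine propext ?_
    obtain ⟨l, hl⟩ := Nat.exists_eq_succ_of_ne_zero hω
    change p.R₀ ≤ X.backhaulRate p ω ↔ ω ∈ E
    rw [le_backhaulRate_iff hp hl]
    constructor
    · exact fun h => Set.mem_iUnion.2 ⟨l, hl, h⟩
    · intro h
      obtain ⟨l', hl', h'⟩ := Set.mem_iUnion.1 h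
      have h1 : X.load 0 ω = l' + 1 := hl'
      have : l' = l := by omega
      exact this ▸ h'
  have hEreal : μ.real E = p.backhaul := by
    have hdisj : Pairwise (Function.onFun Disjoint fun l : ℕ =>
        {ω | X.load 0 ω = l + 1} ∩ X.pickedEvent l) := by
      intro l l' hll
      refine Set.disjoint_left.2 fun ω h1 h2 => hll ?_
      have h1' : X.load 0 ω = l + 1 := h1.1
      have h2' : X.load 0 ω = l' + 1 := h2.1
      omega
    rw [Measure.real, measure_iUnion hdisj fun l => hX.sigmaOf_le _ _ (hEl l),
      ENNReal.tsum_toReal_eq fun l => measure_ne_top _ _, Params.backhaul]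
    exact tsum_congr fun l => (hX.measureReal_load_inter_pickedEvent l).trans (mul_comm _ _)
  have hinter : ({ω | X.servingTier p n ω = 0} ∩ {ω | p.R₀ ≤ X.backhaulRate p ω} : Set Ω) =ᵐ[μ]
      ({ω | X.servingTier p n ω = 0} ∩ E : Set Ω) := EventuallyEq.rfl.inter hEae
  have htier : μ.real {ω | X.servingTier p n ω = 0} = p.share (storeProb p n) 0 :=
    hX.assocProb_eq_share hp n 0
  have hs := (share_zero_pos hp hX n).ne'
  rw [backhaulProb, cond_real_apply hD, measureReal_congr hinter,
    hX.measureReal_inter disjoint_compl_right (measurableSet_tier_assoc n 0) hE, htier, hEreal]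
  field_simp

end Law

end Elements

/-! ### Assembly of the average delivery rate. -/

namespace Params

variable {p : Params}

/-- Helpers that store nothing requested have share zero, and the shares of the two tiers add up to
one. -/
lemma share_zero_zero (hp : p.Valid) : p.share 0 0 = 1 := by
  have h := sum_share hp (le_refl (0 : ℝ))
  rw [Fin.sum_univ_two] at h
  have h1 : p.share 0 1 = 0 := by simp [share, candProb]
  rwa [h1, add_zero] at h

end Params

namespace Elements

variable {Ω : Type*} {X : Elements Ω} {p : Params} [mΩ : MeasurableSpace Ω] {μ : Measure Ω}

lemma storeProb_of_mem_Mp {n : ℕ} (hn : n ∈ p.Mp) : storeProb p n = 0 := by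
  have h := Finset.mem_Icc.1 hn
  refine if_neg fun h' => ?_
  have := Finset.mem_Icc.1 h'
  omega

lemma storeProb_of_mem_Lp {n : ℕ} (hn : n ∈ p.Lp) : storeProb p n = p.pLp := if_pos hn

lemma totalRate_eq_of_forall {s a b c d e : ℝ}
    (hMp : ∀ n ∈ p.Mp, X.sucRate p μ s n 0 = a) (hLp : ∀ n ∈ p.Lp, X.sucRate p μ s n 1 = b ∧
      X.assocProb p μ n 0 = c ∧ X.accessProb p μ s n 0 = d ∧ X.backhaulProb p μ n = e) :
    X.totalRate p μ s = p.QMp * a + p.QLp * b + p.QLp * c * d * e * p.R₀ := by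
  have h1 : ∑ n ∈ p.Mp, p.q n * X.sucRate p μ s n 0 = p.QMp * a := by
    rw [Params.QMp, Finset.sum_mul]
    exact Finset.sum_congr rfl fun n hn => by rw [hMp n hn]
  have h2 : ∑ n ∈ p.Lp, p.q n * (X.sucRate p μ s n 1 +
      X.assocProb p μ n 0 * X.accessProb p μ s n 0 * X.backhaulProb p μ n * p.R₀) =
      p.QLp * (b + c * d * e * p.R₀) := by
    rw [Params.QLp, Finset.sum_mul]
    refine Finset.sum_congr rfl fun n hn => ?_
    obtain ⟨h1, h2, h3, h4⟩ := hLp n hn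
    rw [h1, h2, h3, h4]
  rw [totalRate, h1, h2]
  ring

variable [IsProbabilityMeasure μ]

namespace Law

lemma assocProb_Lp (hX : X.Law p μ) (hp : p.Valid) {n : ℕ} (hn : n ∈ p.Lp) (k : Tier) :
    X.assocProb p μ n k = p.ALp k := by
  rw [hX.assocProb_eq_share hp, storeProb_of_mem_Lp hn, Params.ALp_eq_share hp]

lemma sucRate_zero_Mp (hX : X.Law p μ) (hp : p.Valid) {n : ℕ} (hn : n ∈ p.Mp) :
    X.sucRate p μ 0 n 0 = p.rateMp := by
  rw [hX.sucRate_zero hp, storeProb_of_mem_Mp hn, Params.share_zero_zero hp, one_mul,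
    Params.rateMp]
  simp_rw [Params.termMp_eq hp]

lemma sucRate_zero_Lp (hX : X.Law p μ) (hp : p.Valid) {n : ℕ} (hn : n ∈ p.Lp) :
    X.sucRate p μ 0 n 1 = p.rateLp := by
  rw [hX.sucRate_zero hp, storeProb_of_mem_Lp hn, ← Params.ALp_eq_share hp, Params.rateLp]
  simp_rw [Params.termLp_eq hp]

lemma accessProb_zero_Lp (hX : X.Law p μ) (hp : p.Valid) {n : ℕ} (hn : n ∈ p.Lp) :
    X.accessProb p μ 0 n 0 = p.accessLp := by
  rw [hX.accessProb_zero hp, storeProb_of_mem_Lp hn, Params.accessLp]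
  simp_rw [Params.termAccess_eq hp]

lemma totalRate_zero (hX : X.Law p μ) (hp : p.Valid) :
    X.totalRate p μ 0 = p.QMp * p.rateMp + p.QLp * p.rateLp +
      p.QLp * p.ALp 0 * p.accessLp * p.backhaul * p.R₀ :=
  totalRate_eq_of_forall (fun _ hn => hX.sucRate_zero_Mp hp hn) fun n hn =>
    ⟨hX.sucRate_zero_Lp hp hn, hX.assocProb_Lp hp hn 0, hX.accessProb_zero_Lp hp hn,
      hX.backhaulProb_eq hp n⟩

lemma tendsto_totalRate (hX : X.Law p μ) (hp : p.Valid) :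
    Tendsto (fun s => X.totalRate p μ s) (𝓝[>] 0) (𝓝 (X.totalRate p μ 0)) := by
  unfold totalRate
  refine (tendsto_finsetSum _ fun n _ => (hX.tendsto_sucRate hp n 0).const_mul _).add
    (tendsto_finsetSum _ fun n _ => ((hX.tendsto_sucRate hp n 1).add ?_).const_mul _)
  exact (((hX.tendsto_accessProb hp n 0).const_mul _).mul_const _).mul_const _

end Law

end Elements

end HetNet

end

theorem corollary3 {Ω : Type*} [MeasurableSpace Ω] (μ : MeasureTheory.Measure Ω)
    [MeasureTheory.IsProbabilityMeasure μ] (p : HetNet.Params) (hp : p.Valid)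
    (X : HetNet.Elements Ω) (hX : X.Law p μ) :
    -- the sums and integrals of the closed expressions converge
    ((∀ r, p.R₀ ≤ r → Summable (p.termMp r) ∧ Summable (p.termLp r)) ∧
      MeasureTheory.IntegrableOn (fun r => ∑' l : ℕ, p.termMp r l) (Set.Ioi p.R₀) ∧
      MeasureTheory.IntegrableOn (fun r => ∑' l : ℕ, p.termLp r l) (Set.Ioi p.R₀) ∧
      Summable p.termAccess ∧ Summable (fun l => p.backhaulAt l * p.loadPMF 0 l)) ∧
    -- association with the MBSs, and the backhaul link
    (∀ n ∈ p.Lp, (∀ k, X.assocProb p μ n k = p.ALp k) ∧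
      (∀ l, X.backhaulProbAt p μ n l = p.backhaulAt l) ∧
      X.backhaulProb p μ n = p.backhaul) ∧
    -- without noise
    ((∀ n ∈ p.Mp, X.sucRate p μ 0 n 0 = p.rateMp) ∧
      (∀ n ∈ p.Lp, X.sucRate p μ 0 n 1 = p.rateLp ∧ X.accessProb p μ 0 n 0 = p.accessLp) ∧
      X.totalRate p μ 0 = p.QMp * p.rateMp + p.QLp * p.rateLp +
        p.QLp * p.ALp 0 * p.accessLp * p.backhaul * p.R₀) ∧
    -- limit of vanishing noise
    ((∀ n ∈ p.Mp, Filter.Tendsto (fun s => X.sucRate p μ s n 0)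
        (nhdsWithin 0 (Set.Ioi 0)) (nhds p.rateMp)) ∧
      (∀ n ∈ p.Lp, Filter.Tendsto (fun s => X.sucRate p μ s n 1)
          (nhdsWithin 0 (Set.Ioi 0)) (nhds p.rateLp) ∧
        Filter.Tendsto (fun s => X.accessProb p μ s n 0)
          (nhdsWithin 0 (Set.Ioi 0)) (nhds p.accessLp)) ∧
      Filter.Tendsto (fun s => X.totalRate p μ s) (nhdsWithin 0 (Set.Ioi 0))
        (nhds (p.QMp * p.rateMp + p.QLp * p.rateLp +
          p.QLp * p.ALp 0 * p.accessLp * p.backhaul * p.R₀))) := by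
  have hpa := hX.pa_nonneg
  have hc0 := HetNet.Params.pLp_nonneg (p := p)
  have hc1 := HetNet.Params.pLp_le_one hp
  refine ⟨⟨fun r hr => ⟨?_, ?_⟩, ?_, ?_, ?_, hX.summable_backhaul hp⟩,
    fun n hn => ⟨hX.assocProb_Lp hp hn, hX.backhaulProbAt_eq hp n, hX.backhaulProb_eq hp n⟩,
    ⟨fun n hn => hX.sucRate_zero_Mp hp hn,
      fun n hn => ⟨hX.sucRate_zero_Lp hp hn, hX.accessProb_zero_Lp hp hn⟩, hX.totalRate_zero hp⟩,
    fun n hn => ?_, fun n hn => ⟨?_, ?_⟩, ?_⟩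
  · exact (HetNet.Params.summable_rateTerm hp le_rfl zero_le_one hpa 0 hr).congr
      fun l => (HetNet.Params.termMp_eq hp r l).symm
  · exact (HetNet.Params.summable_rateTerm hp hc0 hc1 hpa 1 hr).congr
      fun l => (HetNet.Params.termLp_eq hp r l).symm
  · simp_rw [HetNet.Params.termMp_eq hp]
    exact (HetNet.Params.lintegral_tsum_rateTerm hp le_rfl zero_le_one hpa 0).1
  · simp_rw [HetNet.Params.termLp_eq hp]
    exact (HetNet.Params.lintegral_tsum_rateTerm hp hc0 hc1 hpa 1).1
  · exact (HetNet.Params.summable_accessTerm hp hc0 hc1 hpa 0).congr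
      fun l => (HetNet.Params.termAccess_eq hp l).symm
  · rw [← hX.sucRate_zero_Mp hp hn]
    exact hX.tendsto_sucRate hp n 0
  · rw [← hX.sucRate_zero_Lp hp hn]
    exact hX.tendsto_sucRate hp n 1
  · rw [← hX.accessProb_zero_Lp hp hn]
    exact hX.tendsto_accessProb hp n 0
  · rw [← hX.totalRate_zero hp]
    exact hX.tendsto_totalRate hp
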